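/- **Setting.** Let $n\in\mathbb N$, $d\ge 2$, $s\in\mathbb N$, $\delta>0$, $\Delta,\bar\Delta\ge 0$, $M,R,\sigma>0$, $\kappa_1>\kappa_0>0$, $l>1$. Write $\mathcal Q_\Delta(a)=\Delta(\lfloor a/\Delta\rfloor+\frac12)$ for $\Delta>0$ and $\mathcal Q_0(a)=a$ (applied entrywise to vectors); $\mathscr U([-\frac{\Delta}{2},\frac{\Delta}{2}])$ is the uniform law (the point mass at $0$ if $\Delta=0$); $\|X\|_{\psi_2}=\inf\{t>0:\mathbb E\exp(X^2/t^2)\le 2\}$, and $\|x\|_{\psi_2}=\sup_{\|v\|_2=1}\|v^\top x\|_{\psi_2}$ for a random vector $x$. Let $y_k=x_k^\top\theta^\star+\epsilon_k$, $k=1,\dots,n$, where the $x_k\in\mathbb R^d$ are i.i.d., zero-mean, with $\|x_k\|_{\psi_2}\le\sigma$ and $\kappa_0\le\lambda_{\min}(\Sigma^\star)\le\lambda_{\max}(\Sigma^\star)\le\kappa_1$ for $\Sigma^\star=\mathbb E(x_kx_k^\top)$; the $\epsilon_k$ are i.i.d. and independent of the $x_k$; $\mathbb E|y_k|^{2l}\le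 M$; and $\theta^\star\in\mathbb R^d$ has at most $s$ nonzero entries and $\|\theta^\star\|_2\le R$. The responses are truncated to $\widetilde y_k=\mathrm{sign}(y_k)\min\{|y_k|,\zeta_y\}$ and quantized to $\dot y_k=\mathcal Q_\Delta(\widetilde y_k+\phi_k)$ with uniform dither $\phi_k\sim\mathscr U([-\frac{\Delta}{2},\frac{\Delta}{2}])$. The covariates are quantized to $\dot x_k=\mathcal Q_{\bar\Delta}(x_k+\tau_k)$ with triangular dither, i.e. $\tau_k$ is distributed as the sum of two independent uniform vectors on $[-\frac{\bar\Delta}{2},\frac{\bar\Delta}{2}]^d$. All the $x_k,\epsilon_k,\phi_k,\tau_k$ are mutually independent. Let $$Q=\frac1n\sum_{k=1}^n\dot x_k\dot x_k^\top-\frac{\bar\Delta^2}{4}I_d,\qquad b=\frac1n\sum_{k=1}^n\dot y_k\dot x_k,\qquad \mathcal S=\{\theta\in\mathbb R^d:\|\theta\|_1\le R\sqrt s\}$$ (the matrix $Q$ need not be positive semi-definite). A *stationary point* is a $\widetilde\theta\in\mathcal S$ such that, for some subgradient $g$ of $\|\cdot\|_1$ at $\widetilde\theta$, $$\langle Q\widetilde\theta-b+\lambda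 g,\ \theta-\widetilde\theta\rangle\ge 0\qquad\text{for all }\theta\in\mathcal S.$$ **Theorem.** There are absolute constants $C_2,C_3>0$ such that, for all $l>1$ and $0<a_1\le a_2$, there is $C_0=C_0(l,a_1,a_2)>0$ such that for every $C_1\ge C_0$ there are $C,C'>0$ depending only on $l,a_1,a_2,C_1$ with the following property. For all $(\kappa_0,\sigma,\Delta,\bar\Delta,M,R)$ as above there is $c>0$, depending only on these six numbers and on $l,a_1,a_2,C_1$, such that in the above setting, for any $D\in\{\Delta,\bar\Delta\}$, if $$a_1\Big(\frac{\sigma M^{1/l}}{\sigma+D}\,\frac{n}{\delta\log d}\Big)^{1/2}\le\zeta_y\le a_2\Big(\frac{\sigma M^{1/l}}{\sigma+D}\,\frac{n}{\delta\log d}\Big)^{1/2},$$ $$\lambda=C_1\frac{(\sigma+\bar\Delta)^2}{\sqrt{\kappa_0}}\big(\Delta+M^{1/(2l)}\big)\sqrt{\frac{\delta\log d}{n}},\qquad n\ge c\,\delta s\log d,$$ then with probability at least $1-8d^{1-\delta}-C_2\exp(-C_3n)$ every stationary point $\widetilde\theta$ satisfies $$\|\widetilde\theta-\theta^\star\|_2\le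 C\,\mathscr L\sqrt{\frac{\delta s\log d}{n}}\qquad\text{and}\qquad\|\widetilde\theta-\theta^\star\|_1\le C'\,\mathscr L\,s\sqrt{\frac{\delta\log d}{n}},\qquad \mathscr L=\frac{(\sigma+\bar\Delta)^2(\Delta+M^{1/(2l)})}{\kappa_0^{3/2}}.$$ (For $n=0$, which the hypotheses allow only if $s=0$, quotients by $n$ are read as $0$.) -/

import Mathlib

open MeasureTheory ProbabilityTheory
open scoped ENNReal Matrix

noncomputable section

namespace QCS

/-- The `ℓ₁` norm of a vector. -/
def l1Norm {d : ℕ} (v : Fin d → ℝ) : ℝ := ∑ i, |v i|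

/-- The `ℓ₂` norm of a vector. -/
def l2Norm {d : ℕ} (v : Fin d → ℝ) : ℝ := Real.sqrt (∑ i, v i ^ 2)

/-- `v` has at most `s` nonzero entries. -/
def IsSparse {d : ℕ} (s : ℕ) (v : Fin d → ℝ) : Prop :=
  (Finset.univ.filter (fun i => v i ≠ 0)).card ≤ s

/-- The uniform quantizer `a ↦ Δ (⌊a / Δ⌋ + 1/2)`; level `0` means no quantization. -/
def quantize (Δ a : ℝ) : ℝ := if Δ = 0 then a else Δ * ((⌊a / Δ⌋ : ℝ) + 1 / 2)

/-- Truncation of a scalar at the threshold `ζ`. -/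
def truncate (ζ a : ℝ) : ℝ := Real.sign a * min |a| ζ

/-- The uniform distribution on `[-Δ/2, Δ/2]`; the point mass at `0` if `Δ = 0`. -/
def uniformDither (Δ : ℝ) : Measure ℝ :=
  if Δ = 0 then Measure.dirac 0 else ProbabilityTheory.cond volume (Set.Icc (-(Δ / 2)) (Δ / 2))

/-- The uniform distribution on the cube `[-Δ/2, Δ/2]^d`. -/
def uniformCube (d : ℕ) (Δ : ℝ) : Measure (Fin d → ℝ) :=
  Measure.pi (fun _ => uniformDither Δ)

/-- The law of the sum of two independent uniform vectors in `[-Δ/2, Δ/2]^d`. -/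
def triangularDither (d : ℕ) (Δ : ℝ) : Measure (Fin d → ℝ) :=
  Measure.conv (uniformCube d Δ) (uniformCube d Δ)

/-- The sub-Gaussian norm `inf {t > 0 : E exp (X² / t²) ≤ 2}`, with value `∞` if there is
no such `t`. -/
def psi2Norm {Ω : Type*} [MeasurableSpace Ω] (μ : Measure Ω) (X : Ω → ℝ) : ℝ≥0∞ :=
  sInf {r : ℝ≥0∞ | ∃ t : ℝ, 0 < t ∧ r = ENNReal.ofReal t ∧
    ∫⁻ ω, ENNReal.ofReal (Real.exp (X ω ^ 2 / t ^ 2)) ∂μ ≤ 2}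

/-- The sub-Gaussian norm of a random vector: the supremum over unit directions. -/
def psi2NormVec {Ω : Type*} [MeasurableSpace Ω] {d : ℕ} (μ : Measure Ω)
    (x : Ω → Fin d → ℝ) : ℝ≥0∞ :=
  ⨆ (v : Fin d → ℝ) (_ : l2Norm v = 1), psi2Norm μ (fun ω => v ⬝ᵥ x ω)

/-- The matrix `E (x xᵀ)`. -/
def secondMoment {Ω : Type*} [MeasurableSpace Ω] {d : ℕ} (μ : Measure Ω)
    (x : Ω → Fin d → ℝ) : Matrix (Fin d) (Fin d) ℝ :=
  Matrix.of fun i j => ∫ ω, x ω i * x ω j ∂μ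

/-- The response `y = xᵀ θ + ε` of the linear model. -/
def response {Ω : Type*} {d : ℕ} (θ : Fin d → ℝ) (x : Ω → Fin d → ℝ) (ε : Ω → ℝ) (ω : Ω) : ℝ :=
  x ω ⬝ᵥ θ + ε ω

/-- The sampling scheme: i.i.d. covariates `x k`, i.i.d. noise `ε k` independent of the
covariates, uniform dithers `φ k` (level `Δ`, for the responses) and triangular dither vectors
`τ k` (level `Δb`, for the covariates). The last four fields together say that all the `4 n`
random elements are mutually independent. -/
structure SamplingScheme {Ω : Type*} [MeasurableSpace Ω] (μ : Measure Ω) {n d : ℕ} (Δ Δb : ℝ)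
    (x : Fin n → Ω → Fin d → ℝ) (ε : Fin n → Ω → ℝ) (φ : Fin n → Ω → ℝ)
    (τ : Fin n → Ω → Fin d → ℝ) : Prop where
  measurable_x : ∀ k, Measurable (x k)
  measurable_ε : ∀ k, Measurable (ε k)
  measurable_φ : ∀ k, Measurable (φ k)
  measurable_τ : ∀ k, Measurable (τ k)
  identDistrib_x : ∀ j k, IdentDistrib (x j) (x k) μ μ
  identDistrib_ε : ∀ j k, IdentDistrib (ε j) (ε k) μ μ
  law_φ : ∀ k, μ.map (φ k) = uniformDither Δ
  law_τ : ∀ k, μ.map (τ k) = triangularDither d Δb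
  indep_x_ε : ∀ k, IndepFun (x k) (ε k) μ
  indep_φ_τ : ∀ k, IndepFun (φ k) (τ k) μ
  indep_signal_dither : ∀ k,
    IndepFun (fun ω => (x k ω, ε k ω)) (fun ω => (φ k ω, τ k ω)) μ
  indep_samples : iIndepFun (fun k ω => (x k ω, ε k ω, φ k ω, τ k ω)) μ

/-- The quantized covariate: entrywise `quantize Δb (x + τ)`. -/
def quantizedCovariate {d : ℕ} (Δb : ℝ) (x τ : Fin d → ℝ) : Fin d → ℝ :=
  fun i => quantize Δb (x i + τ i)

/-- The quantized response: `quantize Δ (y truncated at ζ + φ)`. -/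
def quantizedResponse (Δ ζ y φ : ℝ) : ℝ := quantize Δ (truncate ζ y + φ)

/-- `(1/n) ∑ₖ xₖ xₖᵀ - (Δb²/4) I` for (quantized) covariates `xₖ`. -/
def matQ {n d : ℕ} (Δb : ℝ) (x : Fin n → Fin d → ℝ) : Matrix (Fin d) (Fin d) ℝ :=
  (1 / (n : ℝ)) • (∑ k, Matrix.vecMulVec (x k) (x k)) - (Δb ^ 2 / 4) • (1 : Matrix _ _ ℝ)

/-- `(1/n) ∑ₖ yₖ xₖ` for (quantized) pairs `(xₖ, yₖ)`. -/
def vecB {n d : ℕ} (x : Fin n → Fin d → ℝ) (y : Fin n → ℝ) : Fin d → ℝ :=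
  (1 / (n : ℝ)) • ∑ k, y k • x k

/-- The subdifferential of `f` at `θ`. -/
def subdifferential {d : ℕ} (f : (Fin d → ℝ) → ℝ) (θ : Fin d → ℝ) : Set (Fin d → ℝ) :=
  {g | ∀ u, f θ + g ⬝ᵥ (u - θ) ≤ f u}

/-- `θ` is a stationary point of
`minimize (1/2) θᵀ Q θ - bᵀ θ + lam ‖θ‖₁ subject to ‖θ‖₁ ≤ r`: it is feasible and, for some
subgradient `g` of the `ℓ₁` norm at `θ`, `⟨Q θ - b + lam g, u - θ⟩ ≥ 0` for all feasible `u`. -/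
def IsStationary {d : ℕ} (Q : Matrix (Fin d) (Fin d) ℝ) (b : Fin d → ℝ) (lam r : ℝ)
    (θ : Fin d → ℝ) : Prop :=
  l1Norm θ ≤ r ∧ ∃ g ∈ subdifferential l1Norm θ,
    ∀ u : Fin d → ℝ, l1Norm u ≤ r → 0 ≤ (Q *ᵥ θ - b + lam • g) ⬝ᵥ (u - θ)

/-- The factor `(σ + Δb)² (Δ + M^{1/(2l)}) / κ₀^{3/2}`. -/
def errorFactor (l κ₀ σ Δ Δb M : ℝ) : ℝ :=
  (σ + Δb) ^ 2 * (Δ + M ^ (1 / (2 * l))) / κ₀ ^ (3 / 2 : ℝ)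

end QCS

end

/-! The argument separates a deterministic part from the construction of a good event.

Deterministic part (`stationary_error_bound`). The true parameter is feasible, so stationarity can
be tested against it. If every coordinate of the gradient `b - Q θs` is at most `lam / 2`, the usual
Lasso computation bounds the quadratic form of `Q` at the error `Υ`. Since `Q` may be indefinite,
only a restricted convexity `κ‖Υ‖₂² - η‖Υ‖₁² ≤ Υᵀ Q Υ` is available. The constraint gives `‖Υ‖₁ ≤ 2
R √s`, hence `η‖Υ‖₁² ≤ (lam / 4) ‖Υ‖₁` once `η` is small, and the negative term is absorbed by the
regularization. This holds at every stationary point, with no use of global minimality.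

Gradient. The uniform dither makes the quantized response unbiased for the truncated one; the
triangular dither also makes the quantization noise of the covariates have variance `Δb² / 4`
whatever the signal, so `Q` is unbiased for the second-moment matrix (`secondMoment_covariate`).
What remains is two centered sums and the truncation bias. With `r = √(δ log d / n)`, a Bernstein
bound makes each sum of order `r` outside probability `2 d ^ (-δ)` per coordinate. For the response,
which has only `2 l` moments, this needs `r ζ` bounded (`measureReal_cross_ge_le`); conversely `ζ ≳
1 / r` makes the bias of order `r ^ l`, negligible because `l > 1` (`abs_integral_truncate_sub_le`).

Restricted convexity. At a fixed vector the lower tail of the quadratic form is exponentially small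
in `n`. A union bound handles all `(2 d) ^ m` sums of `m` signed basis vectors, with `m` of order `n
/ log d`, and Maurey's averaging (`restricted_strong_convexity`) extends the bound to all vectors
with `η` of order `1 / m`. Then `η R √s` is of order `r · (r √s)`, below `lam` when `n ≥ c δ s log
d`.

The events are assembled in `exists_good_event`; the theorem then only selects constants. -/

namespace QCS

/-! ### The quantization error as a periodic function -/

section Quantizer

lemma measurable_quantize (Δ : ℝ) : Measurable (quantize Δ) := by
  unfold quantize
  split_ifs
  · exact measurable_id
  · have : Measurable fun a : ℝ => (⌊a / Δ⌋ : ℝ) :=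
      (measurable_from_top (f := fun z : ℤ => (z : ℝ))).comp
        (Int.measurable_floor.comp (measurable_id.div_const Δ))
    fun_prop

lemma quantize_sub_self {Δ : ℝ} (hΔ : 0 < Δ) (a : ℝ) :
    quantize Δ a - a = Δ * (1 / 2 - Int.fract (a / Δ)) := by
  have h : a = Δ * (a / Δ) := by field_simp
  rw [quantize, if_neg hΔ.ne', Int.fract]
  nth_rewrite 2 [h]
  ring

lemma abs_quantize_sub_le {Δ : ℝ} (hΔ : 0 ≤ Δ) (a : ℝ) : |quantize Δ a - a| ≤ Δ / 2 := by
  rcases hΔ.eq_or_lt with rfl | h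
  · simp [quantize]
  · rw [quantize_sub_self h, abs_mul, abs_of_pos h]
    have h0 := Int.fract_nonneg (a / Δ)
    have h1 := (Int.fract_lt_one (a / Δ)).le
    have : |1 / 2 - Int.fract (a / Δ)| ≤ 1 / 2 := by
      rw [abs_le]; constructor <;> linarith
    nlinarith

lemma periodic_quantize_sub {Δ : ℝ} (hΔ : 0 < Δ) :
    Function.Periodic (fun a => quantize Δ a - a) Δ := by
  intro a
  simp only [quantize_sub_self hΔ]
  rw [add_div, div_self hΔ.ne', Int.fract_add_one]

/-- The error is `Δ`-periodic, so its integral over a full period does not see the shift `a`; on the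
base period it is `Δ / 2 - u`. -/
lemma integral_period_quantize_sub {Δ : ℝ} (hΔ : 0 < Δ) (p : ℕ) (a : ℝ) :
    ∫ u in (-(Δ / 2))..(Δ / 2), (quantize Δ (a + u) - (a + u)) ^ p
      = ∫ u in (0 : ℝ)..Δ, (Δ / 2 - u) ^ p := by
  have hper : Function.Periodic (fun a => (quantize Δ a - a) ^ p) Δ := fun x => by
    have := periodic_quantize_sub hΔ x
    simp only at this ⊢
    rw [this]
  rw [intervalIntegral.integral_comp_add_left (fun u => (quantize Δ u - u) ^ p)]
  have h1 : a + Δ / 2 = (a + -(Δ / 2)) + Δ := by ring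
  rw [h1, hper.intervalIntegral_add_eq _ 0, zero_add]
  -- The period has to be closed on the left: at `u = Δ` the floor jumps and the formula for the
  -- error fails.
  rw [intervalIntegral.integral_of_le hΔ.le, intervalIntegral.integral_of_le hΔ.le,
    ← integral_Ico_eq_integral_Ioc, ← integral_Ico_eq_integral_Ioc]
  refine setIntegral_congr_fun measurableSet_Ico fun u hu => ?_
  rw [quantize_sub_self hΔ, Int.fract_eq_self.2 ⟨div_nonneg hu.1 hΔ.le, (div_lt_one hΔ).2 hu.2⟩]
  congr 1
  field_simp

end Quantizer

/-! ### Uniform and triangular dithers -/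

section Dither

lemma isProbabilityMeasure_uniformDither {Δ : ℝ} (hΔ : 0 ≤ Δ) :
    IsProbabilityMeasure (uniformDither Δ) := by
  unfold uniformDither
  split_ifs with h
  · infer_instance
  · have h' : 0 < Δ := lt_of_le_of_ne hΔ (Ne.symm h)
    refine cond_isProbabilityMeasure_of_finite ?_ ?_ <;> simp [Real.volume_Icc, h']

lemma ae_abs_le_uniformDither {Δ : ℝ} (hΔ : 0 ≤ Δ) : ∀ᵐ u ∂(uniformDither Δ), |u| ≤ Δ / 2 := by
  unfold uniformDither
  split_ifs with h
  · subst h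
    rw [ae_dirac_iff (measurableSet_le (by fun_prop) (by fun_prop))]
    simp
  · refine (ae_cond_of_forall_mem measurableSet_Icc fun u hu => ?_)
    exact abs_le.2 hu

lemma integral_uniformDither {Δ : ℝ} (hΔ : 0 < Δ) (f : ℝ → ℝ) :
    ∫ u, f u ∂(uniformDither Δ) = Δ⁻¹ * ∫ u in (-(Δ / 2))..(Δ / 2), f u := by
  rw [uniformDither, if_neg hΔ.ne', ProbabilityTheory.cond, integral_smul_measure, Real.volume_Icc,
    integral_Icc_eq_integral_Ioc, intervalIntegral.integral_of_le (by linarith), smul_eq_mul]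
  congr 1
  rw [ENNReal.toReal_inv, ENNReal.toReal_ofReal (by linarith)]
  congr 1
  ring

lemma integrable_uniformDither {Δ : ℝ} (hΔ : 0 ≤ Δ) {f : ℝ → ℝ} (hf : Measurable f) (C : ℝ)
    (h : ∀ u, |u| ≤ Δ / 2 → |f u| ≤ C) : Integrable f (uniformDither Δ) := by
  have := isProbabilityMeasure_uniformDither hΔ
  exact Integrable.of_bound hf.aestronglyMeasurable C
    ((ae_abs_le_uniformDither hΔ).mono fun u hu => h u hu)

lemma integral_id_uniformDither {Δ : ℝ} (hΔ : 0 ≤ Δ) : ∫ u, u ∂(uniformDither Δ) = 0 := by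
  rcases hΔ.eq_or_lt with rfl | h
  · simp [uniformDither]
  · rw [integral_uniformDither h, integral_id]; ring

lemma integral_sq_uniformDither {Δ : ℝ} (hΔ : 0 ≤ Δ) :
    ∫ u, u ^ 2 ∂(uniformDither Δ) = Δ ^ 2 / 12 := by
  rcases hΔ.eq_or_lt with rfl | h
  · simp [uniformDither]
  · rw [integral_uniformDither h, integral_pow]; push_cast; field_simp; ring

/-- Under a uniform dither the error sweeps exactly one period, so it is itself uniform on `[-Δ/2,
Δ/2]` for every `a`; this and the next lemma are its first two moments. -/
lemma integral_quantError {Δ : ℝ} (hΔ : 0 ≤ Δ) (a : ℝ) :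
    ∫ u, (quantize Δ (a + u) - (a + u)) ∂(uniformDither Δ) = 0 := by
  rcases hΔ.eq_or_lt with rfl | h
  · simp [quantize]
  · have := integral_period_quantize_sub h 1 a
    simp only [pow_one] at this
    rw [integral_uniformDither h, this, intervalIntegral.integral_comp_sub_left (fun u => u),
      integral_id]
    ring

lemma integral_quantError_sq {Δ : ℝ} (hΔ : 0 ≤ Δ) (a : ℝ) :
    ∫ u, (quantize Δ (a + u) - (a + u)) ^ 2 ∂(uniformDither Δ) = Δ ^ 2 / 12 := by
  rcases hΔ.eq_or_lt with rfl | h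
  · simp [quantize]
  · rw [integral_uniformDither h, integral_period_quantize_sub h 2 a,
      intervalIntegral.integral_comp_sub_left (fun u => u ^ 2), integral_pow]
    push_cast; field_simp; ring

/-- A uniform dither makes the quantizer unbiased. -/
lemma integral_quantize_uniformDither {Δ : ℝ} (hΔ : 0 ≤ Δ) (a : ℝ) :
    ∫ u, quantize Δ (a + u) ∂(uniformDither Δ) = a := by
  have := isProbabilityMeasure_uniformDither hΔ
  have hq := measurable_quantize Δ
  have h1 : Integrable (fun u => quantize Δ (a + u) - (a + u)) (uniformDither Δ) :=
    integrable_uniformDither hΔ (by fun_prop) (Δ / 2) fun u _ => abs_quantize_sub_le hΔ _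
  have h2 : Integrable (fun u : ℝ => u) (uniformDither Δ) :=
    integrable_uniformDither hΔ (by fun_prop) (Δ / 2) fun u hu => hu
  calc ∫ u, quantize Δ (a + u) ∂(uniformDither Δ)
      = ∫ u, ((quantize Δ (a + u) - (a + u)) + (a + u)) ∂(uniformDither Δ) := by
        congr 1; ext u; ring
    _ = a := by
        have h3 : Integrable (fun u => a + u) (uniformDither Δ) := (integrable_const a).add h2
        rw [integral_add h1 h3, integral_quantError hΔ,
          integral_add (integrable_const a) h2, integral_id_uniformDither hΔ]
        simp

/-- The law of the sum of two independent uniform dithers. -/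
noncomputable def triangularLaw (Δ : ℝ) : Measure ℝ := Measure.conv (uniformDither Δ)
    (uniformDither Δ)

lemma isProbabilityMeasure_triangularLaw {Δ : ℝ} (hΔ : 0 ≤ Δ) :
    IsProbabilityMeasure (triangularLaw Δ) := by
  have := isProbabilityMeasure_uniformDither hΔ
  unfold triangularLaw
  infer_instance

lemma ae_abs_le_triangularLaw {Δ : ℝ} (hΔ : 0 ≤ Δ) : ∀ᵐ u ∂(triangularLaw Δ), |u| ≤ Δ := by
  have := isProbabilityMeasure_uniformDither hΔ
  unfold triangularLaw Measure.conv
  rw [ae_map_iff (by fun_prop) (measurableSet_le (by fun_prop) (by fun_prop))]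
  have h1 := Measure.quasiMeasurePreserving_fst (μ := uniformDither Δ) (ν := uniformDither Δ)
    |>.ae (ae_abs_le_uniformDither hΔ)
  have h2 := Measure.quasiMeasurePreserving_snd (μ := uniformDither Δ) (ν := uniformDither Δ)
    |>.ae (ae_abs_le_uniformDither hΔ)
  filter_upwards [h1, h2] with p hp1 hp2
  calc |p.1 + p.2| ≤ |p.1| + |p.2| := abs_add_le _ _
    _ ≤ Δ := by linarith

lemma integrable_triangularLaw {Δ : ℝ} (hΔ : 0 ≤ Δ) {f : ℝ → ℝ} (hf : Measurable f) (C : ℝ)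
    (h : ∀ u, |u| ≤ Δ → |f u| ≤ C) : Integrable f (triangularLaw Δ) := by
  have := isProbabilityMeasure_triangularLaw hΔ
  exact Integrable.of_bound hf.aestronglyMeasurable C
    ((ae_abs_le_triangularLaw hΔ).mono fun u hu => h u hu)

lemma integral_triangularLaw {Δ : ℝ} (hΔ : 0 ≤ Δ) {f : ℝ → ℝ} (hf : Measurable f) (C : ℝ)
    (h : ∀ u, |u| ≤ Δ → |f u| ≤ C) :
    ∫ u, f u ∂(triangularLaw Δ)
      = ∫ u, ∫ v, f (u + v) ∂(uniformDither Δ) ∂(uniformDither Δ) := by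
  have := isProbabilityMeasure_uniformDither hΔ
  exact integral_conv (integrable_triangularLaw hΔ hf C h)

lemma abs_quantize_le {Δ a u : ℝ} (hΔ : 0 ≤ Δ) (hu : |u| ≤ Δ) :
    |quantize Δ (a + u) - a| ≤ 3 * Δ / 2 := by
  have h1 := abs_quantize_sub_le hΔ (a + u)
  rw [abs_le] at *
  constructor <;> linarith [h1.1, h1.2, hu.1, hu.2]

/-- Integrating out one of the two uniform dithers already gives `a + u`, and the other dither `u`
is centered. -/
lemma integral_quantize_triangularLaw {Δ : ℝ} (hΔ : 0 ≤ Δ) (a : ℝ) :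
    ∫ u, quantize Δ (a + u) ∂(triangularLaw Δ) = a := by
  have := isProbabilityMeasure_uniformDither hΔ
  have hq := measurable_quantize Δ
  rw [integral_triangularLaw hΔ (by fun_prop) (|a| + 3 * Δ / 2)]
  · simp_rw [← add_assoc, integral_quantize_uniformDither hΔ]
    rw [integral_add (integrable_const a) (integrable_uniformDither hΔ (by fun_prop) (Δ / 2)
      fun u hu => hu), integral_id_uniformDither hΔ]
    simp
  · intro u hu
    have h1 := abs_quantize_le (a := a) hΔ hu
    calc |quantize Δ (a + u)| = |a + (quantize Δ (a + u) - a)| := by ring_nf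
      _ ≤ |a| + |quantize Δ (a + u) - a| := abs_add_le _ _
      _ ≤ _ := by linarith

/-- A triangular dither makes the second moment of the quantization noise independent of the
signal. -/
lemma integral_quantize_sub_sq_triangularLaw {Δ : ℝ} (hΔ : 0 ≤ Δ) (a : ℝ) :
    ∫ u, (quantize Δ (a + u) - a) ^ 2 ∂(triangularLaw Δ) = Δ ^ 2 / 4 := by
  have := isProbabilityMeasure_uniformDither hΔ
  have hq := measurable_quantize Δ
  have hw : Measurable fun b => quantize Δ b - b := by fun_prop
  set U := uniformDither Δ
  set w : ℝ → ℝ := fun b => quantize Δ b - b with hw_def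
  have hwb : ∀ b, |w b| ≤ Δ / 2 := abs_quantize_sub_le hΔ
  have hw1 : ∀ b, ∫ v, w (b + v) ∂U = 0 := integral_quantError hΔ
  have hw2 : ∀ b, ∫ v, w (b + v) ^ 2 ∂U = Δ ^ 2 / 12 := integral_quantError_sq hΔ
  have hU1 : ∫ u, u ∂U = 0 := integral_id_uniformDither hΔ
  have hU2 : ∫ u, u ^ 2 ∂U = Δ ^ 2 / 12 := integral_sq_uniformDither hΔ
  have habs : ∀ᵐ p ∂(U.prod U), |p.1| ≤ Δ / 2 ∧ |p.2| ≤ Δ / 2 := by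
    have h1 := Measure.quasiMeasurePreserving_fst (μ := U) (ν := U)
      |>.ae (ae_abs_le_uniformDither hΔ)
    have h2 := Measure.quasiMeasurePreserving_snd (μ := U) (ν := U)
      |>.ae (ae_abs_le_uniformDither hΔ)
    exact h1.and h2
  have hint : ∀ {f : ℝ × ℝ → ℝ}, Measurable f → ∀ C : ℝ,
      (∀ p : ℝ × ℝ, |p.1| ≤ Δ / 2 → |p.2| ≤ Δ / 2 → |f p| ≤ C) → Integrable f (U.prod U) :=
    fun hf C h => Integrable.of_bound hf.aestronglyMeasurable C
      (habs.mono fun p hp => h p hp.1 hp.2)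
  rw [integral_triangularLaw hΔ (by fun_prop) ((3 * Δ / 2) ^ 2)]
  swap
  · intro u hu
    rw [abs_pow]
    exact pow_le_pow_left₀ (abs_nonneg _) (abs_quantize_le hΔ hu) 2
  -- The noise is `u + v + w`, with `w` the error at `a + u + v`. Each square contributes `Δ² / 12`.
  -- The product `u w` vanishes by integrating over `v` first and `v w` by integrating over `u`
  -- first, which is why the last summand is written with `a + v + u`.
  have hexp : ∀ u v, (quantize Δ (a + (u + v)) - a) ^ 2
      = (u ^ 2 + v ^ 2 + w (a + u + v) ^ 2 + 2 * (u * v))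
        + (2 * (u * w (a + u + v)) + 2 * (v * w (a + v + u))) := by
    intro u v
    simp only [hw_def]
    rw [show a + v + u = a + u + v by ring, ← add_assoc]
    ring
  have i1 : Integrable (fun p : ℝ × ℝ => p.1 ^ 2) (U.prod U) := by
    refine hint (by fun_prop) ((Δ / 2) ^ 2) fun p h1 _ => ?_
    rw [abs_pow]; exact pow_le_pow_left₀ (abs_nonneg _) h1 2
  have i2 : Integrable (fun p : ℝ × ℝ => p.2 ^ 2) (U.prod U) := by
    refine hint (by fun_prop) ((Δ / 2) ^ 2) fun p _ h1 => ?_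
    rw [abs_pow]; exact pow_le_pow_left₀ (abs_nonneg _) h1 2
  have i3 : Integrable (fun p : ℝ × ℝ => w (a + p.1 + p.2) ^ 2) (U.prod U) := by
    refine hint (by fun_prop) ((Δ / 2) ^ 2) fun p _ _ => ?_
    rw [abs_pow]; exact pow_le_pow_left₀ (abs_nonneg _) (hwb _) 2
  have i4 : Integrable (fun p : ℝ × ℝ => 2 * (p.1 * p.2)) (U.prod U) := by
    refine (hint (by fun_prop) (Δ / 2 * (Δ / 2)) fun p h1 h2 => ?_).const_mul 2
    rw [abs_mul]; gcongr
  have i5 : Integrable (fun p : ℝ × ℝ => 2 * (p.1 * w (a + p.1 + p.2))) (U.prod U) := by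
    refine (hint (by fun_prop) (Δ / 2 * (Δ / 2)) fun p h1 h2 => ?_).const_mul 2
    rw [abs_mul]; gcongr; exact hwb _
  have i6 : Integrable (fun p : ℝ × ℝ => 2 * (p.2 * w (a + p.2 + p.1))) (U.prod U) := by
    refine (hint (by fun_prop) (Δ / 2 * (Δ / 2)) fun p h1 h2 => ?_).const_mul 2
    rw [abs_mul]; gcongr; exact hwb _
  have j1 : Integrable (fun p : ℝ × ℝ => p.1 ^ 2 + p.2 ^ 2) (U.prod U) := i1.add i2
  have j2 : Integrable (fun p : ℝ × ℝ => p.1 ^ 2 + p.2 ^ 2 + w (a + p.1 + p.2) ^ 2) (U.prod U) :=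
    j1.add i3
  have j3 : Integrable (fun p : ℝ × ℝ => p.1 ^ 2 + p.2 ^ 2 + w (a + p.1 + p.2) ^ 2
    + 2 * (p.1 * p.2)) (U.prod U) := j2.add i4
  have j4 : Integrable (fun p : ℝ × ℝ => 2 * (p.1 * w (a + p.1 + p.2))
    + 2 * (p.2 * w (a + p.2 + p.1))) (U.prod U) := i5.add i6
  have j5 : Integrable (fun p : ℝ × ℝ => p.1 ^ 2 + p.2 ^ 2 + w (a + p.1 + p.2) ^ 2
    + 2 * (p.1 * p.2) + (2 * (p.1 * w (a + p.1 + p.2))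
    + 2 * (p.2 * w (a + p.2 + p.1)))) (U.prod U) := j3.add j4
  have key : ∫ u, ∫ v, (quantize Δ (a + (u + v)) - a) ^ 2 ∂U ∂U
      = ∫ p : ℝ × ℝ, ((p.1 ^ 2 + p.2 ^ 2 + w (a + p.1 + p.2) ^ 2 + 2 * (p.1 * p.2))
        + (2 * (p.1 * w (a + p.1 + p.2)) + 2 * (p.2 * w (a + p.2 + p.1)))) ∂(U.prod U) := by
    rw [integral_prod _ j5]
    simp only [hexp]
  rw [key, integral_add j3 j4, integral_add j2 i4, integral_add j1 i3, integral_add i1 i2,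
    integral_add i5 i6, integral_prod _ i1, integral_prod _ i2, integral_prod _ i3,
    integral_prod _ i4, integral_prod _ i5, integral_prod_symm _ i6]
  simp only [hw1, hw2, integral_const_mul, integral_const, hU2]
  have hU3 : ∀ u : ℝ, ∫ v, u * v ∂U = 0 := fun u => by
    rw [integral_const_mul u (fun v : ℝ => v), hU1, mul_zero]
  simp only [hU3, integral_zero]
  simp [hU2]
  ring

/-- The triangular dither vector has independent coordinates. -/
lemma triangularDither_eq_pi (d : ℕ) {Δ : ℝ} (hΔ : 0 ≤ Δ) :
    triangularDither d Δ = Measure.pi fun _ => triangularLaw Δ := by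
  have := isProbabilityMeasure_uniformDither hΔ
  unfold triangularDither triangularLaw uniformCube Measure.conv
  rw [← Measure.pi_map_pi (μ := fun _ : Fin d => (uniformDither Δ).prod (uniformDither Δ))
    (f := fun _ p => p.1 + p.2) (fun _ => by fun_prop),
    ← (measurePreserving_arrowProdEquivProdArrow ℝ ℝ (Fin d) (fun _ => uniformDither Δ)
      (fun _ => uniformDither Δ)).map_eq, Measure.map_map (by fun_prop) (by fun_prop)]
  rfl

end Dither

end QCS

namespace QCS

/-! ### Squared-exponential moments -/

section SubGaussian

lemma lintegral_exp_sq_gaussianReal :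
    ∫⁻ g, ENNReal.ofReal (Real.exp (g ^ 2 / 4)) ∂(gaussianReal 0 1) ≤ 2 := by
  rw [gaussianReal_of_var_ne_zero 0 one_ne_zero,
    lintegral_withDensity_eq_lintegral_mul _ (measurable_gaussianPDF 0 1) (by fun_prop)]
  simp only [Pi.mul_apply]
  have h : ∀ x : ℝ, gaussianPDF 0 1 x * ENNReal.ofReal (Real.exp (x ^ 2 / 4))
      = ENNReal.ofReal ((√(2 * Real.pi))⁻¹ * Real.exp (-(1 / 4) * x ^ 2)) := fun x => by
    rw [gaussianPDF, ← ENNReal.ofReal_mul (gaussianPDFReal_nonneg _ _ _), gaussianPDFReal,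
      mul_assoc, ← Real.exp_add]
    norm_num
    congr 3
    ring
  simp_rw [h]
  rw [← ofReal_integral_eq_lintegral_ofReal
    ((integrable_exp_neg_mul_sq (by norm_num)).const_mul _) (ae_of_all _ fun x => by positivity),
    integral_const_mul, integral_gaussian, ← ENNReal.ofReal_ofNat 2]
  refine ENNReal.ofReal_le_ofReal ?_
  rw [← Real.sqrt_inv, ← Real.sqrt_mul (by positivity), Real.sqrt_le_left (by norm_num)]
  field_simp
  norm_num

/-- Squared-exponential moment of a sub-Gaussian variable, by Gaussian averaging of its moment
generating function. -/
lemma lintegral_exp_sq_le_of_hasSubgaussianMGF {T : Type*} [MeasurableSpace T] {ν : Measure T}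
    [IsProbabilityMeasure ν] {X : T → ℝ} (hX : Measurable X) {c : NNReal} (hc : 0 < c)
    (h : HasSubgaussianMGF X c ν) :
    ∫⁻ t, ENNReal.ofReal (Real.exp (X t ^ 2 / (4 * c))) ∂ν ≤ 2 := by
  have hc' : (0 : ℝ) < c := hc
  -- For a standard Gaussian `g`, `E exp (s g) = exp (s² / 2)` with `s = X / √(2c)`. After the swap,
  -- the generating function of `X` at `g / √(2c)` is at most `exp (g² / 4)`.
  have h1 : ∀ t, ENNReal.ofReal (Real.exp (X t ^ 2 / (4 * c)))
      = ∫⁻ g, ENNReal.ofReal (Real.exp (g / √(2 * c) * X t)) ∂(gaussianReal 0 1) := fun t => by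
    have hm := congrFun (mgf_id_gaussianReal (μ := 0) (v := 1)) (X t / √(2 * c))
    have hi := integrable_exp_mul_gaussianReal (μ := 0) (v := 1) (X t / √(2 * c))
    have e : (fun g : ℝ => Real.exp (X t / √(2 * c) * g))
        = fun g => Real.exp (g / √(2 * c) * X t) := by ext g; congr 1; ring
    rw [e] at hi
    rw [← ofReal_integral_eq_lintegral_ofReal hi (ae_of_all _ fun x => by positivity), ← e]
    simp only [mgf, id] at hm
    rw [hm]
    congr 2
    rw [div_pow, Real.sq_sqrt (by positivity)]
    field_simp
    push_cast
    ring
  simp_rw [h1]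
  rw [lintegral_lintegral_swap (by fun_prop)]
  refine le_trans (lintegral_mono fun g => ?_) lintegral_exp_sq_gaussianReal
  rw [← ofReal_integral_eq_lintegral_ofReal (h.integrable_exp_mul _)
    (ae_of_all _ fun x => by positivity)]
  refine ENNReal.ofReal_le_ofReal ((h.mgf_le (g / √(2 * c))).trans_eq ?_)
  rw [div_pow, Real.sq_sqrt (by positivity)]
  congr 1
  field_simp
  ring

/-- An admissible scale strictly below `2 σ` is taken, so that attainment of the infimum is not
needed; this is the origin of the factor 4. Homogeneity passes from unit directions to all `v`, and
at `v = 0` the exponent is `0 / 0 = 0`. -/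
lemma lintegral_exp_sq_le_of_psi2NormVec {Ω : Type*} [MeasurableSpace Ω] {μ : Measure Ω}
    [IsProbabilityMeasure μ] {d : ℕ} {x : Ω → Fin d → ℝ} {σ : ℝ} (hσ : 0 < σ)
    (h : psi2NormVec μ x ≤ ENNReal.ofReal σ) (v : Fin d → ℝ) :
    ∫⁻ ω, ENNReal.ofReal (Real.exp ((v ⬝ᵥ x ω) ^ 2 / (4 * σ ^ 2 * (v ⬝ᵥ v)))) ∂μ ≤ 2 := by
  rcases eq_or_ne v 0 with rfl | hv
  · simp
  have hN : 0 < v ⬝ᵥ v := lt_of_le_of_ne (by simpa using dotProduct_star_self_nonneg v)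
    (fun h0 => hv (dotProduct_self_eq_zero.1 h0.symm))
  set N := √(v ⬝ᵥ v) with hNdef
  have hNpos : 0 < N := Real.sqrt_pos.2 hN
  have hNsq : N ^ 2 = v ⬝ᵥ v := Real.sq_sqrt hN.le
  have hunit : l2Norm (N⁻¹ • v) = 1 := by
    rw [l2Norm, Real.sqrt_eq_one]
    have : ∑ i, (N⁻¹ • v) i ^ 2 = N⁻¹ ^ 2 * (v ⬝ᵥ v) := by
      simp only [Pi.smul_apply, smul_eq_mul, dotProduct, Finset.mul_sum]
      exact Finset.sum_congr rfl fun i _ => by ring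
    rw [this, ← hNsq]
    field_simp
  have h2 : psi2Norm μ (fun ω => (N⁻¹ • v) ⬝ᵥ x ω) ≤ ENNReal.ofReal σ :=
    le_trans (le_iSup₂ (f := fun (v : Fin d → ℝ) (_ : l2Norm v = 1) =>
      psi2Norm μ (fun ω => v ⬝ᵥ x ω)) (N⁻¹ • v) hunit) h
  have h3 : psi2Norm μ (fun ω => (N⁻¹ • v) ⬝ᵥ x ω) < ENNReal.ofReal (2 * σ) :=
    lt_of_le_of_lt h2 ((ENNReal.ofReal_lt_ofReal_iff (by linarith)).2 (by linarith))
  obtain ⟨r, ⟨t, ht, rfl, hint⟩, hr⟩ := sInf_lt_iff.1 h3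
  have htσ : t < 2 * σ := (ENNReal.ofReal_lt_ofReal_iff (by linarith)).1 hr
  refine le_trans (lintegral_mono fun ω => ENNReal.ofReal_le_ofReal (Real.exp_le_exp.2 ?_)) hint
  simp only [smul_dotProduct]
  rw [smul_eq_mul, mul_pow, ← hNsq, inv_pow, ← div_eq_inv_mul, div_div,
    mul_comm (4 * σ ^ 2)]
  gcongr
  nlinarith

end SubGaussian

/-! ### Moments and tails of the vector quantization noise -/

section VectorDither

variable {d : ℕ} {Δ : ℝ}

lemma isProbabilityMeasure_triangularDither (hΔ : 0 ≤ Δ) :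
    IsProbabilityMeasure (triangularDither d Δ) := by
  have := isProbabilityMeasure_triangularLaw hΔ
  rw [triangularDither_eq_pi d hΔ]
  infer_instance

lemma integrable_quantize_triangularLaw (hΔ : 0 ≤ Δ) (a : ℝ) :
    Integrable (fun u => quantize Δ (a + u)) (triangularLaw Δ) := by
  have := isProbabilityMeasure_triangularLaw hΔ
  have hq := measurable_quantize Δ
  have h1 : Integrable (fun u => quantize Δ (a + u) - a) (triangularLaw Δ) :=
    integrable_triangularLaw hΔ (by fun_prop) _ fun u hu => abs_quantize_le hΔ hu
  exact (h1.add (integrable_const a)).congr (ae_of_all _ fun u => by simp)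

lemma integral_quantizedCovariate (hΔ : 0 ≤ Δ) (a : Fin d → ℝ) (i : Fin d) :
    ∫ t, quantizedCovariate Δ a t i ∂(triangularDither d Δ) = a i := by
  have := isProbabilityMeasure_triangularLaw hΔ
  have hq := measurable_quantize Δ
  rw [triangularDither_eq_pi d hΔ]
  simp only [quantizedCovariate]
  rw [integral_comp_eval (μ := fun _ : Fin d => triangularLaw Δ) (i := i)
    (f := fun u => quantize Δ (a i + u)) (Measurable.aestronglyMeasurable (by fun_prop))]
  exact integral_quantize_triangularLaw hΔ (a i)

lemma iIndepFun_quantize_pi (hΔ : 0 ≤ Δ) (f : Fin d → ℝ → ℝ) (hf : ∀ i, Measurable (f i)) :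
    iIndepFun (fun i (t : Fin d → ℝ) => f i (t i))
      (Measure.pi fun _ : Fin d => triangularLaw Δ) := by
  have := isProbabilityMeasure_triangularLaw hΔ
  exact iIndepFun_pi (fun i => (hf i).aemeasurable)

/-- The second moments of a covariate quantized with a triangular dither. -/
lemma integral_quantizedCovariate_mul (hΔ : 0 ≤ Δ) (a : Fin d → ℝ) (i j : Fin d) :
    ∫ t, quantizedCovariate Δ a t i * quantizedCovariate Δ a t j ∂(triangularDither d Δ)
      = a i * a j + if i = j then Δ ^ 2 / 4 else 0 := by
  have := isProbabilityMeasure_triangularLaw hΔ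
  have hq := measurable_quantize Δ
  split_ifs with hij
  · subst hij
    rw [triangularDither_eq_pi d hΔ]
    simp only [quantizedCovariate]
    rw [integral_comp_eval (μ := fun _ : Fin d => triangularLaw Δ) (i := i)
      (f := fun u => quantize Δ (a i + u) * quantize Δ (a i + u))
      (Measurable.aestronglyMeasurable (by fun_prop))]
    have i1 : Integrable (fun u => (quantize Δ (a i + u) - a i) ^ 2) (triangularLaw Δ) :=
      integrable_triangularLaw hΔ (by fun_prop) ((3 * Δ / 2) ^ 2) fun u hu => by
        rw [abs_pow]; exact pow_le_pow_left₀ (abs_nonneg _) (abs_quantize_le hΔ hu) 2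
    have i2 : Integrable (fun u => 2 * a i * quantize Δ (a i + u)) (triangularLaw Δ) :=
      (integrable_quantize_triangularLaw hΔ (a i)).const_mul _
    have i3 : Integrable (fun u => (quantize Δ (a i + u) - a i) ^ 2
      + 2 * a i * quantize Δ (a i + u)) (triangularLaw Δ) := i1.add i2
    calc _ = ∫ u, ((quantize Δ (a i + u) - a i) ^ 2 + 2 * a i * quantize Δ (a i + u)
          - a i ^ 2) ∂(triangularLaw Δ) := by congr 1; ext u; ring
      _ = _ := by
        rw [integral_sub i3 (integrable_const _), integral_add i1 i2, integral_const_mul,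
          integral_quantize_triangularLaw hΔ, integral_quantize_sub_sq_triangularLaw hΔ]
        simp
        ring
  · have hind := (iIndepFun_quantize_pi (d := d) hΔ (fun i u => quantize Δ (a i + u))
      (fun i => by fun_prop)).indepFun hij
    have h1 := integral_quantizedCovariate hΔ a i
    have h2 := integral_quantizedCovariate hΔ a j
    rw [triangularDither_eq_pi d hΔ] at h1 h2 ⊢
    simp only [quantizedCovariate] at h1 h2 ⊢
    rw [hind.integral_fun_mul_eq_mul_integral (Measurable.aestronglyMeasurable (by fun_prop))
      (Measurable.aestronglyMeasurable (by fun_prop)), h1, h2, add_zero]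

/-- For a fixed signal the coordinates of the noise are independent, centered and bounded by `3 Δ /
2`. Hoeffding's lemma gives the variance proxy `(9/4) Δ² (v ⬝ᵥ v)`, and four times it is the
denominator. The bound is uniform in `a`, so it can be used conditionally on the covariate. -/
lemma lintegral_exp_sq_quantError (hΔ : 0 ≤ Δ) (a v : Fin d → ℝ) :
    ∫⁻ t, ENNReal.ofReal (Real.exp ((v ⬝ᵥ (quantizedCovariate Δ a t - a)) ^ 2
      / (9 * Δ ^ 2 * (v ⬝ᵥ v)))) ∂(triangularDither d Δ) ≤ 2 := by
  have := isProbabilityMeasure_triangularLaw hΔ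
  have hprob := isProbabilityMeasure_triangularDither (d := d) hΔ
  have hq := measurable_quantize Δ
  by_cases h0 : 9 * Δ ^ 2 * (v ⬝ᵥ v) = 0
  · simp [h0]
  have hN0 : 0 ≤ v ⬝ᵥ v := by simpa using dotProduct_star_self_nonneg v
  have hpos : 0 < 9 * Δ ^ 2 * (v ⬝ᵥ v) := lt_of_le_of_ne (by positivity) (Ne.symm h0)
  have hmem : ∀ i, ∀ᵐ t ∂(Measure.pi fun _ : Fin d => triangularLaw Δ),
      v i * (quantize Δ (a i + t i) - a i) ∈ Set.Icc (-(|v i| * (3 * Δ / 2)))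
        (|v i| * (3 * Δ / 2)) := by
    intro i
    have := (Measure.quasiMeasurePreserving_eval (fun _ : Fin d => triangularLaw Δ) i).ae
      (ae_abs_le_triangularLaw hΔ)
    filter_upwards [this] with t ht
    rw [Set.mem_Icc, ← abs_le, abs_mul]
    exact mul_le_mul_of_nonneg_left (abs_quantize_le hΔ ht) (abs_nonneg _)
  have hmean : ∀ i, ∫ t, v i * (quantize Δ (a i + t i) - a i)
      ∂(Measure.pi fun _ : Fin d => triangularLaw Δ) = 0 := by
    intro i
    rw [integral_comp_eval (μ := fun _ : Fin d => triangularLaw Δ) (i := i)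
      (f := fun u => v i * (quantize Δ (a i + u) - a i))
        (Measurable.aestronglyMeasurable (by fun_prop)), integral_const_mul,
      integral_sub (integrable_quantize_triangularLaw hΔ _) (integrable_const _),
      integral_quantize_triangularLaw hΔ]
    simp
  have hsub := HasSubgaussianMGF.sum_of_iIndepFun
    (iIndepFun_quantize_pi (d := d) hΔ (fun i u => v i * (quantize Δ (a i + u) - a i))
      (fun i => by fun_prop)) (s := Finset.univ)
    (fun i _ => hasSubgaussianMGF_of_mem_Icc_of_integral_eq_zero
      (Measurable.aemeasurable (by fun_prop)) (hmem i) (hmean i))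
  set c : NNReal := ∑ i, (‖|v i| * (3 * Δ / 2) - -(|v i| * (3 * Δ / 2))‖₊ / 2) ^ 2 with hc
  have hcval : (c : ℝ) = 9 / 4 * Δ ^ 2 * (v ⬝ᵥ v) := by
    rw [hc]
    push_cast
    simp only [dotProduct, Finset.mul_sum]
    refine Finset.sum_congr rfl fun i _ => ?_
    rw [div_pow, Real.norm_eq_abs, sq_abs]
    have := sq_abs (v i)
    linear_combination (9 / 4 * Δ ^ 2) * this
  have hcpos : 0 < c := by
    rw [← NNReal.coe_pos, hcval]; linarith
  have := lintegral_exp_sq_le_of_hasSubgaussianMGF (by fun_prop) hcpos hsub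
  rw [triangularDither_eq_pi d hΔ]
  refine le_trans (le_of_eq ?_) this
  congr 1; ext t
  rw [hcval]
  simp only [quantizedCovariate, dotProduct, Pi.sub_apply]
  congr 3
  ring

end VectorDither

end QCS

namespace QCS

/-! ### Exponential tail bounds for independent sums -/

section Concentration

/-- The second-order Taylor bound without any restriction on `x`; its factor `exp |x|` is the weight
in the Bernstein inequality below. -/
lemma exp_le_one_add_add_sq_mul_exp_abs (x : ℝ) :
    Real.exp x ≤ 1 + x + x ^ 2 * Real.exp |x| := by
  have h := Complex.norm_exp_sub_sum_le_norm_mul_exp (x : ℂ) 2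
  have h2 : Complex.exp x - ∑ m ∈ Finset.range 2, (x : ℂ) ^ m / (m.factorial : ℂ)
      = ((Real.exp x - (1 + x) : ℝ) : ℂ) := by
    simp [Finset.sum_range_succ]
  rw [h2, Complex.norm_real, Complex.norm_real, Real.norm_eq_abs, Real.norm_eq_abs, sq_abs] at h
  linarith [le_abs_self (Real.exp x - (1 + x))]

/-- For nonnegative variables no exponential weight is needed: this is why the lower tail below asks
only for second moments. -/
lemma exp_neg_le_one_sub_add_sq {x : ℝ} (hx : 0 ≤ x) : Real.exp (-x) ≤ 1 - x + x ^ 2 := by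
  rcases le_total x 1 with h | h
  · have := Real.abs_exp_sub_one_sub_id_le (x := -x) (by rw [abs_neg, abs_of_nonneg hx]; exact h)
    rw [neg_sq] at this
    linarith [le_abs_self (Real.exp (-x) - 1 - -x)]
  · have : Real.exp (-x) ≤ 1 := Real.exp_le_one_iff.2 (by linarith)
    nlinarith

variable {Ω : Type*} [MeasurableSpace Ω] {μ : Measure Ω}

lemma integrable_of_lintegral_ofReal_le {f : Ω → ℝ} (hf : Measurable f) (h0 : ∀ ω, 0 ≤ f ω) {G : ℝ}
    (h : ∫⁻ ω, ENNReal.ofReal (f ω) ∂μ ≤ ENNReal.ofReal G) : Integrable f μ := by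
  refine (lintegral_ofReal_ne_top_iff_integrable hf.aestronglyMeasurable (ae_of_all _ h0)).1 ?_
  exact ne_top_of_le_ne_top ENNReal.ofReal_ne_top h

lemma integral_le_of_lintegral_ofReal_le {f : Ω → ℝ} (hf : Measurable f) (h0 : ∀ ω, 0 ≤ f ω)
    {G : ℝ} (hG : 0 ≤ G) (h : ∫⁻ ω, ENNReal.ofReal (f ω) ∂μ ≤ ENNReal.ofReal G) :
    ∫ ω, f ω ∂μ ≤ G := by
  rw [integral_eq_lintegral_of_nonneg_ae (ae_of_all _ h0) hf.aestronglyMeasurable]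
  exact ENNReal.toReal_le_of_le_ofReal hG h

variable [IsProbabilityMeasure μ]

lemma integrable_of_integrable_sq {f : Ω → ℝ} (hf : Measurable f)
    (h : Integrable (fun ω => f ω ^ 2) μ) : Integrable f μ := by
  refine ((integrable_const (1 : ℝ)).add h).mono' hf.aestronglyMeasurable (ae_of_all _ fun ω => ?_)
  rw [Real.norm_eq_abs, Pi.add_apply]
  nlinarith [sq_nonneg (|f ω| - 1), sq_abs (f ω)]

/-- Chernoff's bound for a sum of independent variables. -/
lemma measureReal_sum_ge_le {n : ℕ} {Y : Fin n → Ω → ℝ} (hind : iIndepFun Y μ)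
    (hm : ∀ k, Measurable (Y k)) {t B : ℝ} (u : ℝ) (ht : 0 ≤ t)
    (hint : ∀ k, Integrable (fun ω => Real.exp (t * Y k ω)) μ)
    (hB : ∀ k, ∫ ω, Real.exp (t * Y k ω) ∂μ ≤ Real.exp B) :
    μ.real {ω | n * u ≤ ∑ k, Y k ω} ≤ Real.exp (n * (B - t * u)) := by
  have h1 : Integrable (fun ω => Real.exp (t * (∑ k, Y k) ω)) μ :=
    hind.integrable_exp_mul_sum hm (s := Finset.univ) (fun k _ => hint k)
  have h2 := measure_ge_le_exp_mul_mgf (μ := μ) (X := ∑ k, Y k) (n * u) ht h1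
  rw [hind.mgf_sum hm] at h2
  have h3 : ∏ k, mgf (Y k) μ t ≤ Real.exp B ^ n := by
    calc ∏ k, mgf (Y k) μ t ≤ ∏ _k : Fin n, Real.exp B :=
          Finset.prod_le_prod (fun k _ => mgf_nonneg) (fun k _ => hB k)
      _ = _ := by simp
  simp only [Finset.sum_apply] at h2
  calc _ ≤ _ := h2
    _ ≤ Real.exp (-t * (n * u)) * Real.exp B ^ n := by gcongr
    _ = _ := by rw [← Real.exp_nat_mul, ← Real.exp_add]; congr 1; ring

/-- Integrate the Taylor bound and apply `1 + z ≤ exp z`; the mean then factors out exactly. The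
weighted second moment replaces both the variance and a boundedness assumption. -/
lemma integral_exp_mul_centered_le {Y : Ω → ℝ} (hm : Measurable Y) {t G : ℝ} (hG : 0 ≤ G)
    (h : ∫⁻ ω, ENNReal.ofReal (Y ω ^ 2 * Real.exp (|t| * |Y ω|)) ∂μ ≤ ENNReal.ofReal G) :
    Integrable (fun ω => Real.exp (t * (Y ω - ∫ ω, Y ω ∂μ))) μ ∧
    ∫ ω, Real.exp (t * (Y ω - ∫ ω, Y ω ∂μ)) ∂μ ≤ Real.exp (t ^ 2 * G) := by
  have hpos : ∀ ω, 0 ≤ Y ω ^ 2 * Real.exp (|t| * |Y ω|) := fun ω => by positivity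
  have hi := integrable_of_lintegral_ofReal_le (by fun_prop) hpos h
  have hle := integral_le_of_lintegral_ofReal_le (by fun_prop) hpos hG h
  have hi2 : Integrable (fun ω => Y ω ^ 2) μ := by
    refine hi.mono' (by fun_prop) (ae_of_all _ fun ω => ?_)
    rw [Real.norm_eq_abs, abs_of_nonneg (sq_nonneg _)]
    exact le_mul_of_one_le_right (sq_nonneg _) (Real.one_le_exp (by positivity))
  have hi1 : Integrable Y μ := integrable_of_integrable_sq hm hi2
  have hpt : ∀ ω, Real.exp (t * Y ω)
      ≤ 1 + t * Y ω + t ^ 2 * (Y ω ^ 2 * Real.exp (|t| * |Y ω|)) := fun ω => by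
    have := exp_le_one_add_add_sq_mul_exp_abs (t * Y ω)
    rw [abs_mul] at this
    linarith
  have hb1 : Integrable (fun ω => 1 + t * Y ω) μ := (integrable_const 1).add (hi1.const_mul t)
  have hb : Integrable (fun ω => 1 + t * Y ω + t ^ 2 * (Y ω ^ 2 * Real.exp (|t| * |Y ω|))) μ :=
    hb1.add (hi.const_mul _)
  have hexp : Integrable (fun ω => Real.exp (t * Y ω)) μ := by
    refine hb.mono' (by fun_prop) (ae_of_all _ fun ω => ?_)
    rw [Real.norm_eq_abs, abs_of_pos (Real.exp_pos _)]
    exact hpt ω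
  have hmean : ∫ ω, Real.exp (t * Y ω) ∂μ ≤ Real.exp (t * ∫ ω, Y ω ∂μ + t ^ 2 * G) := by
    calc _ ≤ _ := integral_mono hexp hb hpt
      _ = 1 + t * ∫ ω, Y ω ∂μ + t ^ 2 * ∫ ω, Y ω ^ 2 * Real.exp (|t| * |Y ω|) ∂μ := by
        rw [integral_add hb1 (hi.const_mul _), integral_add (integrable_const 1) (hi1.const_mul t),
          integral_const_mul, integral_const_mul]
        simp
      _ ≤ 1 + (t * ∫ ω, Y ω ∂μ + t ^ 2 * G) := by nlinarith [sq_nonneg t]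
      _ ≤ _ := by linarith [Real.add_one_le_exp (t * ∫ ω, Y ω ∂μ + t ^ 2 * G)]
  have e : (fun ω => Real.exp (t * (Y ω - ∫ ω, Y ω ∂μ)))
      = fun ω => Real.exp (-(t * ∫ ω, Y ω ∂μ)) * Real.exp (t * Y ω) := by
    ext ω; rw [← Real.exp_add]; congr 1; ring
  rw [e]
  refine ⟨hexp.const_mul _, ?_⟩
  rw [integral_const_mul]
  calc _ ≤ Real.exp (-(t * ∫ ω, Y ω ∂μ)) * Real.exp (t * ∫ ω, Y ω ∂μ + t ^ 2 * G) := by gcongr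
    _ = _ := by rw [← Real.exp_add]; congr 1; ring

/-- A Bernstein inequality under a weighted second-moment bound. -/
lemma measureReal_abs_sum_centered_ge_le {n : ℕ} {Y : Fin n → Ω → ℝ} (hind : iIndepFun Y μ)
    (hm : ∀ k, Measurable (Y k)) {t G : ℝ} (u : ℝ) (ht : 0 ≤ t) (hG : 0 ≤ G)
    (h : ∀ k, ∫⁻ ω, ENNReal.ofReal (Y k ω ^ 2 * Real.exp (t * |Y k ω|)) ∂μ ≤ ENNReal.ofReal G) :
    μ.real {ω | n * u ≤ |∑ k, (Y k ω - ∫ ω, Y k ω ∂μ)|}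
      ≤ 2 * Real.exp (n * (t ^ 2 * G - t * u)) := by
  have h1 := fun k => integral_exp_mul_centered_le (hm k) (t := t) hG
    (by rw [abs_of_nonneg ht]; exact h k)
  have h2 := fun k => integral_exp_mul_centered_le (hm k) (t := -t) hG
    (by rw [abs_neg, abs_of_nonneg ht]; exact h k)
  have hup := measureReal_sum_ge_le (Y := fun k ω => Y k ω - ∫ ω, Y k ω ∂μ)
    (hind.comp (fun k y => y - ∫ ω, Y k ω ∂μ) (fun k => by fun_prop))
    (fun k => by fun_prop) u ht (fun k => (h1 k).1) (fun k => (h1 k).2)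
  have hlo := measureReal_sum_ge_le (Y := fun k ω => -(Y k ω - ∫ ω, Y k ω ∂μ))
    (hind.comp (fun k y => -(y - ∫ ω, Y k ω ∂μ)) (fun k => by fun_prop))
    (fun k => by fun_prop) (B := t ^ 2 * G) u ht
    (fun k => by simpa only [mul_neg, neg_mul] using (h2 k).1)
    (fun k => by simpa only [mul_neg, neg_mul, neg_sq] using (h2 k).2)
  have hsub : {ω | n * u ≤ |∑ k, (Y k ω - ∫ ω, Y k ω ∂μ)|}
      ⊆ {ω | n * u ≤ ∑ k, (Y k ω - ∫ ω, Y k ω ∂μ)}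
        ∪ {ω | n * u ≤ ∑ k, -(Y k ω - ∫ ω, Y k ω ∂μ)} := by
    intro ω hω
    rw [Set.mem_union]
    simp only [Set.mem_ofPred_eq, Finset.sum_neg_distrib] at hω ⊢
    exact le_abs.1 hω
  calc _ ≤ _ := measureReal_mono hsub
    _ ≤ _ := measureReal_union_le _ _
    _ ≤ _ := by linarith

/-- The lower tail of a sum of independent nonnegative variables. -/
lemma measureReal_sum_le_le {n : ℕ} {X : Fin n → Ω → ℝ} (hind : iIndepFun X μ)
    (hm : ∀ k, Measurable (X k)) (h0 : ∀ k ω, 0 ≤ X k ω) {t G : ℝ} (u : ℝ) (ht : 0 ≤ t) (hG : 0 ≤ G)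
    (h : ∀ k, ∫⁻ ω, ENNReal.ofReal (X k ω ^ 2) ∂μ ≤ ENNReal.ofReal G) :
    μ.real {ω | ∑ k, (X k ω - ∫ ω, X k ω ∂μ) ≤ -(n * u)}
      ≤ Real.exp (n * (t ^ 2 * G - t * u)) := by
  have hi2 := fun k => integrable_of_lintegral_ofReal_le (by fun_prop) (fun ω => sq_nonneg (X k ω))
    (h k)
  have hle := fun k => integral_le_of_lintegral_ofReal_le (by fun_prop)
    (fun ω => sq_nonneg (X k ω)) hG (h k)
  have hi1 := fun k => integrable_of_integrable_sq (hm k) (hi2 k)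
  have hexp : ∀ k, Integrable (fun ω => Real.exp (-(t * X k ω))) μ := fun k => by
    refine (integrable_const (1 : ℝ)).mono' (by fun_prop) (ae_of_all _ fun ω => ?_)
    rw [Real.norm_eq_abs, abs_of_pos (Real.exp_pos _)]
    exact Real.exp_le_one_iff.2 (by have := mul_nonneg ht (h0 k ω); linarith)
  have hmean : ∀ k, ∫ ω, Real.exp (-(t * X k ω)) ∂μ
      ≤ Real.exp (-(t * ∫ ω, X k ω ∂μ) + t ^ 2 * G) := fun k => by
    have hb1 : Integrable (fun ω => 1 - t * X k ω) μ := (integrable_const 1).sub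
      ((hi1 k).const_mul t)
    have hb : Integrable (fun ω => 1 - t * X k ω + t ^ 2 * X k ω ^ 2) μ :=
      hb1.add ((hi2 k).const_mul _)
    calc _ ≤ _ := integral_mono (hexp k) hb fun ω => by
          have := exp_neg_le_one_sub_add_sq (mul_nonneg ht (h0 k ω))
          rw [mul_pow] at this
          exact this
      _ = 1 - t * ∫ ω, X k ω ∂μ + t ^ 2 * ∫ ω, X k ω ^ 2 ∂μ := by
        rw [integral_add hb1 ((hi2 k).const_mul _),
          integral_sub (integrable_const 1) ((hi1 k).const_mul t),
          integral_const_mul, integral_const_mul]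
        simp
      _ ≤ 1 + (-(t * ∫ ω, X k ω ∂μ) + t ^ 2 * G) := by nlinarith [sq_nonneg t, hle k]
      _ ≤ _ := by linarith [Real.add_one_le_exp (-(t * ∫ ω, X k ω ∂μ) + t ^ 2 * G)]
  have e : ∀ k, (fun ω => Real.exp (t * (∫ ω, X k ω ∂μ - X k ω)))
      = fun ω => Real.exp (t * ∫ ω, X k ω ∂μ) * Real.exp (-(t * X k ω)) := fun k => by
    ext ω; rw [← Real.exp_add]; congr 1; ring
  have hlo := measureReal_sum_ge_le (Y := fun k ω => ∫ ω, X k ω ∂μ - X k ω)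
    (hind.comp (fun k y => ∫ ω, X k ω ∂μ - y) (fun k => by fun_prop))
    (fun k => by fun_prop) (B := t ^ 2 * G) u ht
    (fun k => by rw [e]; exact (hexp k).const_mul _)
    (fun k => by
      rw [e, integral_const_mul]
      calc _ ≤ Real.exp (t * ∫ ω, X k ω ∂μ) * Real.exp (-(t * ∫ ω, X k ω ∂μ) + t ^ 2 * G) := by
            gcongr; exact hmean k
        _ = _ := by rw [← Real.exp_add]; congr 1; ring)
  refine le_trans (measureReal_mono fun ω hω => ?_) hlo
  simp only [Set.mem_ofPred_eq] at hω ⊢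
  have : ∑ k, (∫ ω, X k ω ∂μ - X k ω) = -∑ k, (X k ω - ∫ ω, X k ω ∂μ) := by
    rw [← Finset.sum_neg_distrib]; exact Finset.sum_congr rfl fun k _ => by ring
  linarith

/-- Chernoff's bound at `t = 1`: since `4 ≤ exp 2`, the exponent is `n (2 - 3)`. -/
lemma measureReal_sum_sq_ge_le {n : ℕ} {H : Fin n → Ω → ℝ} (hind : iIndepFun H μ)
    (hm : ∀ k, Measurable (H k))
    (h : ∀ k, ∫⁻ ω, ENNReal.ofReal (Real.exp (H k ω ^ 2)) ∂μ ≤ 4) :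
    μ.real {ω | n * 3 ≤ ∑ k, H k ω ^ 2} ≤ Real.exp (-n) := by
  have h' : ∀ k, ∫⁻ ω, ENNReal.ofReal (Real.exp (H k ω ^ 2)) ∂μ ≤ ENNReal.ofReal 4 := by
    simpa using h
  have h4 : (4 : ℝ) ≤ Real.exp 2 := by
    have h1 := Real.add_one_le_exp (1 : ℝ)
    have : Real.exp 2 = Real.exp 1 * Real.exp 1 := by rw [← Real.exp_add]; norm_num
    nlinarith
  have := measureReal_sum_ge_le (Y := fun k ω => H k ω ^ 2) (μ := μ)
    (hind.comp (fun k y => y ^ 2) (fun k => by fun_prop)) (fun k => by fun_prop) (t := 1) (B := 2)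
    3 zero_le_one
    (fun k => by
      simp only [one_mul]
      exact integrable_of_lintegral_ofReal_le (by fun_prop) (fun ω => (Real.exp_pos _).le) (h' k))
    (fun k => by
      simp only [one_mul]
      exact (integral_le_of_lintegral_ofReal_le (by fun_prop) (fun ω => (Real.exp_pos _).le)
        (by norm_num) (h' k)).trans h4)
  refine this.trans_eq ?_
  congr 1; ring

end Concentration

end QCS

namespace QCS

/-! ### Maurey's method and the deterministic error bound -/

section Deterministic

variable {d : ℕ}

lemma l1Norm_nonneg (v : Fin d → ℝ) : 0 ≤ l1Norm v := Finset.sum_nonneg fun _ _ => abs_nonneg _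

lemma dotProduct_self_nonneg' (v : Fin d → ℝ) : 0 ≤ v ⬝ᵥ v := by
  simpa using dotProduct_star_self_nonneg v

lemma l2Norm_sq (v : Fin d → ℝ) : l2Norm v ^ 2 = v ⬝ᵥ v := by
  have h : ∑ i, v i ^ 2 = v ⬝ᵥ v := Finset.sum_congr rfl fun i _ => by ring
  rw [l2Norm, h, Real.sq_sqrt (dotProduct_self_nonneg' v)]

/-- A signed standard basis vector. -/
def signedBasis (p : Fin d × Bool) : Fin d → ℝ := Pi.single p.1 (if p.2 then 1 else -1)

lemma sum_abs_smul_signedBasis (v : Fin d → ℝ) :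
    ∑ j, |v j| • signedBasis (j, decide (0 ≤ v j)) = v := by
  ext i
  simp only [Finset.sum_apply, Pi.smul_apply, signedBasis, smul_eq_mul]
  rw [Finset.sum_eq_single i (fun j _ hj => by rw [Pi.single_eq_of_ne (Ne.symm hj), mul_zero])
    (by simp), Pi.single_eq_same]
  by_cases h : 0 ≤ v i
  · simp [h, abs_of_nonneg h]
  · simp [h, abs_of_neg (not_le.1 h)]

lemma signedBasis_dotProduct_mulVec (B : Matrix (Fin d) (Fin d) ℝ) (p : Fin d × Bool) :
    signedBasis p ⬝ᵥ B *ᵥ signedBasis p = B p.1 p.1 := by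
  rcases p with ⟨j, b⟩
  cases b <;> simp [signedBasis, Matrix.mulVec_single]

/-- Maurey's empirical method: nonnegativity of a quadratic form on the sums of signed basis
vectors propagates to the whole space, up to an error. -/
lemma quadraticForm_add_nsmul_nonneg (B : Matrix (Fin d) (Fin d) ℝ) {v : Fin d → ℝ}
    (hv : l1Norm v = 1) {T : ℝ} (hT : ∀ i, B i i ≤ T) (m : ℕ) :
    ∀ u : Fin d → ℝ,
      (∀ J : Fin m → Fin d × Bool, 0 ≤ (u + ∑ i, signedBasis (J i)) ⬝ᵥ
        B *ᵥ (u + ∑ i, signedBasis (J i))) →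
      0 ≤ (u + (m : ℝ) • v) ⬝ᵥ B *ᵥ (u + (m : ℝ) • v) + m * (T - v ⬝ᵥ B *ᵥ v) := by
  -- The offset `u` is kept general: the induction replaces random atoms by their mean `v` one at a
  -- time, and the atoms not yet averaged are absorbed into `u`.
  induction m with
  | zero => intro u h; simpa using h Fin.elim0
  | succ m ih =>
    intro u h
    -- The weights `|v j|` form a probability vector with mean atom `v`. Averaging preserves the
    -- cross terms, while the square of the atom averages to at most `T` instead of `v ⬝ᵥ B *ᵥ v`;
    -- the difference is the error of one step.
    set e : Fin d → Fin d → ℝ := fun j => signedBasis (j, decide (0 ≤ v j)) with he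
    have hsum : ∑ j, |v j| • e j = v := sum_abs_smul_signedBasis v
    set w := u + (m : ℝ) • v with hw
    have hj : ∀ j, 0 ≤ (w + e j) ⬝ᵥ B *ᵥ (w + e j) + m * (T - v ⬝ᵥ B *ᵥ v) := fun j => by
      have := ih (u + e j) fun J => by
        have := h (Fin.cons (j, decide (0 ≤ v j)) J)
        simpa [Fin.sum_univ_succ, add_assoc, he] using this
      rwa [show u + e j + (m : ℝ) • v = w + e j by rw [hw]; abel] at this
    have hexp : ∀ j, (w + e j) ⬝ᵥ B *ᵥ (w + e j)
        = w ⬝ᵥ B *ᵥ w + w ⬝ᵥ B *ᵥ e j + e j ⬝ᵥ B *ᵥ w + B j j := fun j => by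
      have := signedBasis_dotProduct_mulVec B (j, decide (0 ≤ v j))
      simp only [Matrix.mulVec_add, dotProduct_add, add_dotProduct]
      rw [this]; ring
    have h1 : ∑ j, |v j| * (w ⬝ᵥ B *ᵥ e j) = w ⬝ᵥ B *ᵥ v := by
      conv_rhs => rw [← hsum, Matrix.mulVec_sum, dotProduct_sum]
      simp [Matrix.mulVec_smul]
    have h2 : ∑ j, |v j| * (e j ⬝ᵥ B *ᵥ w) = v ⬝ᵥ B *ᵥ w := by
      conv_rhs => rw [← hsum, sum_dotProduct]
      simp
    have h3 : ∑ j, |v j| * B j j ≤ T := by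
      calc _ ≤ ∑ j, |v j| * T := Finset.sum_le_sum fun j _ =>
            mul_le_mul_of_nonneg_left (hT j) (abs_nonneg _)
        _ = T := by rw [← Finset.sum_mul]; change l1Norm v * T = T; rw [hv, one_mul]
    have h4 : ∑ j, |v j| = 1 := hv
    have h5 : 0 ≤ ∑ j, |v j| * ((w + e j) ⬝ᵥ B *ᵥ (w + e j) + m * (T - v ⬝ᵥ B *ᵥ v)) :=
      Finset.sum_nonneg fun j _ => mul_nonneg (abs_nonneg _) (hj j)
    simp only [hexp, mul_add, Finset.sum_add_distrib, h1, h2] at h5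
    rw [← Finset.sum_mul, ← Finset.sum_mul, h4, one_mul, one_mul] at h5
    have h6 : u + ((m + 1 : ℕ) : ℝ) • v = w + v := by
      rw [hw]; push_cast; rw [add_smul, one_smul, add_assoc]
    rw [h6]
    simp only [Matrix.mulVec_add, dotProduct_add, add_dotProduct]
    push_cast
    linarith

/-- Restricted strong convexity from strong convexity on the sums of signed basis vectors. -/
lemma restricted_strong_convexity (Q : Matrix (Fin d) (Fin d) ℝ) {κ T : ℝ} (hκ : 0 ≤ κ)
    (hT : ∀ i, Q i i ≤ T) {m : ℕ} (hm : 1 < m)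
    (h : ∀ J : Fin m → Fin d × Bool, κ * ((∑ i, signedBasis (J i)) ⬝ᵥ ∑ i, signedBasis (J i))
      ≤ (∑ i, signedBasis (J i)) ⬝ᵥ Q *ᵥ ∑ i, signedBasis (J i)) (v : Fin d → ℝ) :
    κ * (v ⬝ᵥ v) - T / (m - 1) * l1Norm v ^ 2 ≤ v ⬝ᵥ Q *ᵥ v := by
  have hm' : (1 : ℝ) < m := by exact_mod_cast hm
  rcases (l1Norm_nonneg v).eq_or_lt with h0 | hN
  · have : v = 0 := by
      ext i
      have := (Finset.sum_eq_zero_iff_of_nonneg fun i _ => abs_nonneg (v i)).1 h0.symm i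
        (Finset.mem_univ i)
      simpa using this
    subst this
    simp [← h0]
  set N := l1Norm v
  set B := Q - κ • (1 : Matrix (Fin d) (Fin d) ℝ) with hB
  have hBq : ∀ w, w ⬝ᵥ B *ᵥ w = w ⬝ᵥ Q *ᵥ w - κ * (w ⬝ᵥ w) := fun w => by
    rw [hB, Matrix.sub_mulVec, dotProduct_sub, Matrix.smul_mulVec, Matrix.one_mulVec,
      dotProduct_smul, smul_eq_mul]
  have hBd : ∀ i, B i i ≤ T := fun i => by
    simp only [hB, Matrix.sub_apply, Matrix.smul_apply, Matrix.one_apply_eq, smul_eq_mul]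
    linarith [hT i]
  have hunit : l1Norm (N⁻¹ • v) = 1 := by
    have : l1Norm (N⁻¹ • v) = N⁻¹ * N := by
      simp only [l1Norm, Pi.smul_apply, smul_eq_mul, abs_mul, ← Finset.mul_sum, N]
      change |N⁻¹| * N = N⁻¹ * N
      rw [abs_of_pos (inv_pos.2 hN)]
    rw [this, inv_mul_cancel₀ hN.ne']
  have key := quadraticForm_add_nsmul_nonneg B hunit hBd m 0 fun J => by
    rw [zero_add, hBq]; linarith [h J]
  have hq : ∀ c : ℝ, (c • v) ⬝ᵥ B *ᵥ (c • v) = c ^ 2 * (v ⬝ᵥ B *ᵥ v) := fun c => by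
    rw [Matrix.mulVec_smul, dotProduct_smul, smul_dotProduct, smul_eq_mul, smul_eq_mul]; ring
  rw [zero_add, smul_smul, hq, hq, hBq] at key
  set q := v ⬝ᵥ Q *ᵥ v - κ * (v ⬝ᵥ v) with hqdef
  -- The averaged inequality is `m² q / N² + m (T - q / N²) ≥ 0`. The `q` in the error term removes
  -- one of the `m` copies, hence the denominator `m - 1`.
  have key2 : 0 ≤ (m : ℝ) * ((m - 1) * q + T * N ^ 2) := by
    have : (m : ℝ) * ((m - 1) * q + T * N ^ 2)
        = N ^ 2 * ((↑m * N⁻¹) ^ 2 * q + ↑m * (T - N⁻¹ ^ 2 * q)) := by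
      field_simp; ring
    rw [this]; positivity
  have key3 : 0 ≤ (m - 1) * q + T * N ^ 2 := nonneg_of_mul_nonneg_right key2 (by linarith)
  have key4 : -(T / (m - 1) * N ^ 2) ≤ q := by
    rw [div_mul_eq_mul_div, neg_le, ← sub_nonneg]
    have : T * N ^ 2 / (↑m - 1) - -q = ((m - 1) * q + T * N ^ 2) / (m - 1) := by
      have : (m : ℝ) - 1 ≠ 0 := by linarith
      field_simp
      ring
    rw [this]
    exact div_nonneg key3 (by linarith)
  linarith

/-- The error bounds for a stationary point under restricted strong convexity. -/
lemma stationary_error_bound {Q : Matrix (Fin d) (Fin d) ℝ} {b θ θs : Fin d → ℝ}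
    {lam r κ η : ℝ} {s : ℕ} (hlam : 0 < lam) (hκ : 0 < κ) (hη : 0 ≤ η)
    (hθ : IsStationary Q b lam r θ) (hs : IsSparse s θs) (hr : l1Norm θs ≤ r)
    (hgrad : ∀ i, |b i - (Q *ᵥ θs) i| ≤ lam / 2) (hηr : η * (2 * r) ≤ lam / 4)
    (hrsc : ∀ v, κ * (v ⬝ᵥ v) - η * l1Norm v ^ 2 ≤ v ⬝ᵥ Q *ᵥ v) :
    l2Norm (θ - θs) ≤ 7 / 4 * (lam / κ) * √s ∧ l1Norm (θ - θs) ≤ 14 * (lam / κ) * s := by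
  obtain ⟨hθr, g, hg, hst⟩ := hθ
  set Υ := θ - θs with hΥ
  -- Both the variational inequality and the subgradient inequality are tested at the true
  -- parameter.
  have hst' := hst θs hr
  have hsub := hg θs
  have hneg : θs - θ = -Υ := by rw [hΥ]; abel
  rw [hneg, dotProduct_neg] at hst' hsub
  have hQ : Q *ᵥ θ = Q *ᵥ Υ + Q *ᵥ θs := by rw [← Matrix.mulVec_add, hΥ, sub_add_cancel]
  have hdot : (Q *ᵥ θ - b + lam • g) ⬝ᵥ Υ
      = Υ ⬝ᵥ Q *ᵥ Υ - (b - Q *ᵥ θs) ⬝ᵥ Υ + lam * (g ⬝ᵥ Υ) := by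
    rw [hQ, dotProduct_comm Υ]
    simp only [add_dotProduct, sub_dotProduct, smul_dotProduct, smul_eq_mul]
    ring
  have hcorr : (b - Q *ᵥ θs) ⬝ᵥ Υ ≤ lam / 2 * l1Norm Υ := by
    rw [dotProduct, l1Norm, Finset.mul_sum]
    refine Finset.sum_le_sum fun i _ => ?_
    calc (b - Q *ᵥ θs) i * Υ i ≤ |(b - Q *ᵥ θs) i| * |Υ i| := by
          rw [← abs_mul]; exact le_abs_self _
      _ ≤ _ := mul_le_mul_of_nonneg_right (hgrad i) (abs_nonneg _)
  set S := Finset.univ.filter fun i => θs i ≠ 0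
  set A := ∑ i ∈ S, |Υ i|
  set A' := ∑ i ∈ Sᶜ, |Υ i|
  have hA0 : 0 ≤ A := Finset.sum_nonneg fun _ _ => abs_nonneg _
  have hA'0 : 0 ≤ A' := Finset.sum_nonneg fun _ _ => abs_nonneg _
  have hAA : l1Norm Υ = A + A' := (Finset.sum_add_sum_compl S _).symm
  -- Off the support of `θs` the error is `θ` itself, so there the `ℓ₁` norm decreases by exactly
  -- `A'`.
  have hcone : l1Norm θs - l1Norm θ ≤ A - A' := by
    have h1 : l1Norm θs - l1Norm θ = ∑ i ∈ S, (|θs i| - |θ i|) + ∑ i ∈ Sᶜ, (|θs i| - |θ i|) := by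
      rw [Finset.sum_add_sum_compl, Finset.sum_sub_distrib]; rfl
    have h2 : ∑ i ∈ S, (|θs i| - |θ i|) ≤ A := Finset.sum_le_sum fun i _ => by
      rw [hΥ, Pi.sub_apply, abs_sub_comm]; exact abs_sub_abs_le_abs_sub _ _
    have h3 : ∑ i ∈ Sᶜ, (|θs i| - |θ i|) = -A' := by
      rw [← Finset.sum_neg_distrib]
      refine Finset.sum_congr rfl fun i hi => ?_
      have : θs i = 0 := by simpa [S] using hi
      simp [hΥ, this]
    linarith
  -- The feasibility of `θ` enters here: it makes the quadratic defect `η‖Υ‖₁²` at most linear in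
  -- `‖Υ‖₁`.
  have hl1 : l1Norm Υ ≤ 2 * r := by
    have : l1Norm Υ ≤ l1Norm θ + l1Norm θs := by
      simp only [l1Norm, ← Finset.sum_add_distrib]
      exact Finset.sum_le_sum fun i _ => abs_sub _ _
    linarith
  set N := l2Norm Υ
  have hN0 : 0 ≤ N := Real.sqrt_nonneg _
  have hN : N ^ 2 = Υ ⬝ᵥ Υ := l2Norm_sq Υ
  have hAN : A ≤ √s * N := by
    have h1 : A ^ 2 ≤ S.card * ∑ i ∈ S, |Υ i| ^ 2 := sq_sum_le_card_mul_sum_sq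
    have h2 : ∑ i ∈ S, |Υ i| ^ 2 ≤ N ^ 2 := by
      rw [hN, dotProduct]
      calc ∑ i ∈ S, |Υ i| ^ 2 ≤ ∑ i, |Υ i| ^ 2 :=
            Finset.sum_le_sum_of_subset_of_nonneg (Finset.subset_univ _) fun _ _ _ => sq_nonneg _
        _ = _ := Finset.sum_congr rfl fun i _ => by rw [sq_abs]; ring
    have h3 : (S.card : ℝ) ≤ s := by exact_mod_cast hs
    have h4 : A ^ 2 ≤ (√s * N) ^ 2 := by
      rw [mul_pow, Real.sq_sqrt (Nat.cast_nonneg s)]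
      calc A ^ 2 ≤ S.card * ∑ i ∈ S, |Υ i| ^ 2 := h1
        _ ≤ s * N ^ 2 := by gcongr
    exact (abs_le_of_sq_le_sq' h4 (by positivity)).2
  have hquad : Υ ⬝ᵥ Q *ᵥ Υ ≤ lam / 2 * (A + A') + lam * (A - A') := by
    have h1 : lam * -(g ⬝ᵥ Υ) ≤ lam * (A - A') :=
      mul_le_mul_of_nonneg_left (by linarith) hlam.le
    rw [hAA] at hcorr
    linarith
  -- Gradient, regularizer and convexity defect contribute `1/2 + 1 + 1/4` on the support and `1/2 -
  -- 1 + 1/4` off it.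
  have hmain : κ * N ^ 2 ≤ lam * (7 / 4 * A - 1 / 4 * A') := by
    have h1 := hrsc Υ
    have h2 : η * l1Norm Υ ^ 2 ≤ lam / 4 * (A + A') := by
      calc η * l1Norm Υ ^ 2 = η * l1Norm Υ * l1Norm Υ := by ring
        _ ≤ η * (2 * r) * l1Norm Υ := by
          gcongr
          exact l1Norm_nonneg Υ
        _ ≤ lam / 4 * l1Norm Υ := mul_le_mul_of_nonneg_right hηr (l1Norm_nonneg Υ)
        _ = _ := by rw [hAA]
    rw [← hN] at h1
    linarith
  -- The left side of `hmain` is nonnegative, which forces the error into a cone; then `‖Υ‖₁ ≤ 8 A`,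
  -- and `14 = 8 · 7/4`.
  have hA'A : A' ≤ 7 * A := by
    have : 0 ≤ lam * (7 / 4 * A - 1 / 4 * A') := le_trans (by positivity) hmain
    have := nonneg_of_mul_nonneg_right this hlam
    linarith
  have hNle : N ≤ 7 / 4 * (lam / κ) * √s := by
    rcases hN0.eq_or_lt with h0 | hNpos
    · rw [← h0]; positivity
    · have h1 : κ * N ^ 2 ≤ 7 / 4 * lam * (√s * N) := by
        have : lam * (7 / 4 * A - 1 / 4 * A') ≤ lam * (7 / 4 * (√s * N)) :=
          mul_le_mul_of_nonneg_left (by linarith) hlam.le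
        linarith
      have h2 : N * (κ * N) ≤ N * (7 / 4 * lam * √s) := by linarith
      have h3 := le_of_mul_le_mul_left h2 hNpos
      calc N = κ * N / κ := by field_simp
        _ ≤ 7 / 4 * lam * √s / κ := by gcongr
        _ = _ := by ring
  refine ⟨hNle, ?_⟩
  have hss : √(s : ℝ) * √s = s := Real.mul_self_sqrt (Nat.cast_nonneg s)
  calc l1Norm Υ = A + A' := hAA
    _ ≤ 8 * (√s * N) := by linarith
    _ ≤ 8 * (√s * (7 / 4 * (lam / κ) * √s)) := by gcongr
    _ = _ := by linear_combination 14 * (lam / κ) * hss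

end Deterministic

end QCS

namespace QCS

/-! ### Truncated responses -/

section Truncation

lemma truncate_eq_max_min {ζ : ℝ} (hζ : 0 ≤ ζ) (a : ℝ) : truncate ζ a = max (-ζ) (min a ζ) := by
  unfold truncate
  rcases lt_trichotomy a 0 with h | h | h
  · rw [Real.sign_of_neg h, abs_of_neg h, min_eq_left (h.le.trans hζ), neg_one_mul,
      ← max_neg_neg, neg_neg, max_comm]
  · subst h; simp [hζ]
  · rw [Real.sign_of_pos h, abs_of_pos h, one_mul, max_eq_right]
    exact (neg_nonpos.2 hζ).trans (le_min h.le hζ)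

lemma measurable_truncate {ζ : ℝ} (hζ : 0 ≤ ζ) : Measurable (truncate ζ) := by
  have : truncate ζ = fun a => max (-ζ) (min a ζ) := funext (truncate_eq_max_min hζ)
  rw [this]; fun_prop

lemma abs_truncate_le {ζ : ℝ} (hζ : 0 ≤ ζ) (a : ℝ) : |truncate ζ a| ≤ ζ := by
  rw [truncate_eq_max_min hζ, abs_le]
  exact ⟨le_max_left _ _, max_le (by linarith) (min_le_right _ _)⟩

lemma abs_truncate_le_abs {ζ : ℝ} (hζ : 0 ≤ ζ) (a : ℝ) : |truncate ζ a| ≤ |a| := by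
  rw [truncate_eq_max_min hζ]
  refine abs_le.2 ⟨?_, max_le (by linarith [abs_nonneg a])
    ((min_le_left _ _).trans (le_abs_self a))⟩
  exact le_max_of_le_right (le_min (neg_abs_le a) (by linarith [abs_nonneg a]))

/-- Truncation changes `a` only when `|a| ≥ ζ`, where the factor `(|a| / ζ) ^ l` is at least 1; this
trades moments for a power of `1 / ζ`. -/
lemma abs_truncate_sub_le {ζ l : ℝ} (hζ : 0 < ζ) (hl : 0 ≤ l) (a : ℝ) :
    |truncate ζ a - a| ≤ |a| * (|a| / ζ) ^ l := by
  rw [truncate_eq_max_min hζ.le]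
  rcases le_total |a| ζ with h | h
  · have h' := abs_le.1 h
    rw [min_eq_left h'.2, max_eq_right h'.1, sub_self, abs_zero]
    positivity
  · have h1 : 1 ≤ (|a| / ζ) ^ l := Real.one_le_rpow ((one_le_div hζ).2 h) hl
    refine le_trans ?_ (le_mul_of_one_le_right (abs_nonneg a) h1)
    rcases le_total a 0 with ha | ha
    · rw [abs_of_nonpos ha] at h ⊢
      rw [min_eq_left (by linarith), max_eq_left (by linarith), abs_of_nonneg (by linarith)]
      linarith
    · rw [abs_of_nonneg ha] at h ⊢
      rw [min_eq_right h, max_eq_right (by linarith), abs_of_nonpos (by linarith)]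
      linarith

lemma abs_quantizedResponse_le {Δ ζ y u : ℝ} (hΔ : 0 ≤ Δ) (hu : |u| ≤ Δ / 2) :
    |quantizedResponse Δ ζ y u| ≤ |truncate ζ y| + Δ := by
  have h1 := abs_quantize_sub_le hΔ (truncate ζ y + u)
  have h2 := abs_add_le (truncate ζ y) u
  have h3 := abs_sub_abs_le_abs_sub (quantize Δ (truncate ζ y + u)) (truncate ζ y + u)
  unfold quantizedResponse
  linarith

end Truncation

/-! ### Weighted moments of products -/

section Moments

variable {Ω : Type*} [MeasurableSpace Ω] {μ : Measure Ω}

lemma sq_le_two_mul_exp {x : ℝ} (hx : 0 ≤ x) : x ^ 2 ≤ 2 * Real.exp x := by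
  have := Real.quadratic_le_exp_of_nonneg hx
  linarith

/-- The product of two sub-Gaussian variables is sub-exponential. -/
lemma lintegral_mul_sq_mul_exp_le {h₁ h₂ : Ω → ℝ} (hm₁ : Measurable h₁)
    (H₁ : ∫⁻ ω, ENNReal.ofReal (Real.exp (h₁ ω ^ 2)) ∂μ ≤ 4)
    (H₂ : ∫⁻ ω, ENNReal.ofReal (Real.exp (h₂ ω ^ 2)) ∂μ ≤ 4) {t : ℝ} (ht : t ≤ 1 / 2) :
    ∫⁻ ω, ENNReal.ofReal ((h₁ ω * h₂ ω) ^ 2 * Real.exp (t * |h₁ ω * h₂ ω|)) ∂μ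
      ≤ ENNReal.ofReal 32 := by
  -- With `y = |h₁ h₂| ≤ (h₁² + h₂²) / 2`, one factor `exp (y / 2)` pays for the square and another
  -- for the weight, since `t ≤ 1/2`.
  have hpt : ∀ ω, (h₁ ω * h₂ ω) ^ 2 * Real.exp (t * |h₁ ω * h₂ ω|)
      ≤ 4 * (Real.exp (h₁ ω ^ 2) + Real.exp (h₂ ω ^ 2)) := fun ω => by
    set y := |h₁ ω * h₂ ω| with hy
    have hy0 : 0 ≤ y := abs_nonneg _
    have h1 : (h₁ ω * h₂ ω) ^ 2 ≤ 8 * Real.exp (y / 2) := by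
      rw [← sq_abs, ← hy]
      have := sq_le_two_mul_exp (x := y / 2) (by positivity)
      linarith [this]
    have h2 : Real.exp (t * y) ≤ Real.exp (y / 2) := Real.exp_le_exp.2 (by nlinarith)
    have h3 : y ≤ (h₁ ω ^ 2 + h₂ ω ^ 2) / 2 := by
      rw [hy, abs_mul]
      nlinarith [sq_nonneg (|h₁ ω| - |h₂ ω|), sq_abs (h₁ ω), sq_abs (h₂ ω)]
    have h4 : Real.exp (y / 2) * Real.exp (y / 2) ≤ Real.exp (h₁ ω ^ 2 / 2) * Real.exp
      (h₂ ω ^ 2 / 2) := by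
      rw [← Real.exp_add, ← Real.exp_add]
      exact Real.exp_le_exp.2 (by linarith)
    have h5 : ∀ z : ℝ, Real.exp (z ^ 2) = Real.exp (z ^ 2 / 2) ^ 2 := fun z => by
      rw [← Real.exp_nat_mul]; congr 1; push_cast; ring
    rw [h5 (h₁ ω), h5 (h₂ ω)]
    have h6 : (h₁ ω * h₂ ω) ^ 2 * Real.exp (t * y) ≤ 8 * Real.exp (y / 2) * Real.exp (y / 2) := by
      gcongr
    nlinarith [sq_nonneg (Real.exp (h₁ ω ^ 2 / 2) - Real.exp (h₂ ω ^ 2 / 2))]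
  calc _ ≤ ∫⁻ ω, ENNReal.ofReal 4 * (ENNReal.ofReal (Real.exp (h₁ ω ^ 2))
        + ENNReal.ofReal (Real.exp (h₂ ω ^ 2))) ∂μ := by
        refine lintegral_mono fun ω => ?_
        rw [← ENNReal.ofReal_add (by positivity) (by positivity), ← ENNReal.ofReal_mul
          (by norm_num)]
        exact ENNReal.ofReal_le_ofReal (hpt ω)
    _ = ENNReal.ofReal 4 * (∫⁻ ω, ENNReal.ofReal (Real.exp (h₁ ω ^ 2)) ∂μ
        + ∫⁻ ω, ENNReal.ofReal (Real.exp (h₂ ω ^ 2)) ∂μ) := by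
        rw [lintegral_const_mul' _ _ ENNReal.ofReal_ne_top, lintegral_add_left (by fun_prop)]
    _ ≤ ENNReal.ofReal 4 * (4 + 4) := by gcongr
    _ = _ := by
        rw [show (4 + 4 : ℝ≥0∞) = ENNReal.ofReal 8 by norm_num, ← ENNReal.ofReal_mul (by norm_num)]
        norm_num

/-- The constant in the Bernstein bound for the product of a variable with `2 l` moments and a
sub-Gaussian variable. -/
noncomputable def momentConst (l : ℝ) : ℝ :=
  2 + 4 * (2 ^ (l / (l - 1)) * Real.exp ((l / (l - 1)) ^ 2))

/-- The bound `t |g| ≤ 1` reduces the weight to `exp |h|`. Young's inequality with exponents `l` and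
`q = l / (l - 1)` then separates `g²`, which consumes the `2 l` moments, from `h² exp |h|`, whose
`q`-th power is dominated by `exp (h²)` because `2 q |h| ≤ q² + h²`. -/
lemma lintegral_mul_sq_mul_exp_le_of_moment {l : ℝ} (hl : 1 < l) {g h : Ω → ℝ} (hm : Measurable g)
    (Hg : ∫⁻ ω, ENNReal.ofReal (|g ω| ^ (2 * l)) ∂μ ≤ 2)
    (Hh : ∫⁻ ω, ENNReal.ofReal (Real.exp (h ω ^ 2)) ∂μ ≤ 4) {t : ℝ}
    (ht : ∀ᵐ ω ∂μ, t * |g ω| ≤ 1) :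
    ∫⁻ ω, ENNReal.ofReal ((g ω * h ω) ^ 2 * Real.exp (t * |g ω * h ω|)) ∂μ
      ≤ ENNReal.ofReal (momentConst l) := by
  set q := l / (l - 1) with hq
  have hl1 : 0 < l - 1 := by linarith
  have hq1 : 1 ≤ q := (one_le_div hl1).2 (by linarith)
  have hq0 : 0 < q := by linarith
  have hconj : l.HolderConjugate q := Real.HolderConjugate.conjExponent hl
  set K := (2 : ℝ) ^ q * Real.exp (q ^ 2) with hK
  have hK0 : 0 ≤ K := by positivity
  have hpt : ∀ ω, t * |g ω| ≤ 1 → (g ω * h ω) ^ 2 * Real.exp (t * |g ω * h ω|)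
      ≤ |g ω| ^ (2 * l) + K * Real.exp (h ω ^ 2) := fun ω hω => by
    have h1 : Real.exp (t * |g ω * h ω|) ≤ Real.exp |h ω| := by
      refine Real.exp_le_exp.2 ?_
      rw [abs_mul, ← mul_assoc]
      exact mul_le_of_le_one_left (abs_nonneg _) hω
    have h2 : h ω ^ 2 * Real.exp |h ω| ≤ 2 * Real.exp (2 * |h ω|) := by
      have h3 := sq_le_two_mul_exp (abs_nonneg (h ω))
      rw [sq_abs] at h3
      rw [two_mul (|h ω|), Real.exp_add, ← mul_assoc]
      gcongr
    have h3 : (h ω ^ 2 * Real.exp |h ω|) ^ q ≤ K * Real.exp (h ω ^ 2) := by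
      calc (h ω ^ 2 * Real.exp |h ω|) ^ q ≤ (2 * Real.exp (2 * |h ω|)) ^ q :=
            Real.rpow_le_rpow (by positivity) h2 hq0.le
        _ = 2 ^ q * Real.exp (2 * |h ω| * q) := by
            rw [Real.mul_rpow (by norm_num) (by positivity), ← Real.exp_mul]
        _ ≤ 2 ^ q * Real.exp (q ^ 2 + h ω ^ 2) := by
            gcongr
            nlinarith [sq_nonneg (q - |h ω|), sq_abs (h ω)]
        _ = _ := by rw [hK, Real.exp_add]; ring
    have h4 := Real.young_inequality_of_nonneg (a := g ω ^ 2) (b := h ω ^ 2 * Real.exp |h ω|)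
      (sq_nonneg _) (by positivity) hconj
    have h5 : (g ω ^ 2) ^ l = |g ω| ^ (2 * l) := by
      rw [← sq_abs, Real.rpow_mul (abs_nonneg _), Real.rpow_two]
    have h6 : (g ω ^ 2) ^ l / l ≤ |g ω| ^ (2 * l) := by
      rw [← h5]; exact div_le_self (by positivity) hl.le
    have h7 : (h ω ^ 2 * Real.exp |h ω|) ^ q / q ≤ K * Real.exp (h ω ^ 2) :=
      (div_le_self (by positivity) hq1).trans h3
    calc (g ω * h ω) ^ 2 * Real.exp (t * |g ω * h ω|)
        ≤ (g ω * h ω) ^ 2 * Real.exp |h ω| := by gcongr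
      _ = g ω ^ 2 * (h ω ^ 2 * Real.exp |h ω|) := by ring
      _ ≤ _ := by linarith
  calc _ ≤ ∫⁻ ω, (ENNReal.ofReal (|g ω| ^ (2 * l)) + ENNReal.ofReal K
        * ENNReal.ofReal (Real.exp (h ω ^ 2))) ∂μ := by
        refine lintegral_mono_ae (ht.mono fun ω hω => ?_)
        rw [← ENNReal.ofReal_mul hK0, ← ENNReal.ofReal_add (by positivity) (by positivity)]
        exact ENNReal.ofReal_le_ofReal (hpt ω hω)
    _ = ∫⁻ ω, ENNReal.ofReal (|g ω| ^ (2 * l)) ∂μ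
        + ENNReal.ofReal K * ∫⁻ ω, ENNReal.ofReal (Real.exp (h ω ^ 2)) ∂μ := by
        rw [lintegral_add_left (by fun_prop), lintegral_const_mul' _ _ ENNReal.ofReal_ne_top]
    _ ≤ 2 + ENNReal.ofReal K * 4 := by gcongr
    _ = _ := by
        rw [show (2 : ℝ≥0∞) = ENNReal.ofReal 2 by norm_num,
          show (4 : ℝ≥0∞) = ENNReal.ofReal 4 by norm_num, ← ENNReal.ofReal_mul hK0,
          ← ENNReal.ofReal_add (by norm_num) (by positivity), momentConst, mul_comm K]

lemma lintegral_pow_four_le {p : Ω → ℝ} {c : ℝ} (hc : 0 < c)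
    (H : ∫⁻ ω, ENNReal.ofReal (Real.exp (p ω ^ 2 / c)) ∂μ ≤ 4) :
    ∫⁻ ω, ENNReal.ofReal ((p ω ^ 2) ^ 2) ∂μ ≤ ENNReal.ofReal (8 * c ^ 2) := by
  calc _ ≤ ∫⁻ ω, ENNReal.ofReal (2 * c ^ 2) * ENNReal.ofReal (Real.exp (p ω ^ 2 / c)) ∂μ := by
        refine lintegral_mono fun ω => ?_
        rw [← ENNReal.ofReal_mul (by positivity)]
        refine ENNReal.ofReal_le_ofReal ?_
        have := sq_le_two_mul_exp (x := p ω ^ 2 / c) (by positivity)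
        rw [div_pow, div_le_iff₀ (by positivity)] at this
        linarith
    _ = ENNReal.ofReal (2 * c ^ 2) * ∫⁻ ω, ENNReal.ofReal (Real.exp (p ω ^ 2 / c)) ∂μ :=
        lintegral_const_mul' _ _ ENNReal.ofReal_ne_top
    _ ≤ ENNReal.ofReal (2 * c ^ 2) * 4 := by gcongr
    _ = _ := by
        rw [show (4 : ℝ≥0∞) = ENNReal.ofReal 4 by norm_num, ← ENNReal.ofReal_mul (by positivity)]
        congr 1; ring

lemma integrable_sq_of_lintegral_exp [IsProbabilityMeasure μ] {p : Ω → ℝ} (hm : Measurable p)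
    {c : ℝ} (hc : 0 < c)
    (H : ∫⁻ ω, ENNReal.ofReal (Real.exp (p ω ^ 2 / c)) ∂μ ≤ 4) :
    Integrable (fun ω => p ω ^ 2) μ :=
  integrable_of_integrable_sq (by fun_prop)
    (integrable_of_lintegral_ofReal_le (by fun_prop) (fun ω => sq_nonneg _)
      (lintegral_pow_four_le hc H))

/-- The constant in the bound for the bias caused by truncation. -/
noncomputable def biasConst (l : ℝ) : ℝ := 1 + 4 * Real.exp ((2 * l / (l - 1)) ^ 2)

lemma biasConst_pos (l : ℝ) : 0 < biasConst l := by unfold biasConst; positivity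

/-- A case split in place of Young's inequality: either `h ≤ y ^ (l - 1)` and the product is at most
`y ^ (2 l)`, or `y ≤ h ^ (1 / (l - 1))` and it is at most `h ^ p`, since `(1 + l) / (l - 1) + 1 =
p`. -/
lemma mul_rpow_le_add {l : ℝ} (hl : 1 < l) {y h : ℝ} (hy : 0 ≤ y) (hh : 0 ≤ h) :
    y * y ^ l * h ≤ y ^ (2 * l) + Real.exp ((2 * l / (l - 1)) ^ 2) * Real.exp (h ^ 2) := by
  have hl1 : 0 < l - 1 := by linarith
  set p := 2 * l / (l - 1) with hp
  have hp0 : 0 < p := by positivity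
  have hexp : h ^ p ≤ Real.exp (p ^ 2) * Real.exp (h ^ 2) := by
    have h1 : h ≤ Real.exp h := by linarith [Real.add_one_le_exp h]
    calc h ^ p ≤ Real.exp h ^ p := Real.rpow_le_rpow hh h1 hp0.le
      _ = Real.exp (h * p) := by rw [← Real.exp_mul]
      _ ≤ Real.exp (p ^ 2 + h ^ 2) := Real.exp_le_exp.2 (by nlinarith [sq_nonneg (h - p)])
      _ = _ := Real.exp_add _ _
  have hyl : 0 ≤ y ^ (2 * l) := by positivity
  rcases le_total h (y ^ (l - 1)) with hle | hle
  · have : y * y ^ l * h ≤ y ^ (2 * l) := by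
      calc y * y ^ l * h ≤ y * y ^ l * y ^ (l - 1) := by gcongr
        _ = y ^ (2 * l) := by
          rcases hy.eq_or_lt with rfl | hy'
          · rw [Real.zero_rpow (by linarith : 2 * l ≠ 0)]; simp
          · nth_rewrite 1 [← Real.rpow_one y]
            rw [← Real.rpow_add hy', ← Real.rpow_add hy']; congr 1; ring
    have : 0 ≤ Real.exp (p ^ 2) * Real.exp (h ^ 2) := by positivity
    linarith
  · have h1 : y ≤ h ^ (1 / (l - 1)) := by
      calc y = (y ^ (l - 1)) ^ (1 / (l - 1)) := by
            rw [← Real.rpow_mul hy, mul_one_div_cancel hl1.ne', Real.rpow_one]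
        _ ≤ _ := Real.rpow_le_rpow (by positivity) hle (by positivity)
    have : y * y ^ l * h ≤ h ^ p := by
      calc y * y ^ l * h ≤ h ^ (1 / (l - 1)) * (h ^ (1 / (l - 1))) ^ l * h := by gcongr
        _ = h ^ p := by
          rcases hh.eq_or_lt with rfl | hh'
          · rw [Real.zero_rpow hp0.ne']; simp
          · nth_rewrite 3 [← Real.rpow_one h]
            rw [← Real.rpow_mul hh, ← Real.rpow_add hh', ← Real.rpow_add hh']; congr 1
            rw [hp]; field_simp; ring
    linarith

end Moments

end QCS

namespace QCS

/-! ### Conditioning on the signal -/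

section Independence

variable {Ω S T : Type*} [MeasurableSpace Ω] [MeasurableSpace S] [MeasurableSpace T] {μ : Measure Ω}
  [IsProbabilityMeasure μ] {p : Ω → S} {q : Ω → T}

lemma lintegral_comp_prod_of_indepFun (hp : Measurable p) (hq : Measurable q) (h : IndepFun p q μ)
    {F : S × T → ℝ≥0∞} (hF : Measurable F) :
    ∫⁻ ω, F (p ω, q ω) ∂μ = ∫⁻ ω, ∫⁻ t, F (p ω, t) ∂(μ.map q) ∂μ := by
  have := Measure.isProbabilityMeasure_map (μ := μ) hq.aemeasurable
  have hmap := (indepFun_iff_map_prod_eq_prod_map_map hp.aemeasurable hq.aemeasurable).1 h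
  rw [← lintegral_map (f := F) hF (hp.prodMk hq), hmap, lintegral_prod _ hF.aemeasurable,
    lintegral_map (by fun_prop) hp]

lemma integral_comp_prod_of_indepFun (hp : Measurable p) (hq : Measurable q) (h : IndepFun p q μ)
    {F : S × T → ℝ} (hF : Measurable F) (hi : Integrable (fun ω => F (p ω, q ω)) μ) :
    ∫ ω, F (p ω, q ω) ∂μ = ∫ ω, ∫ t, F (p ω, t) ∂(μ.map q) ∂μ := by
  have := Measure.isProbabilityMeasure_map (μ := μ) hq.aemeasurable
  have hmap := (indepFun_iff_map_prod_eq_prod_map_map hp.aemeasurable hq.aemeasurable).1 h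
  have hi' : Integrable F ((μ.map p).prod (μ.map q)) := by
    rw [← hmap, integrable_map_measure hF.aestronglyMeasurable (by fun_prop)]
    exact hi
  have hF' : StronglyMeasurable fun s => ∫ t, F (s, t) ∂(μ.map q) :=
    hF.stronglyMeasurable.integral_prod_right'
  rw [← integral_map (f := F) (hp.prodMk hq).aemeasurable hF.aestronglyMeasurable, hmap,
    integral_prod _ hi', integral_map hp.aemeasurable hF'.aestronglyMeasurable]

end Independence

lemma measurable_quantizedCovariate {d : ℕ} (Δ : ℝ) :
    Measurable fun p : (Fin d → ℝ) × (Fin d → ℝ) => quantizedCovariate Δ p.1 p.2 := by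
  have := measurable_quantize Δ
  unfold quantizedCovariate
  fun_prop

lemma measurable_dotProduct_const {Ω : Type*} [MeasurableSpace Ω] {d : ℕ} {f : Ω → Fin d → ℝ}
    (hf : Measurable f) (v : Fin d → ℝ) : Measurable fun ω => v ⬝ᵥ f ω := by
  unfold dotProduct; fun_prop

/-- Cauchy–Schwarz for `p = √A · (p / √A)` and its analogue for `q`. The case `B = 0`, where `q ^ 2
/ B` reads as `0`, is kept to cover unquantized covariates. -/
lemma add_sq_div_le {p q A B C : ℝ} (hA : 0 < A) (hB : 0 ≤ B) (hC : A + B ≤ C)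
    (hq : B = 0 → q = 0) : (p + q) ^ 2 / C ≤ p ^ 2 / A + q ^ 2 / B := by
  rcases hB.eq_or_lt with h | h
  · rw [hq h.symm, ← h]
    simp only [add_zero, div_zero]
    gcongr
    linarith
  · rw [div_add_div _ _ hA.ne' h.ne', div_le_div_iff₀ (by linarith) (by positivity)]
    have h1 : (p + q) ^ 2 * (A * B) ≤ (p ^ 2 * B + A * q ^ 2) * (A + B) := by
      nlinarith [sq_nonneg (p * B - q * A)]
    exact h1.trans (mul_le_mul_of_nonneg_left hC (by positivity))

/-- The scale of the sub-Gaussian tails of a quantized covariate. -/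
def subgScale (σ Δ : ℝ) : ℝ := 3 * (σ + Δ)

/-! ### Measurability and tails of the quantized covariates -/

namespace SamplingScheme

variable {Ω : Type*} [MeasurableSpace Ω] {μ : Measure Ω} {n d : ℕ}
  {σ Δ Δb : ℝ} {x : Fin n → Ω → Fin d → ℝ} {ε φ : Fin n → Ω → ℝ} {τ : Fin n → Ω → Fin d → ℝ}

lemma measurable_covariate (h : SamplingScheme μ Δ Δb x ε φ τ) (k : Fin n) :
    Measurable fun ω => quantizedCovariate Δb (x k ω) (τ k ω) := by
  have h1 := measurable_pi_iff.1 (h.measurable_x k)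
  have h2 := measurable_pi_iff.1 (h.measurable_τ k)
  exact measurable_pi_lambda _ fun i => (measurable_quantize Δb).comp ((h1 i).add (h2 i))

lemma ae_abs_τ_le (h : SamplingScheme μ Δ Δb x ε φ τ) (hΔb : 0 ≤ Δb) (k : Fin n) :
    ∀ᵐ ω ∂μ, ∀ i, |τ k ω i| ≤ Δb := by
  have := isProbabilityMeasure_triangularLaw hΔb
  have hae : ∀ᵐ t ∂(μ.map (τ k)), ∀ i, |t i| ≤ Δb := by
    rw [h.law_τ k, triangularDither_eq_pi d hΔb, ae_all_iff]
    exact fun i => (Measure.quasiMeasurePreserving_eval (fun _ : Fin d => triangularLaw Δb) i).ae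
      (ae_abs_le_triangularLaw hΔb)
  exact ae_of_ae_map (h.measurable_τ k).aemeasurable hae

lemma ae_abs_φ_le (h : SamplingScheme μ Δ Δb x ε φ τ) (hΔ : 0 ≤ Δ) (k : Fin n) :
    ∀ᵐ ω ∂μ, |φ k ω| ≤ Δ / 2 := by
  have hae : ∀ᵐ t ∂(μ.map (φ k)), |t| ≤ Δ / 2 := by
    rw [h.law_φ k]
    exact ae_abs_le_uniformDither hΔ
  exact ae_of_ae_map (h.measurable_φ k).aemeasurable hae

lemma measurable_covariate_apply (h : SamplingScheme μ Δ Δb x ε φ τ) (k : Fin n) (i : Fin d) :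
    Measurable fun ω => quantizedCovariate Δb (x k ω) (τ k ω) i :=
  (measurable_pi_apply i).comp (h.measurable_covariate k)

lemma indepFun_x_τ (h : SamplingScheme μ Δ Δb x ε φ τ) (k : Fin n) : IndepFun (x k) (τ k) μ :=
  (h.indep_signal_dither k).comp measurable_fst measurable_snd

lemma measurable_response (h : SamplingScheme μ Δ Δb x ε φ τ) (θ : Fin d → ℝ) (k : Fin n) :
    Measurable (response θ (x k) (ε k)) := by
  have h1 := h.measurable_x k
  have h2 := h.measurable_ε k
  have h3 := measurable_dotProduct_const h1 θ
  unfold response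
  simp only [dotProduct_comm _ θ]
  fun_prop

variable [IsProbabilityMeasure μ]

lemma lintegral_exp_signal (hσ : 0 < σ) (hΔb : 0 ≤ Δb) {k : Fin n}
    (hψ : psi2NormVec μ (x k) ≤ ENNReal.ofReal σ) (v : Fin d → ℝ) :
    ∫⁻ ω, ENNReal.ofReal (Real.exp ((v ⬝ᵥ x k ω) ^ 2 / (subgScale σ Δb ^ 2 * (v ⬝ᵥ v)))) ∂μ
      ≤ 4 := by
  have hN := dotProduct_self_nonneg' v
  rcases hN.eq_or_lt with h0 | h0
  · have : v = 0 := dotProduct_self_eq_zero.1 h0.symm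
    subst this
    simp only [zero_dotProduct, mul_zero, div_zero, Real.exp_zero, ENNReal.ofReal_one,
      lintegral_one, measure_univ]
    norm_num
  refine le_trans (lintegral_mono fun ω => ENNReal.ofReal_le_ofReal (Real.exp_le_exp.2 ?_))
    ((lintegral_exp_sq_le_of_psi2NormVec hσ hψ v).trans (by norm_num))
  unfold subgScale
  gcongr
  nlinarith [mul_nonneg hσ.le hΔb, sq_nonneg Δb, sq_nonneg σ]

/-- Split the quantized covariate into signal plus noise. Given the signal, the noise has a
squared-exponential moment at most 2, uniformly; integrating the signal gives a second factor 2. The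
scales combine because `4 σ² + 9 Δb² ≤ 9 (σ + Δb)²`. -/
lemma lintegral_exp_covariate (h : SamplingScheme μ Δ Δb x ε φ τ) (hσ : 0 < σ) (hΔb : 0 ≤ Δb)
    {k : Fin n} (hψ : psi2NormVec μ (x k) ≤ ENNReal.ofReal σ) (v : Fin d → ℝ) :
    ∫⁻ ω, ENNReal.ofReal (Real.exp ((v ⬝ᵥ quantizedCovariate Δb (x k ω) (τ k ω)) ^ 2
      / (subgScale σ Δb ^ 2 * (v ⬝ᵥ v)))) ∂μ ≤ 4 := by
  have hN := dotProduct_self_nonneg' v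
  rcases hN.eq_or_lt with h0 | h0
  · have : v = 0 := dotProduct_self_eq_zero.1 h0.symm
    subst this
    simp only [zero_dotProduct, mul_zero, div_zero, Real.exp_zero, ENNReal.ofReal_one,
      lintegral_one, measure_univ]
    norm_num
  have hmq := measurable_quantizedCovariate (d := d) Δb
  set E₁ : (Fin d → ℝ) → ℝ := fun a => Real.exp ((v ⬝ᵥ a) ^ 2 / (4 * σ ^ 2 * (v ⬝ᵥ v))) with hE₁
  set E₂ : (Fin d → ℝ) × (Fin d → ℝ) → ℝ := fun p =>
    Real.exp ((v ⬝ᵥ (quantizedCovariate Δb p.1 p.2 - p.1)) ^ 2 / (9 * Δb ^ 2 * (v ⬝ᵥ v))) with hE₂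
  have hm₁ : Measurable E₁ := by
    have := measurable_dotProduct_const (f := fun a : Fin d → ℝ => a) measurable_id v
    fun_prop
  have hm₂ : Measurable E₂ := by
    have := measurable_dotProduct_const (f := fun p : (Fin d → ℝ) × (Fin d → ℝ) =>
      quantizedCovariate Δb p.1 p.2 - p.1) (hmq.sub measurable_fst) v
    fun_prop
  calc _ ≤ ∫⁻ ω, (fun p : (Fin d → ℝ) × (Fin d → ℝ) => ENNReal.ofReal (E₁ p.1)
        * ENNReal.ofReal (E₂ p)) (x k ω, τ k ω) ∂μ := by
        refine lintegral_mono_ae ((h.ae_abs_τ_le hΔb k).mono fun ω hω => ?_)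
        simp only
        rw [← ENNReal.ofReal_mul (Real.exp_pos _).le, ← Real.exp_add]
        refine ENNReal.ofReal_le_ofReal (Real.exp_le_exp.2 ?_)
        have hsplit : v ⬝ᵥ quantizedCovariate Δb (x k ω) (τ k ω)
            = v ⬝ᵥ x k ω + v ⬝ᵥ (quantizedCovariate Δb (x k ω) (τ k ω) - x k ω) := by
          rw [dotProduct_sub]; ring
        rw [hsplit]
        refine add_sq_div_le (by positivity) (by positivity) ?_ fun hB => ?_
        · unfold subgScale
          nlinarith [mul_nonneg (mul_nonneg hσ.le hΔb) hN, mul_nonneg (sq_nonneg σ) hN]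
        · have hΔ0 : Δb = 0 := by
            rcases mul_eq_zero.1 hB with hB | hB
            · simpa using hB
            · exact absurd hB h0.ne'
          subst hΔ0
          have : quantizedCovariate 0 (x k ω) (τ k ω) = x k ω := by
            ext i
            have := hω i
            simp only [abs_nonpos_iff] at this
            simp [quantizedCovariate, quantize, this]
          rw [this, sub_self, dotProduct_zero]
    _ = ∫⁻ ω, ENNReal.ofReal (E₁ (x k ω)) * ∫⁻ t, ENNReal.ofReal (E₂ (x k ω, t))
          ∂(triangularDither d Δb) ∂μ := by
        rw [lintegral_comp_prod_of_indepFun (F := fun p : (Fin d → ℝ) × (Fin d → ℝ) =>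
            ENNReal.ofReal (E₁ p.1) * ENNReal.ofReal (E₂ p)) (h.measurable_x k) (h.measurable_τ k)
          (h.indepFun_x_τ k) (by fun_prop), h.law_τ k]
        simp only [lintegral_const_mul' _ _ ENNReal.ofReal_ne_top]
    _ ≤ ∫⁻ ω, ENNReal.ofReal (E₁ (x k ω)) * 2 ∂μ := by
        gcongr with ω
        exact lintegral_exp_sq_quantError hΔb (x k ω) v
    _ ≤ 2 * 2 := by
        rw [lintegral_mul_const' _ _ (by norm_num)]
        gcongr
        exact lintegral_exp_sq_le_of_psi2NormVec hσ hψ v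
    _ = 4 := by norm_num

end SamplingScheme

end QCS

namespace QCS

/-! ### Second moments and unbiasedness -/

section SecondMoment

variable {Ω : Type*} [MeasurableSpace Ω] {μ : Measure Ω} {d : ℕ}

lemma integrable_mul_of_sq {f g : Ω → ℝ} (hf : Measurable f) (hg : Measurable g)
    (hf2 : Integrable (fun ω => f ω ^ 2) μ) (hg2 : Integrable (fun ω => g ω ^ 2) μ) :
    Integrable (fun ω => f ω * g ω) μ := by
  refine (hf2.add hg2).mono' (by fun_prop) (ae_of_all _ fun ω => ?_)
  rw [Real.norm_eq_abs, Pi.add_apply, abs_mul]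
  nlinarith [sq_nonneg (|f ω| - |g ω|), sq_abs (f ω), sq_abs (g ω), sq_nonneg (f ω),
    sq_nonneg (g ω)]

lemma integral_dotProduct_mul_dotProduct {X : Ω → Fin d → ℝ}
    (hi : ∀ i j, Integrable (fun ω => X ω i * X ω j) μ) (u v : Fin d → ℝ) :
    ∫ ω, (u ⬝ᵥ X ω) * (v ⬝ᵥ X ω) ∂μ = u ⬝ᵥ secondMoment μ X *ᵥ v := by
  have h1 : ∀ ω, (u ⬝ᵥ X ω) * (v ⬝ᵥ X ω) = ∑ i, ∑ j, u i * v j * (X ω i * X ω j) := fun ω => by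
    simp only [dotProduct, Finset.sum_mul_sum]
    exact Finset.sum_congr rfl fun i _ => Finset.sum_congr rfl fun j _ => by ring
  simp_rw [h1]
  rw [integral_finsetSum _ fun i _ => integrable_finsetSum _ fun j _ => (hi i j).const_mul _]
  simp only [dotProduct, Matrix.mulVec, secondMoment, Matrix.of_apply, Finset.mul_sum]
  refine Finset.sum_congr rfl fun i _ => ?_
  rw [integral_finsetSum _ fun j _ => (hi i j).const_mul _]
  refine Finset.sum_congr rfl fun j _ => ?_
  rw [integral_const_mul]
  ring

lemma dotProduct_secondMoment_ge {X : Ω → Fin d → ℝ} {κ₀ κ₁ : ℝ}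
    (h : ∀ ev ∈ spectrum ℝ (secondMoment μ X), κ₀ ≤ ev ∧ ev ≤ κ₁) (v : Fin d → ℝ) :
    κ₀ * (v ⬝ᵥ v) ≤ v ⬝ᵥ secondMoment μ X *ᵥ v := by
  set A := secondMoment μ X with hA
  have hsymm : A.IsHermitian := by
    ext i j
    simp [hA, secondMoment, mul_comm]
  have hB : (A - algebraMap ℝ (Matrix (Fin d) (Fin d) ℝ) κ₀).PosSemidef := by
    rw [Matrix.posSemidef_iff_isHermitian_and_spectrum_nonneg]
    refine ⟨hsymm.sub ?_, fun ev hev => ?_⟩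
    · rw [Algebra.algebraMap_eq_smul_one]
      ext i j
      simp [Matrix.one_apply, eq_comm]
    · rw [← spectrum.sub_singleton_eq] at hev
      obtain ⟨a, ha, b, hb, rfl⟩ := hev
      rw [Set.mem_singleton_iff] at hb
      subst hb
      exact sub_nonneg.2 (h a ha).1
  have h1 := hB.dotProduct_mulVec_nonneg v
  rw [Algebra.algebraMap_eq_smul_one, Matrix.sub_mulVec, dotProduct_sub, Matrix.smul_mulVec,
    Matrix.one_mulVec, dotProduct_smul, smul_eq_mul] at h1
  simp only [star_trivial] at h1
  linarith

end SecondMoment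

lemma subgScale_pos {σ Δ : ℝ} (hσ : 0 < σ) (hΔ : 0 ≤ Δ) : 0 < subgScale σ Δ := by
  unfold subgScale; positivity

namespace SamplingScheme

variable {Ω : Type*} [MeasurableSpace Ω] {μ : Measure Ω} [IsProbabilityMeasure μ] {n d : ℕ}
  {σ Δ Δb : ℝ} {x : Fin n → Ω → Fin d → ℝ} {ε φ : Fin n → Ω → ℝ} {τ : Fin n → Ω → Fin d → ℝ}

lemma lintegral_exp_covariate_div (h : SamplingScheme μ Δ Δb x ε φ τ) (hσ : 0 < σ) (hΔb : 0 ≤ Δb)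
    {k : Fin n} (hψ : psi2NormVec μ (x k) ≤ ENNReal.ofReal σ) (v : Fin d → ℝ) :
    ∫⁻ ω, ENNReal.ofReal (Real.exp ((v ⬝ᵥ quantizedCovariate Δb (x k ω) (τ k ω)
      / (subgScale σ Δb * l2Norm v)) ^ 2)) ∂μ ≤ 4 := by
  simpa only [div_pow, mul_pow, l2Norm_sq] using h.lintegral_exp_covariate hσ hΔb hψ v

lemma lintegral_exp_covariate_apply (h : SamplingScheme μ Δ Δb x ε φ τ) (hσ : 0 < σ)
    (hΔb : 0 ≤ Δb) {k : Fin n} (hψ : psi2NormVec μ (x k) ≤ ENNReal.ofReal σ) (i : Fin d) :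
    ∫⁻ ω, ENNReal.ofReal (Real.exp ((quantizedCovariate Δb (x k ω) (τ k ω) i
      / subgScale σ Δb) ^ 2)) ∂μ ≤ 4 := by
  simpa [div_pow] using h.lintegral_exp_covariate hσ hΔb hψ (Pi.single i 1)

lemma lintegral_exp_signal_apply (hσ : 0 < σ) (hΔb : 0 ≤ Δb) {k : Fin n}
    (hψ : psi2NormVec μ (x k) ≤ ENNReal.ofReal σ) (i : Fin d) :
    ∫⁻ ω, ENNReal.ofReal (Real.exp ((x k ω i / subgScale σ Δb) ^ 2)) ∂μ ≤ 4 := by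
  simpa [div_pow] using lintegral_exp_signal hσ hΔb hψ (Pi.single i 1)

lemma integrable_covariate_sq (h : SamplingScheme μ Δ Δb x ε φ τ) (hσ : 0 < σ) (hΔb : 0 ≤ Δb)
    {k : Fin n} (hψ : psi2NormVec μ (x k) ≤ ENNReal.ofReal σ) (i : Fin d) :
    Integrable (fun ω => quantizedCovariate Δb (x k ω) (τ k ω) i ^ 2) μ := by
  have hS := subgScale_pos hσ hΔb
  have hm := h.measurable_covariate_apply k i
  refine integrable_sq_of_lintegral_exp hm (c := subgScale σ Δb ^ 2) (by positivity) ?_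
  simpa [div_pow] using h.lintegral_exp_covariate_apply hσ hΔb hψ i

lemma integrable_signal_sq (h : SamplingScheme μ Δ Δb x ε φ τ) (hσ : 0 < σ) (hΔb : 0 ≤ Δb)
    {k : Fin n} (hψ : psi2NormVec μ (x k) ≤ ENNReal.ofReal σ) (i : Fin d) :
    Integrable (fun ω => x k ω i ^ 2) μ := by
  have hS := subgScale_pos hσ hΔb
  have hm := measurable_pi_iff.1 (h.measurable_x k) i
  refine integrable_sq_of_lintegral_exp hm (c := subgScale σ Δb ^ 2) (by positivity) ?_
  simpa [div_pow] using lintegral_exp_signal_apply hσ hΔb hψ i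

lemma integrable_signal_mul (h : SamplingScheme μ Δ Δb x ε φ τ) (hσ : 0 < σ) (hΔb : 0 ≤ Δb)
    {k : Fin n} (hψ : psi2NormVec μ (x k) ≤ ENNReal.ofReal σ) (i j : Fin d) :
    Integrable (fun ω => x k ω i * x k ω j) μ :=
  integrable_mul_of_sq (measurable_pi_iff.1 (h.measurable_x k) i)
    (measurable_pi_iff.1 (h.measurable_x k) j) (h.integrable_signal_sq hσ hΔb hψ i)
    (h.integrable_signal_sq hσ hΔb hψ j)

lemma integrable_covariate_mul (h : SamplingScheme μ Δ Δb x ε φ τ) (hσ : 0 < σ) (hΔb : 0 ≤ Δb)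
    {k : Fin n} (hψ : psi2NormVec μ (x k) ≤ ENNReal.ofReal σ) (i j : Fin d) :
    Integrable (fun ω => quantizedCovariate Δb (x k ω) (τ k ω) i
      * quantizedCovariate Δb (x k ω) (τ k ω) j) μ :=
  integrable_mul_of_sq (h.measurable_covariate_apply k i) (h.measurable_covariate_apply k j)
    (h.integrable_covariate_sq hσ hΔb hψ i) (h.integrable_covariate_sq hσ hΔb hψ j)

/-- Quantization with a triangular dither shifts the second-moment matrix by a known multiple of
the identity. -/
lemma secondMoment_covariate (h : SamplingScheme μ Δ Δb x ε φ τ) (hσ : 0 < σ) (hΔb : 0 ≤ Δb)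
    {k : Fin n} (hψ : psi2NormVec μ (x k) ≤ ENNReal.ofReal σ) :
    secondMoment μ (fun ω => quantizedCovariate Δb (x k ω) (τ k ω))
      = secondMoment μ (x k) + (Δb ^ 2 / 4) • (1 : Matrix (Fin d) (Fin d) ℝ) := by
  have hm := measurable_quantizedCovariate (d := d) Δb
  ext i j
  simp only [secondMoment, Matrix.of_apply, Matrix.add_apply, Matrix.smul_apply, Matrix.one_apply]
  have h1 : Measurable fun p : (Fin d → ℝ) × (Fin d → ℝ) => quantizedCovariate Δb p.1 p.2 i
      * quantizedCovariate Δb p.1 p.2 j :=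
    (measurable_pi_iff.1 hm i).mul (measurable_pi_iff.1 hm j)
  rw [integral_comp_prod_of_indepFun (F := fun p : (Fin d → ℝ) × (Fin d → ℝ) =>
    quantizedCovariate Δb p.1 p.2 i * quantizedCovariate Δb p.1 p.2 j) (h.measurable_x k)
    (h.measurable_τ k) (h.indepFun_x_τ k) h1 (h.integrable_covariate_mul hσ hΔb hψ i j), h.law_τ k]
  simp only [integral_quantizedCovariate_mul hΔb]
  rw [integral_add (h.integrable_signal_mul hσ hΔb hψ i j) (integrable_const _)]
  simp

/-- The dithers make the quantized product unbiased for the product of the truncated response and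
the covariate. -/
lemma integral_response_mul_covariate (h : SamplingScheme μ Δ Δb x ε φ τ) (hΔ : 0 ≤ Δ)
    (hΔb : 0 ≤ Δb) {ζ : ℝ} (hζ : 0 ≤ ζ) (θ : Fin d → ℝ) (k : Fin n) (i : Fin d)
    (hi : Integrable (fun ω => quantizedResponse Δ ζ (response θ (x k) (ε k) ω) (φ k ω)
      * quantizedCovariate Δb (x k ω) (τ k ω) i) μ) :
    ∫ ω, quantizedResponse Δ ζ (response θ (x k) (ε k) ω) (φ k ω)
      * quantizedCovariate Δb (x k ω) (τ k ω) i ∂μ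
      = ∫ ω, truncate ζ (response θ (x k) (ε k) ω) * x k ω i ∂μ := by
  have := isProbabilityMeasure_uniformDither hΔ
  have := isProbabilityMeasure_triangularDither (d := d) hΔb
  have hq := measurable_quantize Δ
  have hqb := measurable_quantize Δb
  have ht := measurable_truncate hζ
  have hp : Measurable fun ω => (x k ω, ε k ω) := (h.measurable_x k).prodMk (h.measurable_ε k)
  have hd : Measurable fun ω => (φ k ω, τ k ω) := (h.measurable_φ k).prodMk (h.measurable_τ k)
  set F : ((Fin d → ℝ) × ℝ) × (ℝ × (Fin d → ℝ)) → ℝ := fun p =>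
    quantize Δ (truncate ζ (p.1.1 ⬝ᵥ θ + p.1.2) + p.2.1) * quantize Δb (p.1.1 i + p.2.2 i) with hF
  have hFm : Measurable F := by
    have := measurable_dotProduct_const (f := fun p : ((Fin d → ℝ) × ℝ) × (ℝ × (Fin d → ℝ)) =>
      p.1.1) (by fun_prop) θ
    simp only [hF, dotProduct_comm _ θ]
    fun_prop
  have key := integral_comp_prod_of_indepFun (F := F) hp hd (h.indep_signal_dither k) hFm hi
  have hlaw : μ.map (fun ω => (φ k ω, τ k ω)) = (uniformDither Δ).prod (triangularDither d Δb) := by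
    rw [(indepFun_iff_map_prod_eq_prod_map_map (h.measurable_φ k).aemeasurable
      (h.measurable_τ k).aemeasurable).1 (h.indep_φ_τ k), h.law_φ k, h.law_τ k]
  rw [hlaw] at key
  refine key.trans (integral_congr_ae (ae_of_all _ fun ω => ?_))
  simp only [hF]
  -- For a frozen signal the two dithers are independent of each other, so the two unbiasedness
  -- statements multiply.
  rw [integral_prod_mul (fun u => quantize Δ (truncate ζ (x k ω ⬝ᵥ θ + ε k ω) + u))
    (fun t : Fin d → ℝ => quantize Δb (x k ω i + t i)), integral_quantize_uniformDither hΔ]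
  have := integral_quantizedCovariate hΔb (x k ω) i
  simp only [quantizedCovariate] at this
  rw [this]
  rfl

end SamplingScheme

end QCS

/-! ### Moments of the response and truncation bias -/

namespace QCS

lemma lintegral_rpow_div_le {Ω : Type*} [MeasurableSpace Ω] {μ : Measure Ω} {y : Ω → ℝ}
    {l M : ℝ} (hl : 1 < l) (hM : 0 < M)
    (H : ∫⁻ ω, ENNReal.ofReal (|y ω| ^ (2 * l)) ∂μ ≤ ENNReal.ofReal M) :
    ∫⁻ ω, ENNReal.ofReal ((|y ω| / M ^ (1 / (2 * l))) ^ (2 * l)) ∂μ ≤ 1 := by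
  have hm : (M ^ (1 / (2 * l))) ^ (2 * l) = M := by
    rw [← Real.rpow_mul hM.le, one_div_mul_cancel (by linarith), Real.rpow_one]
  calc _ = ∫⁻ ω, ENNReal.ofReal M⁻¹ * ENNReal.ofReal (|y ω| ^ (2 * l)) ∂μ := by
        congr 1; ext ω
        rw [Real.div_rpow (abs_nonneg _) (by positivity), hm, ← ENNReal.ofReal_mul (by positivity),
          div_eq_inv_mul]
    _ = ENNReal.ofReal M⁻¹ * ∫⁻ ω, ENNReal.ofReal (|y ω| ^ (2 * l)) ∂μ :=
        lintegral_const_mul' _ _ ENNReal.ofReal_ne_top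
    _ ≤ ENNReal.ofReal M⁻¹ * ENNReal.ofReal M := by gcongr
    _ = 1 := by rw [← ENNReal.ofReal_mul (by positivity), inv_mul_cancel₀ hM.ne',
      ENNReal.ofReal_one]

namespace SamplingScheme

variable {Ω : Type*} [MeasurableSpace Ω] {μ : Measure Ω} [IsProbabilityMeasure μ] {n d : ℕ}
  {σ Δ Δb : ℝ} {x : Fin n → Ω → Fin d → ℝ} {ε φ : Fin n → Ω → ℝ} {τ : Fin n → Ω → Fin d → ℝ}
  {l M : ℝ} {θ : Fin d → ℝ} {k : Fin n}

/-- Pointwise `|ẏ| ≤ |y| + Δ ≤ (Δ + m) max (|y| / m) 1`, and the two entries of the maximum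
contribute 1 each. The bound is independent of `ζ`. -/
lemma lintegral_rpow_quantizedResponse (h : SamplingScheme μ Δ Δb x ε φ τ) (hΔ : 0 ≤ Δ)
    (hl : 1 < l) (hM : 0 < M) {ζ : ℝ} (hζ : 0 ≤ ζ)
    (Hy : ∫⁻ ω, ENNReal.ofReal (|response θ (x k) (ε k) ω| ^ (2 * l)) ∂μ ≤ ENNReal.ofReal M) :
    ∫⁻ ω, ENNReal.ofReal (|quantizedResponse Δ ζ (response θ (x k) (ε k) ω) (φ k ω)
      / (Δ + M ^ (1 / (2 * l)))| ^ (2 * l)) ∂μ ≤ 2 := by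
  set m := M ^ (1 / (2 * l)) with hmdef
  have hm : 0 < m := by positivity
  calc _ ≤ ∫⁻ ω, (ENNReal.ofReal ((|response θ (x k) (ε k) ω| / m) ^ (2 * l)) + 1) ∂μ := by
        refine lintegral_mono_ae ((h.ae_abs_φ_le hΔ k).mono fun ω hω => ?_)
        rw [← ENNReal.ofReal_one, ← ENNReal.ofReal_add (by positivity) zero_le_one]
        refine ENNReal.ofReal_le_ofReal ?_
        set y := response θ (x k) (ε k) ω
        have h1 : |quantizedResponse Δ ζ y (φ k ω)| ≤ |y| + Δ :=
          (abs_quantizedResponse_le hΔ hω).trans (add_le_add_left (abs_truncate_le_abs hζ y) Δ)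
        have h2 : |quantizedResponse Δ ζ y (φ k ω) / (Δ + m)| ≤ max (|y| / m) 1 := by
          rw [abs_div, abs_of_pos (by positivity : 0 < Δ + m), div_le_iff₀ (by positivity)]
          have h3 : |y| = |y| / m * m := by field_simp
          have h4 := mul_le_mul_of_nonneg_right (le_max_left (|y| / m) 1) hm.le
          have h5 := mul_le_mul_of_nonneg_right (le_max_right (|y| / m) 1) hΔ
          linarith
        calc _ ≤ (max (|y| / m) 1) ^ (2 * l) :=
              Real.rpow_le_rpow (abs_nonneg _) h2 (by linarith)
          _ ≤ _ := by
            have h6 : 0 ≤ (|y| / m) ^ (2 * l) := by positivity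
            rcases max_choice (|y| / m) 1 with h3 | h3
            · rw [h3]; linarith
            · rw [h3, Real.one_rpow]; linarith
    _ = ∫⁻ ω, ENNReal.ofReal ((|response θ (x k) (ε k) ω| / m) ^ (2 * l)) ∂μ + 1 := by
        rw [lintegral_add_right _ measurable_const]
        simp
    _ ≤ 1 + 1 := by gcongr; exact lintegral_rpow_div_le hl hM Hy
    _ = 2 := by norm_num

lemma lintegral_response_sq_le (hl : 1 < l) (hM : 0 < M)
    (Hy : ∫⁻ ω, ENNReal.ofReal (|response θ (x k) (ε k) ω| ^ (2 * l)) ∂μ ≤ ENNReal.ofReal M) :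
    ∫⁻ ω, ENNReal.ofReal (response θ (x k) (ε k) ω ^ 2) ∂μ
      ≤ ENNReal.ofReal (2 * (M ^ (1 / (2 * l))) ^ 2) := by
  set m := M ^ (1 / (2 * l)) with hmdef
  have hm : 0 < m := by positivity
  calc _ ≤ ∫⁻ ω, ENNReal.ofReal (m ^ 2)
        * (ENNReal.ofReal ((|response θ (x k) (ε k) ω| / m) ^ (2 * l)) + 1) ∂μ := by
        refine lintegral_mono fun ω => ?_
        rw [← ENNReal.ofReal_one, ← ENNReal.ofReal_add (by positivity) zero_le_one,
          ← ENNReal.ofReal_mul (by positivity)]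
        refine ENNReal.ofReal_le_ofReal ?_
        set y := response θ (x k) (ε k) ω
        set z := |y| / m with hz
        have hz0 : 0 ≤ z := by positivity
        have h1 : y ^ 2 = m ^ 2 * z ^ 2 := by rw [hz, div_pow, sq_abs]; field_simp
        rw [h1]
        refine mul_le_mul_of_nonneg_left ?_ (sq_nonneg m)
        have h2 : 0 ≤ z ^ (2 * l) := by positivity
        rcases le_total z 1 with h3 | h3
        · nlinarith
        · have : z ^ (2 : ℝ) ≤ z ^ (2 * l) := Real.rpow_le_rpow_of_exponent_le h3 (by linarith)
          rw [Real.rpow_two] at this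
          linarith
    _ = ENNReal.ofReal (m ^ 2)
        * (∫⁻ ω, ENNReal.ofReal ((|response θ (x k) (ε k) ω| / m) ^ (2 * l)) ∂μ + 1) := by
        rw [lintegral_const_mul' _ _ ENNReal.ofReal_ne_top, lintegral_add_right _ measurable_const]
        simp
    _ ≤ ENNReal.ofReal (m ^ 2) * (1 + 1) := by gcongr; exact lintegral_rpow_div_le hl hM Hy
    _ = _ := by
        rw [show (1 + 1 : ℝ≥0∞) = ENNReal.ofReal 2 by norm_num, ← ENNReal.ofReal_mul
          (by positivity),
          mul_comm]

lemma integrable_response_sq (h : SamplingScheme μ Δ Δb x ε φ τ) (hl : 1 < l) (hM : 0 < M)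
    (Hy : ∫⁻ ω, ENNReal.ofReal (|response θ (x k) (ε k) ω| ^ (2 * l)) ∂μ ≤ ENNReal.ofReal M) :
    Integrable (fun ω => response θ (x k) (ε k) ω ^ 2) μ :=
  integrable_of_lintegral_ofReal_le ((h.measurable_response θ k).pow_const 2) (fun _ => sq_nonneg _)
    (lintegral_response_sq_le hl hM Hy)

lemma integrable_signal (h : SamplingScheme μ Δ Δb x ε φ τ) (hσ : 0 < σ) (hΔb : 0 ≤ Δb)
    (hψ : psi2NormVec μ (x k) ≤ ENNReal.ofReal σ) (i : Fin d) :
    Integrable (fun ω => x k ω i) μ :=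
  integrable_of_integrable_sq (measurable_pi_iff.1 (h.measurable_x k) i)
    (h.integrable_signal_sq hσ hΔb hψ i)

/-- The moments are assumed for the response only; the noise inherits integrability as the
difference of response and signal. -/
lemma integrable_noise (h : SamplingScheme μ Δ Δb x ε φ τ) (hσ : 0 < σ) (hΔb : 0 ≤ Δb)
    (hψ : psi2NormVec μ (x k) ≤ ENNReal.ofReal σ) (hl : 1 < l) (hM : 0 < M)
    (Hy : ∫⁻ ω, ENNReal.ofReal (|response θ (x k) (ε k) ω| ^ (2 * l)) ∂μ ≤ ENNReal.ofReal M) :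
    Integrable (ε k) μ := by
  have h1 : Integrable (fun ω => response θ (x k) (ε k) ω) μ :=
    integrable_of_integrable_sq (h.measurable_response θ k) (h.integrable_response_sq hl hM Hy)
  have h2 : Integrable (fun ω => x k ω ⬝ᵥ θ) μ :=
    integrable_finsetSum _ fun i _ => (h.integrable_signal hσ hΔb hψ i).mul_const _
  refine (h1.sub h2).congr (ae_of_all _ fun ω => ?_)
  simp [response]

/-- The cross-moment of the response and the covariate. -/
lemma integral_response_mul_signal (h : SamplingScheme μ Δ Δb x ε φ τ) (hσ : 0 < σ) (hΔb : 0 ≤ Δb)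
    (hψ : psi2NormVec μ (x k) ≤ ENNReal.ofReal σ) (hx0 : ∀ i, ∫ ω, x k ω i ∂μ = 0)
    (hl : 1 < l) (hM : 0 < M)
    (Hy : ∫⁻ ω, ENNReal.ofReal (|response θ (x k) (ε k) ω| ^ (2 * l)) ∂μ ≤ ENNReal.ofReal M)
    (i : Fin d) :
    ∫ ω, response θ (x k) (ε k) ω * x k ω i ∂μ = (secondMoment μ (x k) *ᵥ θ) i := by
  have hx := measurable_pi_iff.1 (h.measurable_x k) i
  have hε := h.integrable_noise hσ hΔb hψ hl hM Hy
  have hxi := h.integrable_signal hσ hΔb hψ i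
  have hmul := h.integrable_signal_mul hσ hΔb hψ
  have hind : IndepFun (ε k) (fun ω => x k ω i) μ :=
    ((h.indep_x_ε k).comp (measurable_pi_apply i) measurable_id).symm
  -- The noise may have a nonzero mean: the term vanishes because the covariate is centered.
  have h2 : ∫ ω, ε k ω * x k ω i ∂μ = 0 := by
    rw [hind.integral_fun_mul_eq_mul_integral hε.aestronglyMeasurable hxi.aestronglyMeasurable,
      hx0 i, mul_zero]
  have h2i : Integrable (fun ω => ε k ω * x k ω i) μ := hind.integrable_mul hε hxi
  have h3 := integral_dotProduct_mul_dotProduct hmul (Pi.single i 1) θ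
  have h3i : Integrable (fun ω => x k ω i * (θ ⬝ᵥ x k ω)) μ := by
    simp only [dotProduct, Finset.mul_sum]
    refine integrable_finsetSum _ fun j _ => ((hmul i j).const_mul (θ j)).congr
      (ae_of_all _ fun ω => ?_)
    simp only
    ring
  simp only [single_one_dotProduct] at h3
  rw [← h3, ← add_zero (∫ ω, x k ω i * (θ ⬝ᵥ x k ω) ∂μ), ← h2, ← integral_add h3i h2i]
  congr 1; ext ω
  rw [response, dotProduct_comm]
  ring

/-- The parameter is controlled by the moments of the response. -/
lemma dotProduct_self_le (h : SamplingScheme μ Δ Δb x ε φ τ) (hσ : 0 < σ) (hΔb : 0 ≤ Δb)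
    (hψ : psi2NormVec μ (x k) ≤ ENNReal.ofReal σ) (hx0 : ∀ i, ∫ ω, x k ω i ∂μ = 0)
    {κ₀ κ₁ : ℝ} (hspec : ∀ ev ∈ spectrum ℝ (secondMoment μ (x k)), κ₀ ≤ ev ∧ ev ≤ κ₁)
    (hl : 1 < l) (hM : 0 < M)
    (Hy : ∫⁻ ω, ENNReal.ofReal (|response θ (x k) (ε k) ω| ^ (2 * l)) ∂μ ≤ ENNReal.ofReal M) :
    κ₀ * (θ ⬝ᵥ θ) ≤ 2 * (M ^ (1 / (2 * l))) ^ 2 := by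
  have hmul := h.integrable_signal_mul hσ hΔb hψ
  have hy2 := h.integrable_response_sq hl hM Hy
  have hymeas := h.measurable_response θ k
  have hyle := integral_le_of_lintegral_ofReal_le (hymeas.pow_const 2) (fun _ => sq_nonneg _)
    (by positivity) (lintegral_response_sq_le hl hM Hy)
  have hcross : ∀ i, Integrable (fun ω => response θ (x k) (ε k) ω * x k ω i) μ := fun i =>
    integrable_mul_of_sq hymeas (measurable_pi_iff.1 (h.measurable_x k) i) hy2
      (h.integrable_signal_sq hσ hΔb hψ i)
  have e1 : ∀ ω, response θ (x k) (ε k) ω * (θ ⬝ᵥ x k ω)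
      = ∑ i, θ i * (response θ (x k) (ε k) ω * x k ω i) := fun ω => by
    rw [dotProduct, Finset.mul_sum]
    exact Finset.sum_congr rfl fun i _ => by ring
  have i1 : Integrable (fun ω => response θ (x k) (ε k) ω * (θ ⬝ᵥ x k ω)) μ := by
    simp only [e1]
    exact integrable_finsetSum _ fun i _ => (hcross i).const_mul _
  have v1 : ∫ ω, response θ (x k) (ε k) ω * (θ ⬝ᵥ x k ω) ∂μ
      = θ ⬝ᵥ secondMoment μ (x k) *ᵥ θ := by
    simp only [e1]
    rw [integral_finsetSum _ fun i _ => (hcross i).const_mul _]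
    simp only [integral_const_mul, h.integral_response_mul_signal hσ hΔb hψ hx0 hl hM Hy]
    rfl
  have v2 := integral_dotProduct_mul_dotProduct hmul θ θ
  have i2 : Integrable (fun ω => (θ ⬝ᵥ x k ω) * (θ ⬝ᵥ x k ω)) μ := by
    simp only [dotProduct, Finset.sum_mul_sum]
    refine integrable_finsetSum _ fun i _ => integrable_finsetSum _ fun j _ =>
      ((hmul i j).const_mul (θ i * θ j)).congr (ae_of_all _ fun ω => ?_)
    simp only
    ring
  -- Expanding `E (y - θᵀx)² ≥ 0` with `E (y θᵀx) = E (θᵀx)²` leaves `θᵀ Σ θ ≤ E y²`.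
  have hsq : 0 ≤ ∫ ω, (response θ (x k) (ε k) ω ^ 2
      - 2 * (response θ (x k) (ε k) ω * (θ ⬝ᵥ x k ω)) + (θ ⬝ᵥ x k ω) * (θ ⬝ᵥ x k ω)) ∂μ :=
    integral_nonneg fun ω => by
      have := sq_nonneg (response θ (x k) (ε k) ω - θ ⬝ᵥ x k ω)
      simp only [Pi.zero_apply]
      linarith [this]
  have i3 : Integrable (fun ω => response θ (x k) (ε k) ω ^ 2
      - 2 * (response θ (x k) (ε k) ω * (θ ⬝ᵥ x k ω))) μ := hy2.sub (i1.const_mul 2)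
  rw [integral_add i3 i2, integral_sub hy2 (i1.const_mul 2), integral_const_mul, v1, v2] at hsq
  have := dotProduct_secondMoment_ge hspec θ
  linarith

/-- The bias caused by truncating the response. -/
lemma abs_integral_truncate_sub_le (h : SamplingScheme μ Δ Δb x ε φ τ) (hσ : 0 < σ) (hΔb : 0 ≤ Δb)
    (hψ : psi2NormVec μ (x k) ≤ ENNReal.ofReal σ) (hx0 : ∀ i, ∫ ω, x k ω i ∂μ = 0)
    (hl : 1 < l) (hM : 0 < M) {ζ : ℝ} (hζ : 0 < ζ)
    (Hy : ∫⁻ ω, ENNReal.ofReal (|response θ (x k) (ε k) ω| ^ (2 * l)) ∂μ ≤ ENNReal.ofReal M)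
    (i : Fin d) :
    |∫ ω, truncate ζ (response θ (x k) (ε k) ω) * x k ω i ∂μ - (secondMoment μ (x k) *ᵥ θ) i|
      ≤ M ^ (1 / (2 * l)) * subgScale σ Δb * (M ^ (1 / (2 * l)) / ζ) ^ l * biasConst l := by
  set m := M ^ (1 / (2 * l)) with hmdef
  have hm : 0 < m := by positivity
  set S := subgScale σ Δb with hS
  have hS0 : 0 < S := subgScale_pos hσ hΔb
  have hymeas := h.measurable_response θ k
  have hxmeas := measurable_pi_iff.1 (h.measurable_x k) i
  have htmeas := measurable_truncate hζ.le
  have hy2 := h.integrable_response_sq hl hM Hy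
  have hx2 := h.integrable_signal_sq hσ hΔb hψ i
  have i1 : Integrable (fun ω => response θ (x k) (ε k) ω * x k ω i) μ :=
    integrable_mul_of_sq hymeas hxmeas hy2 hx2
  have hT2 : Integrable (fun ω => truncate ζ (response θ (x k) (ε k) ω) ^ 2) μ := by
    refine hy2.mono' (Measurable.aestronglyMeasurable (by fun_prop)) (ae_of_all _ fun ω => ?_)
    rw [Real.norm_eq_abs, abs_of_nonneg (sq_nonneg _)]
    exact sq_le_sq.2 (abs_truncate_le_abs hζ.le _)
  have i2 : Integrable (fun ω => truncate ζ (response θ (x k) (ε k) ω) * x k ω i) μ :=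
    integrable_mul_of_sq (by fun_prop) hxmeas hT2 hx2
  rw [← h.integral_response_mul_signal hσ hΔb hψ hx0 hl hM Hy i, ← integral_sub i2 i1]
  set K := Real.exp ((2 * l / (l - 1)) ^ 2) with hK
  set c := m * S * (m / ζ) ^ l with hc
  have hc0 : 0 ≤ c := by positivity
  set f : Ω → ℝ := fun ω => (|response θ (x k) (ε k) ω| / m) ^ (2 * l)
    + K * Real.exp ((x k ω i / S) ^ 2) with hf
  have hfm : Measurable f := by fun_prop
  have hf0 : ∀ ω, 0 ≤ f ω := fun ω => by positivity
  have hfle : ∫⁻ ω, ENNReal.ofReal (f ω) ∂μ ≤ ENNReal.ofReal (biasConst l) := by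
    calc _ = ∫⁻ ω, (ENNReal.ofReal ((|response θ (x k) (ε k) ω| / m) ^ (2 * l))
          + ENNReal.ofReal K * ENNReal.ofReal (Real.exp ((x k ω i / S) ^ 2))) ∂μ := by
          congr 1; ext ω
          rw [← ENNReal.ofReal_mul (by positivity), ← ENNReal.ofReal_add (by positivity)
            (by positivity)]
      _ = ∫⁻ ω, ENNReal.ofReal ((|response θ (x k) (ε k) ω| / m) ^ (2 * l)) ∂μ
          + ENNReal.ofReal K * ∫⁻ ω, ENNReal.ofReal (Real.exp ((x k ω i / S) ^ 2)) ∂μ := by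
          rw [lintegral_add_left (by fun_prop), lintegral_const_mul' _ _ ENNReal.ofReal_ne_top]
      _ ≤ 1 + ENNReal.ofReal K * 4 := by
          gcongr
          · exact lintegral_rpow_div_le hl hM Hy
          · exact lintegral_exp_signal_apply hσ hΔb hψ i
      _ = _ := by
          rw [← ENNReal.ofReal_one, show (4 : ℝ≥0∞) = ENNReal.ofReal 4 by norm_num,
            ← ENNReal.ofReal_mul (by positivity), ← ENNReal.ofReal_add (by norm_num)
              (by positivity),
            biasConst, mul_comm K]
  have hfi := integrable_of_lintegral_ofReal_le hfm hf0 hfle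
  -- Response and covariate are scaled by `m` and `S`; `mul_rpow_le_add` then yields an integrable
  -- majorant.
  have hpt : ∀ ω, ‖truncate ζ (response θ (x k) (ε k) ω) * x k ω i
      - response θ (x k) (ε k) ω * x k ω i‖ ≤ c * f ω := fun ω => by
    set y := response θ (x k) (ε k) ω
    rw [← sub_mul, Real.norm_eq_abs, abs_mul]
    have h1 := mul_rpow_le_add hl (y := |y| / m) (h := |x k ω i| / S) (by positivity)
      (by positivity)
    rw [div_pow |x k ω i|, sq_abs, ← div_pow] at h1
    calc |truncate ζ y - y| * |x k ω i| ≤ |y| * (|y| / ζ) ^ l * |x k ω i| := by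
          gcongr; exact abs_truncate_sub_le hζ (by linarith) y
      _ = c * (|y| / m * (|y| / m) ^ l * (|x k ω i| / S)) := by
          have : |y| / ζ = |y| / m * (m / ζ) := by field_simp
          rw [hc, this, Real.mul_rpow (by positivity) (by positivity)]
          field_simp
      _ ≤ c * f ω := by gcongr
  have := norm_integral_le_of_norm_le (hfi.const_mul c) (ae_of_all _ hpt)
  rw [integral_const_mul, Real.norm_eq_abs] at this
  refine this.trans ?_
  gcongr
  exact integral_le_of_lintegral_ofReal_le hfm hf0 (biasConst_pos l).le hfle

end SamplingScheme

end QCS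

namespace QCS

/-! ### Coordinates of the empirical quantities -/

section EmpiricalMatrix

variable {n d : ℕ}

lemma matQ_mulVec (Δb : ℝ) (x : Fin n → Fin d → ℝ) (v : Fin d → ℝ) (i : Fin d) :
    (matQ Δb x *ᵥ v) i = (1 / (n : ℝ)) * ∑ k, x k i * (v ⬝ᵥ x k) - Δb ^ 2 / 4 * v i := by
  rw [matQ, Matrix.sub_mulVec, Matrix.smul_mulVec, Matrix.smul_mulVec, Matrix.one_mulVec,
    Matrix.sum_mulVec]
  simp only [Pi.sub_apply, Pi.smul_apply, Finset.sum_apply, smul_eq_mul]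
  congr 2
  refine Finset.sum_congr rfl fun k _ => ?_
  simp only [Matrix.mulVec, Matrix.vecMulVec_apply, dotProduct, Finset.mul_sum]
  exact Finset.sum_congr rfl fun j _ => by ring

lemma dotProduct_matQ_mulVec (Δb : ℝ) (x : Fin n → Fin d → ℝ) (v : Fin d → ℝ) :
    v ⬝ᵥ matQ Δb x *ᵥ v = (1 / (n : ℝ)) * ∑ k, (v ⬝ᵥ x k) ^ 2 - Δb ^ 2 / 4 * (v ⬝ᵥ v) := by
  have h : ∑ k, (v ⬝ᵥ x k) ^ 2 = ∑ i, v i * ∑ k, x k i * (v ⬝ᵥ x k) := by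
    simp only [Finset.mul_sum]
    rw [Finset.sum_comm]
    refine Finset.sum_congr rfl fun k _ => ?_
    rw [sq]
    nth_rewrite 1 [dotProduct]
    rw [Finset.sum_mul]
    exact Finset.sum_congr rfl fun i _ => by ring
  rw [h]
  nth_rewrite 1 [dotProduct]
  simp only [matQ_mulVec, mul_sub, Finset.sum_sub_distrib]
  congr 1
  · rw [Finset.mul_sum]; exact Finset.sum_congr rfl fun i _ => by ring
  · rw [dotProduct, Finset.mul_sum]; exact Finset.sum_congr rfl fun i _ => by ring

lemma matQ_diag (Δb : ℝ) (x : Fin n → Fin d → ℝ) (i : Fin d) :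
    matQ Δb x i i = (1 / (n : ℝ)) * ∑ k, x k i ^ 2 - Δb ^ 2 / 4 := by
  simp [matQ, Matrix.sum_apply, Matrix.vecMulVec_apply, sq]

lemma vecB_apply (x : Fin n → Fin d → ℝ) (y : Fin n → ℝ) (i : Fin d) :
    vecB x y i = (1 / (n : ℝ)) * ∑ k, y k * x k i := by
  simp [vecB]

end EmpiricalMatrix

/-! ### Concentration at fixed coordinates and directions -/

namespace SamplingScheme

variable {Ω : Type*} [MeasurableSpace Ω] {μ : Measure Ω} {n d : ℕ}
  {σ Δ Δb : ℝ} {x : Fin n → Ω → Fin d → ℝ} {ε φ : Fin n → Ω → ℝ} {τ : Fin n → Ω → Fin d → ℝ}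
  {l M : ℝ} {θ : Fin d → ℝ}

lemma measurable_quantizedResponse (h : SamplingScheme μ Δ Δb x ε φ τ) {ζ : ℝ} (hζ : 0 ≤ ζ)
    (k : Fin n) :
    Measurable fun ω => quantizedResponse Δ ζ (response θ (x k) (ε k) ω) (φ k ω) := by
  have h1 := h.measurable_response θ k
  have h2 := h.measurable_φ k
  have h3 := measurable_quantize Δ
  have h4 := measurable_truncate hζ
  unfold quantizedResponse
  fun_prop

lemma iIndepFun_covariate (h : SamplingScheme μ Δ Δb x ε φ τ) :
    iIndepFun (fun k ω => quantizedCovariate Δb (x k ω) (τ k ω)) μ := by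
  have hq := measurable_quantize Δb
  have hg : Measurable fun p : (Fin d → ℝ) × ℝ × ℝ × (Fin d → ℝ) =>
      quantizedCovariate Δb p.1 p.2.2.2 := by
    unfold quantizedCovariate
    fun_prop
  exact h.indep_samples.comp _ fun _ => hg

lemma iIndepFun_product (h : SamplingScheme μ Δ Δb x ε φ τ) {ζ : ℝ} (hζ : 0 ≤ ζ) (i : Fin d)
    (α β : ℝ) :
    iIndepFun (fun k ω => quantizedResponse Δ ζ (response θ (x k) (ε k) ω) (φ k ω) / α
      * (quantizedCovariate Δb (x k ω) (τ k ω) i / β)) μ := by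
  have hqb := measurable_quantize Δb
  have hq := measurable_quantize Δ
  have ht := measurable_truncate hζ
  have hd := measurable_dotProduct_const (f := fun p : (Fin d → ℝ) × ℝ × ℝ × (Fin d → ℝ) => p.1)
    measurable_fst θ
  have hg : Measurable fun p : (Fin d → ℝ) × ℝ × ℝ × (Fin d → ℝ) =>
      quantizedResponse Δ ζ (p.1 ⬝ᵥ θ + p.2.1) p.2.2.1 / α
        * (quantizedCovariate Δb p.1 p.2.2.2 i / β) := by
    unfold quantizedResponse quantizedCovariate
    simp only [dotProduct_comm _ θ]
    fun_prop
  exact h.indep_samples.comp _ fun _ => hg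

variable [IsProbabilityMeasure μ]

/-- Concentration of the cross-moment of the quantized responses and covariates. -/
lemma measureReal_cross_ge_le (h : SamplingScheme μ Δ Δb x ε φ τ) (hσ : 0 < σ) (hΔ : 0 ≤ Δ)
    (hΔb : 0 ≤ Δb) (hψ : ∀ k, psi2NormVec μ (x k) ≤ ENNReal.ofReal σ)
    (hl : 1 < l) (hM : 0 < M) {ζ B ρ : ℝ} (hζ : 0 ≤ ζ) (hB : 0 ≤ B) (hρ : 0 ≤ ρ) (hρ1 : ρ ≤ 1)
    (hρζ : ρ * ζ ≤ B * M ^ (1 / (2 * l)))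
    (Hy : ∀ k, ∫⁻ ω, ENNReal.ofReal (|response θ (x k) (ε k) ω| ^ (2 * l)) ∂μ ≤ ENNReal.ofReal M)
    (i : Fin d) :
    (∀ k, Integrable (fun ω => quantizedResponse Δ ζ (response θ (x k) (ε k) ω) (φ k ω)
      * quantizedCovariate Δb (x k ω) (τ k ω) i) μ) ∧
    μ.real {ω | n * (ρ * (B + 1 + momentConst l)) ≤ |∑ k,
      (quantizedResponse Δ ζ (response θ (x k) (ε k) ω) (φ k ω) / (Δ + M ^ (1 / (2 * l)))
        * (quantizedCovariate Δb (x k ω) (τ k ω) i / subgScale σ Δb)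
      - ∫ ω, quantizedResponse Δ ζ (response θ (x k) (ε k) ω) (φ k ω) / (Δ + M ^ (1 / (2 * l)))
        * (quantizedCovariate Δb (x k ω) (τ k ω) i / subgScale σ Δb) ∂μ)|}
      ≤ 2 * Real.exp (-(n * ρ ^ 2)) := by
  set m := M ^ (1 / (2 * l)) with hmdef
  have hm : 0 < m := by positivity
  set S := subgScale σ Δb with hS
  have hS0 : 0 < S := subgScale_pos hσ hΔb
  set G := momentConst l with hG
  have hG0 : 0 ≤ G := by rw [hG]; unfold momentConst; positivity
  have hymeas := fun k => h.measurable_quantizedResponse (θ := θ) hζ k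
  have hxmeas := fun k => h.measurable_covariate_apply k i
  have ht0 : 0 ≤ ρ / (B + 1) := by positivity
  -- The Bernstein parameter `t = ρ / (B + 1)` is chosen so that `t` times the normalized response
  -- is at most 1; here `ρ ζ ≤ B m` is used.
  have hbound : ∀ k, ∀ᵐ ω ∂μ,
      ρ / (B + 1) * |quantizedResponse Δ ζ (response θ (x k) (ε k) ω) (φ k ω) / (Δ + m)| ≤ 1 :=
    fun k => (h.ae_abs_φ_le hΔ k).mono fun ω hω => by
      have h1 := abs_quantizedResponse_le (ζ := ζ) (y := response θ (x k) (ε k) ω) hΔ hω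
      have h2 := abs_truncate_le hζ (response θ (x k) (ε k) ω)
      rw [abs_div, abs_of_pos (by positivity : 0 < Δ + m), div_mul_div_comm,
        div_le_one (by positivity)]
      calc ρ * |quantizedResponse Δ ζ (response θ (x k) (ε k) ω) (φ k ω)|
          ≤ ρ * (ζ + Δ) := by gcongr; linarith
        _ ≤ B * m + Δ := by nlinarith
        _ ≤ (B + 1) * (Δ + m) := by nlinarith [mul_nonneg hB hΔ]
  have hweight : ∀ k, ∫⁻ ω, ENNReal.ofReal
      ((quantizedResponse Δ ζ (response θ (x k) (ε k) ω) (φ k ω) / (Δ + m)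
        * (quantizedCovariate Δb (x k ω) (τ k ω) i / S)) ^ 2
      * Real.exp (ρ / (B + 1) * |quantizedResponse Δ ζ (response θ (x k) (ε k) ω) (φ k ω) / (Δ + m)
        * (quantizedCovariate Δb (x k ω) (τ k ω) i / S)|)) ∂μ ≤ ENNReal.ofReal G := fun k =>
    lintegral_mul_sq_mul_exp_le_of_moment hl ((hymeas k).div_const _)
      (h.lintegral_rpow_quantizedResponse hΔ hl hM hζ (Hy k))
      (h.lintegral_exp_covariate_apply hσ hΔb (hψ k) i) (hbound k)
  constructor
  · intro k
    have hprod : Measurable fun ω => quantizedResponse Δ ζ (response θ (x k) (ε k) ω) (φ k ω)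
        / (Δ + m) * (quantizedCovariate Δb (x k ω) (τ k ω) i / S) :=
      ((hymeas k).div_const _).mul ((hxmeas k).div_const _)
    have hle : ∫⁻ ω, ENNReal.ofReal
        ((quantizedResponse Δ ζ (response θ (x k) (ε k) ω) (φ k ω) / (Δ + m)
          * (quantizedCovariate Δb (x k ω) (τ k ω) i / S)) ^ 2) ∂μ ≤ ENNReal.ofReal G :=
      le_trans (lintegral_mono fun ω => ENNReal.ofReal_le_ofReal
        (le_mul_of_one_le_right (sq_nonneg _) (Real.one_le_exp (by positivity)))) (hweight k)
    have hi := integrable_of_integrable_sq hprod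
      (integrable_of_lintegral_ofReal_le (hprod.pow_const 2) (fun _ => sq_nonneg _) hle)
    refine (hi.const_mul ((Δ + m) * S)).congr (ae_of_all _ fun ω => ?_)
    simp only
    field_simp
  · refine (measureReal_abs_sum_centered_ge_le (h.iIndepFun_product hζ i (Δ + m) S)
      (fun k => ((hymeas k).div_const _).mul ((hxmeas k).div_const _)) _ ht0 hG0 hweight).trans ?_
    gcongr
    -- In the level, `ρ G` compensates the variance term and `ρ (B + 1)` leaves exactly `-ρ²` in the
    -- exponent.
    have h1 : (ρ / (B + 1)) ^ 2 * G ≤ ρ / (B + 1) * (ρ * G) := by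
      have h2 : ρ / (B + 1) ≤ ρ := div_le_self hρ (by linarith)
      have h3 := mul_nonneg ht0 hG0
      nlinarith
    have h2 : ρ / (B + 1) * (ρ * (B + 1 + G)) = ρ ^ 2 + ρ / (B + 1) * (ρ * G) := by
      field_simp
    have h3 : (ρ / (B + 1)) ^ 2 * G - ρ / (B + 1) * (ρ * (B + 1 + G)) ≤ -ρ ^ 2 := by linarith
    have := mul_le_mul_of_nonneg_left h3 (Nat.cast_nonneg (α := ℝ) n)
    linarith

/-- Concentration of the action of the empirical second-moment matrix on a fixed vector. -/
lemma measureReal_gram_ge_le (h : SamplingScheme μ Δ Δb x ε φ τ) (hσ : 0 < σ)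
    (hΔb : 0 ≤ Δb) (hψ : ∀ k, psi2NormVec μ (x k) ≤ ENNReal.ofReal σ)
    {ρ : ℝ} (hρ : 0 ≤ ρ) (hρ1 : ρ ≤ 1 / 2) (v : Fin d → ℝ) (i : Fin d) :
    μ.real {ω | n * (33 * ρ) ≤ |∑ k,
      (quantizedCovariate Δb (x k ω) (τ k ω) i / subgScale σ Δb
        * (v ⬝ᵥ quantizedCovariate Δb (x k ω) (τ k ω) / (subgScale σ Δb * l2Norm v))
      - ∫ ω, quantizedCovariate Δb (x k ω) (τ k ω) i / subgScale σ Δb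
        * (v ⬝ᵥ quantizedCovariate Δb (x k ω) (τ k ω) / (subgScale σ Δb * l2Norm v)) ∂μ)|}
      ≤ 2 * Real.exp (-(n * ρ ^ 2)) := by
  have hxmeas := fun k => h.measurable_covariate_apply k i
  have hvmeas := fun k => measurable_dotProduct_const (h.measurable_covariate k) v
  have hind : iIndepFun (fun k ω => quantizedCovariate Δb (x k ω) (τ k ω) i / subgScale σ Δb
        * (v ⬝ᵥ quantizedCovariate Δb (x k ω) (τ k ω) / (subgScale σ Δb * l2Norm v))) μ := by
    have hg : Measurable fun w : Fin d → ℝ => w i / subgScale σ Δb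
        * (v ⬝ᵥ w / (subgScale σ Δb * l2Norm v)) := by
      have := measurable_dotProduct_const (f := fun w : Fin d → ℝ => w) measurable_id v
      fun_prop
    exact h.iIndepFun_covariate.comp _ fun _ => hg
  -- With `t = ρ` and weighted moment 32, the level `33 ρ` gives `32 ρ² - 33 ρ² = -ρ²`.
  refine (measureReal_abs_sum_centered_ge_le hind
    (fun k => ((hxmeas k).div_const _).mul ((hvmeas k).div_const _)) (t := ρ) (G := 32) _ hρ
    (by norm_num) fun k => ?_).trans ?_
  · exact lintegral_mul_sq_mul_exp_le ((hxmeas k).div_const _)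
      (h.lintegral_exp_covariate_apply hσ hΔb (hψ k) i)
      (h.lintegral_exp_covariate_div hσ hΔb (hψ k) v) hρ1
  · refine le_of_eq ?_
    congr 2; ring

/-- The lower tail of the empirical quadratic form at a fixed vector. -/
lemma measureReal_quadraticForm_lt_le (h : SamplingScheme μ Δ Δb x ε φ τ) (hσ : 0 < σ)
    (hΔb : 0 ≤ Δb) (hψ : ∀ k, psi2NormVec μ (x k) ≤ ENNReal.ofReal σ)
    {κ : ℝ} (hκ : 0 < κ) (v : Fin d → ℝ) :
    μ.real {ω | ∑ k, ((v ⬝ᵥ quantizedCovariate Δb (x k ω) (τ k ω)) ^ 2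
      - ∫ ω, (v ⬝ᵥ quantizedCovariate Δb (x k ω) (τ k ω)) ^ 2 ∂μ) < -(n * (κ * (v ⬝ᵥ v)))}
      ≤ Real.exp (-(n * (κ ^ 2 / (32 * subgScale σ Δb ^ 4)))) := by
  have hS0 : 0 < subgScale σ Δb := subgScale_pos hσ hΔb
  set S := subgScale σ Δb with hS
  rcases (dotProduct_self_nonneg' v).eq_or_lt with h0 | hN
  · have : v = 0 := dotProduct_self_eq_zero.1 h0.symm
    subst this
    simp [Real.exp_nonneg]
  set N := v ⬝ᵥ v with hNdef
  have hvmeas := fun k => measurable_dotProduct_const (h.measurable_covariate k) v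
  have hind : iIndepFun (fun k ω => (v ⬝ᵥ quantizedCovariate Δb (x k ω) (τ k ω)) ^ 2) μ := by
    have hg : Measurable fun w : Fin d → ℝ => (v ⬝ᵥ w) ^ 2 :=
      (measurable_dotProduct_const (f := fun w : Fin d → ℝ => w) measurable_id v).pow_const 2
    exact h.iIndepFun_covariate.comp _ fun _ => hg
  set G := 8 * (S ^ 2 * N) ^ 2 with hG
  have hG0 : 0 < G := by positivity
  -- This `t` minimizes `t² G - t κ N`, with value `-(κ N)² / (4 G)`; the size `N` of the vector
  -- cancels, so the rate is the same in every direction.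
  have hlow := measureReal_sum_le_le hind (fun k => (hvmeas k).pow_const 2)
    (fun _ _ => sq_nonneg _) (t := κ * N / (2 * G)) (G := G) (κ * N) (by positivity) hG0.le
    (fun k => lintegral_pow_four_le (by positivity) (h.lintegral_exp_covariate hσ hΔb (hψ k) v))
  refine le_trans (measureReal_mono fun ω hω => ?_) (hlow.trans_eq ?_)
  · simp only [Set.mem_ofPred_eq] at hω ⊢
    exact hω.le
  congr 1
  rw [hG]
  field_simp
  ring

/-- Controls the diagonal of the empirical matrix from above, which Maurey's method needs as `T`. -/
lemma measureReal_diag_ge_le (h : SamplingScheme μ Δ Δb x ε φ τ) (hσ : 0 < σ)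
    (hΔb : 0 ≤ Δb) (hψ : ∀ k, psi2NormVec μ (x k) ≤ ENNReal.ofReal σ) (i : Fin d) :
    μ.real {ω | n * 3 ≤ ∑ k, (quantizedCovariate Δb (x k ω) (τ k ω) i / subgScale σ Δb) ^ 2}
      ≤ Real.exp (-n) := by
  have hg : Measurable fun w : Fin d → ℝ => w i / subgScale σ Δb := by fun_prop
  exact measureReal_sum_sq_ge_le (h.iIndepFun_covariate.comp _ fun _ => hg)
    (fun k => (h.measurable_covariate_apply k i).div_const _)
    fun k => h.lintegral_exp_covariate_apply hσ hΔb (hψ k) i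

end SamplingScheme

end QCS

/-! ### The good event -/

namespace QCS

lemma matQ_diag_le {Ω : Type*} {n d : ℕ} {σ Δb : ℝ} {x τ : Fin n → Ω → Fin d → ℝ} (hσ : 0 < σ)
    (hΔb : 0 ≤ Δb) (hn : 0 < n) (i : Fin d) (ω : Ω)
    (hω : ∑ k, (quantizedCovariate Δb (x k ω) (τ k ω) i / subgScale σ Δb) ^ 2 ≤ n * 3) :
    matQ Δb (fun k => quantizedCovariate Δb (x k ω) (τ k ω)) i i ≤ 3 * subgScale σ Δb ^ 2 := by
  have hn' : (0 : ℝ) < n := by exact_mod_cast hn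
  have hS0 : 0 < subgScale σ Δb := subgScale_pos hσ hΔb
  simp only [div_pow, ← Finset.sum_div] at hω
  rw [div_le_iff₀ (by positivity)] at hω
  rw [matQ_diag]
  have : (1 / (n : ℝ)) * ∑ k, quantizedCovariate Δb (x k ω) (τ k ω) i ^ 2
      ≤ 3 * subgScale σ Δb ^ 2 := by
    rw [one_div_mul_eq_div, div_le_iff₀ hn']
    linarith
  linarith [sq_nonneg Δb]

namespace SamplingScheme

variable {Ω : Type*} [MeasurableSpace Ω] {μ : Measure Ω} [IsProbabilityMeasure μ] {n d : ℕ}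
  {σ Δ Δb : ℝ} {x : Fin n → Ω → Fin d → ℝ} {ε φ : Fin n → Ω → ℝ} {τ : Fin n → Ω → Fin d → ℝ}
  {l M : ℝ} {θ : Fin d → ℝ}

lemma integral_covariate_dotProduct (h : SamplingScheme μ Δ Δb x ε φ τ) (hσ : 0 < σ)
    (hΔb : 0 ≤ Δb) {k : Fin n} (hψ : psi2NormVec μ (x k) ≤ ENNReal.ofReal σ) (u v : Fin d → ℝ) :
    ∫ ω, (u ⬝ᵥ quantizedCovariate Δb (x k ω) (τ k ω))
      * (v ⬝ᵥ quantizedCovariate Δb (x k ω) (τ k ω)) ∂μ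
      = u ⬝ᵥ secondMoment μ (x k) *ᵥ v + Δb ^ 2 / 4 * (u ⬝ᵥ v) := by
  rw [integral_dotProduct_mul_dotProduct (X := fun ω => quantizedCovariate Δb (x k ω) (τ k ω))
    (h.integrable_covariate_mul hσ hΔb hψ), h.secondMoment_covariate hσ hΔb hψ, Matrix.add_mulVec,
    dotProduct_add, Matrix.smul_mulVec, Matrix.one_mulVec, dotProduct_smul, smul_eq_mul]

/-- The gradient of the empirical loss at the true parameter, in terms of centered sums. -/
lemma abs_gradient_le (h : SamplingScheme μ Δ Δb x ε φ τ) (hσ : 0 < σ) (hΔb : 0 ≤ Δb)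
    (hψ : ∀ k, psi2NormVec μ (x k) ≤ ENNReal.ofReal σ) (hn : 0 < n) {ζ α β u₁ u₂ : ℝ} (hα : 0 < α)
    (i : Fin d) (ω : Ω)
    (hβ : ∀ k, |∫ ω, quantizedResponse Δ ζ (response θ (x k) (ε k) ω) (φ k ω)
      * quantizedCovariate Δb (x k ω) (τ k ω) i ∂μ - (secondMoment μ (x k) *ᵥ θ) i| ≤ β)
    (h₁ : |∑ k, (quantizedResponse Δ ζ (response θ (x k) (ε k) ω) (φ k ω) / α
        * (quantizedCovariate Δb (x k ω) (τ k ω) i / subgScale σ Δb)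
      - ∫ ω, quantizedResponse Δ ζ (response θ (x k) (ε k) ω) (φ k ω) / α
        * (quantizedCovariate Δb (x k ω) (τ k ω) i / subgScale σ Δb) ∂μ)| ≤ n * u₁)
    (h₂ : |∑ k, (quantizedCovariate Δb (x k ω) (τ k ω) i / subgScale σ Δb
        * (θ ⬝ᵥ quantizedCovariate Δb (x k ω) (τ k ω) / (subgScale σ Δb * l2Norm θ))
      - ∫ ω, quantizedCovariate Δb (x k ω) (τ k ω) i / subgScale σ Δb
        * (θ ⬝ᵥ quantizedCovariate Δb (x k ω) (τ k ω) / (subgScale σ Δb * l2Norm θ)) ∂μ)|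
      ≤ n * u₂) :
    |vecB (fun k => quantizedCovariate Δb (x k ω) (τ k ω))
        (fun k => quantizedResponse Δ ζ (response θ (x k) (ε k) ω) (φ k ω)) i
      - (matQ Δb (fun k => quantizedCovariate Δb (x k ω) (τ k ω)) *ᵥ θ) i|
      ≤ α * subgScale σ Δb * u₁ + subgScale σ Δb ^ 2 * l2Norm θ * u₂ + β := by
  have hn' : (0 : ℝ) < n := by exact_mod_cast hn
  have hS0 : 0 < subgScale σ Δb := subgScale_pos hσ hΔb
  set S := subgScale σ Δb with hS
  have hT0 : 0 ≤ l2Norm θ := Real.sqrt_nonneg _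
  set X : Fin n → Ω → Fin d → ℝ := fun k ω => quantizedCovariate Δb (x k ω) (τ k ω) with hX
  set Y : Fin n → Ω → ℝ := fun k ω => quantizedResponse Δ ζ (response θ (x k) (ε k) ω) (φ k ω)
    with hY
  have e₁ : ∀ k ω, Y k ω * X k ω i = α * S * (Y k ω / α * (X k ω i / S)) := fun k ω => by
    field_simp
  have e₂ : ∀ k ω, X k ω i * (θ ⬝ᵥ X k ω)
      = S ^ 2 * l2Norm θ * (X k ω i / S * (θ ⬝ᵥ X k ω / (S * l2Norm θ))) := fun k ω => by
    rcases eq_or_ne (l2Norm θ) 0 with h0 | h0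
    · have : θ = 0 := dotProduct_self_eq_zero.1 (by rw [← l2Norm_sq, h0]; norm_num)
      simp [this]
    · field_simp
  set A₁ := ∑ k, (Y k ω / α * (X k ω i / S) - ∫ ω, Y k ω / α * (X k ω i / S) ∂μ)
  set A₂ := ∑ k, (X k ω i / S * (θ ⬝ᵥ X k ω / (S * l2Norm θ))
    - ∫ ω, X k ω i / S * (θ ⬝ᵥ X k ω / (S * l2Norm θ)) ∂μ)
  have s₁ : ∑ k, Y k ω * X k ω i = α * S * A₁ + ∑ k, ∫ ω, Y k ω * X k ω i ∂μ := by
    simp only [e₁, integral_const_mul, ← Finset.mul_sum, A₁, Finset.sum_sub_distrib]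
    ring
  have s₂ : ∑ k, X k ω i * (θ ⬝ᵥ X k ω)
      = S ^ 2 * l2Norm θ * A₂ + ∑ k, ∫ ω, X k ω i * (θ ⬝ᵥ X k ω) ∂μ := by
    simp only [e₂, integral_const_mul, ← Finset.mul_sum, A₂, Finset.sum_sub_distrib]
    ring
  have s₃ : ∀ k, ∫ ω, X k ω i * (θ ⬝ᵥ X k ω) ∂μ
      = (secondMoment μ (x k) *ᵥ θ) i + Δb ^ 2 / 4 * θ i := fun k => by
    simpa using h.integral_covariate_dotProduct hσ hΔb (hψ k) (Pi.single i 1) θ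
  set B := ∑ k, (∫ ω, Y k ω * X k ω i ∂μ - (secondMoment μ (x k) *ᵥ θ) i) with hB
  have hBle : |B| ≤ n * β := by
    calc |B| ≤ ∑ k : Fin n, |∫ ω, Y k ω * X k ω i ∂μ - (secondMoment μ (x k) *ᵥ θ) i| :=
          Finset.abs_sum_le_sum_abs _ _
      _ ≤ ∑ _k : Fin n, β := Finset.sum_le_sum fun k _ => hβ k
      _ = n * β := by simp
  -- The shift `Δb² / 4 * θ i` in the mean of the Gram term is the one that `matQ` subtracts, so the
  -- means cancel up to the bias `B`.
  have hmain : vecB (fun k => X k ω) (fun k => Y k ω) i - (matQ Δb (fun k => X k ω) *ᵥ θ) i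
      = (α * S * A₁ - S ^ 2 * l2Norm θ * A₂ + B) / n := by
    rw [vecB_apply, matQ_mulVec, s₁, s₂]
    simp only [s₃, Finset.sum_add_distrib, Finset.sum_const, Finset.card_univ, Fintype.card_fin,
      nsmul_eq_mul, hB, Finset.sum_sub_distrib]
    field_simp
    ring
  rw [hmain, abs_div, abs_of_pos hn', div_le_iff₀ hn']
  calc |α * S * A₁ - S ^ 2 * l2Norm θ * A₂ + B|
      ≤ |α * S * A₁| + |S ^ 2 * l2Norm θ * A₂| + |B| :=
        (abs_add_le _ _).trans (by gcongr; exact abs_sub _ _)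
    _ = α * S * |A₁| + S ^ 2 * l2Norm θ * |A₂| + |B| := by
        rw [abs_mul (α * S), abs_mul (S ^ 2 * l2Norm θ), abs_of_pos (by positivity : 0 < α * S),
          abs_of_nonneg (by positivity : 0 ≤ S ^ 2 * l2Norm θ)]
    _ ≤ α * S * (n * u₁) + S ^ 2 * l2Norm θ * (n * u₂) + n * β := by gcongr
    _ = _ := by ring

/-- The quadratic form of the empirical matrix at a vector where its lower tail is controlled. -/
lemma le_dotProduct_matQ (h : SamplingScheme μ Δ Δb x ε φ τ) (hσ : 0 < σ) (hΔb : 0 ≤ Δb)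
    (hψ : ∀ k, psi2NormVec μ (x k) ≤ ENNReal.ofReal σ) (hn : 0 < n) {κ₀ κ₁ : ℝ}
    (hspec : ∀ k, ∀ ev ∈ spectrum ℝ (secondMoment μ (x k)), κ₀ ≤ ev ∧ ev ≤ κ₁)
    (v : Fin d → ℝ) (ω : Ω)
    (hω : -(n * (κ₀ / 2 * (v ⬝ᵥ v))) ≤ ∑ k, ((v ⬝ᵥ quantizedCovariate Δb (x k ω) (τ k ω)) ^ 2
      - ∫ ω, (v ⬝ᵥ quantizedCovariate Δb (x k ω) (τ k ω)) ^ 2 ∂μ)) :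
    κ₀ / 2 * (v ⬝ᵥ v)
      ≤ v ⬝ᵥ matQ Δb (fun k => quantizedCovariate Δb (x k ω) (τ k ω)) *ᵥ v := by
  have hn' : (0 : ℝ) < n := by exact_mod_cast hn
  have hmean : ∀ k, κ₀ * (v ⬝ᵥ v) + Δb ^ 2 / 4 * (v ⬝ᵥ v)
      ≤ ∫ ω, (v ⬝ᵥ quantizedCovariate Δb (x k ω) (τ k ω)) ^ 2 ∂μ := fun k => by
    simp only [sq (v ⬝ᵥ _)]
    rw [h.integral_covariate_dotProduct hσ hΔb (hψ k) v v]
    linarith [dotProduct_secondMoment_ge (hspec k) v]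
  have hsum : n * (κ₀ * (v ⬝ᵥ v) + Δb ^ 2 / 4 * (v ⬝ᵥ v))
      ≤ ∑ k, ∫ ω, (v ⬝ᵥ quantizedCovariate Δb (x k ω) (τ k ω)) ^ 2 ∂μ := by
    calc _ = ∑ _k : Fin n, (κ₀ * (v ⬝ᵥ v) + Δb ^ 2 / 4 * (v ⬝ᵥ v)) := by simp [mul_add]
      _ ≤ _ := Finset.sum_le_sum fun k _ => hmean k
  rw [Finset.sum_sub_distrib] at hω
  rw [dotProduct_matQ_mulVec, ← sub_nonneg]
  have : (1 / (n : ℝ)) * ∑ k, (v ⬝ᵥ quantizedCovariate Δb (x k ω) (τ k ω)) ^ 2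
      - Δb ^ 2 / 4 * (v ⬝ᵥ v) - κ₀ / 2 * (v ⬝ᵥ v)
      = (∑ k, (v ⬝ᵥ quantizedCovariate Δb (x k ω) (τ k ω)) ^ 2
        - n * (Δb ^ 2 / 4 * (v ⬝ᵥ v) + κ₀ / 2 * (v ⬝ᵥ v))) / n := by
    field_simp
    ring
  rw [this]
  refine div_nonneg ?_ hn'.le
  linarith

/-- A coordinate has second moment at most `S² E exp (x² / S²) ≤ 4 S²`. The resulting `√κ₀ ≤ 2 S`
lets gradient terms of order `S` be absorbed into `S² / √κ₀`, the form of `lam`. -/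
lemma kappa_le (h : SamplingScheme μ Δ Δb x ε φ τ) (hσ : 0 < σ) (hΔb : 0 ≤ Δb) {k : Fin n}
    (hψ : psi2NormVec μ (x k) ≤ ENNReal.ofReal σ) {κ₀ κ₁ : ℝ}
    (hspec : ∀ ev ∈ spectrum ℝ (secondMoment μ (x k)), κ₀ ≤ ev ∧ ev ≤ κ₁) (i : Fin d) :
    κ₀ ≤ 4 * subgScale σ Δb ^ 2 := by
  have hS0 : 0 < subgScale σ Δb := subgScale_pos hσ hΔb
  have hm := measurable_pi_iff.1 (h.measurable_x k) i
  have h1 := dotProduct_secondMoment_ge hspec (Pi.single i 1)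
  have h2 : κ₀ ≤ ∫ ω, x k ω i ^ 2 ∂μ := by
    simpa [secondMoment, sq] using h1
  refine h2.trans (integral_le_of_lintegral_ofReal_le (hm.pow_const 2) (fun _ => sq_nonneg _)
    (by positivity) ?_)
  calc _ ≤ ∫⁻ ω, ENNReal.ofReal (subgScale σ Δb ^ 2)
        * ENNReal.ofReal (Real.exp ((x k ω i / subgScale σ Δb) ^ 2)) ∂μ := by
        refine lintegral_mono fun ω => ?_
        rw [← ENNReal.ofReal_mul (by positivity)]
        refine ENNReal.ofReal_le_ofReal ?_
        have := Real.add_one_le_exp ((x k ω i / subgScale σ Δb) ^ 2)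
        calc x k ω i ^ 2 = subgScale σ Δb ^ 2 * (x k ω i / subgScale σ Δb) ^ 2 := by field_simp
          _ ≤ _ := by gcongr; linarith
    _ = ENNReal.ofReal (subgScale σ Δb ^ 2)
        * ∫⁻ ω, ENNReal.ofReal (Real.exp ((x k ω i / subgScale σ Δb) ^ 2)) ∂μ :=
        lintegral_const_mul' _ _ ENNReal.ofReal_ne_top
    _ ≤ ENNReal.ofReal (subgScale σ Δb ^ 2) * 4 := by
        gcongr; exact lintegral_exp_signal_apply hσ hΔb hψ i
    _ = _ := by
        rw [show (4 : ℝ≥0∞) = ENNReal.ofReal 4 by norm_num, ← ENNReal.ofReal_mul (by positivity),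
          mul_comm]

/-- The event on which the gradient at the true parameter is small and the empirical matrix is
strongly convex in a restricted sense. -/
lemma exists_good_event (h : SamplingScheme μ Δ Δb x ε φ τ) (hσ : 0 < σ) (hΔ : 0 ≤ Δ)
    (hΔb : 0 ≤ Δb) (hψ : ∀ k, psi2NormVec μ (x k) ≤ ENNReal.ofReal σ)
    (hx0 : ∀ k i, ∫ ω, x k ω i ∂μ = 0) {κ₀ κ₁ : ℝ} (hκ₀ : 0 < κ₀)
    (hspec : ∀ k, ∀ ev ∈ spectrum ℝ (secondMoment μ (x k)), κ₀ ≤ ev ∧ ev ≤ κ₁)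
    (hl : 1 < l) (hM : 0 < M)
    (Hy : ∀ k, ∫⁻ ω, ENNReal.ofReal (|response θ (x k) (ε k) ω| ^ (2 * l)) ∂μ ≤ ENNReal.ofReal M)
    (hn : 0 < n) (hd : 0 < d) {ζ B ρ : ℝ} (hζ : 0 < ζ) (hB : 0 ≤ B) (hρ : 0 ≤ ρ) (hρ1 : ρ ≤ 1 / 2)
    (hρζ : ρ * ζ ≤ B * M ^ (1 / (2 * l)))
    (hbias : (M ^ (1 / (2 * l)) / ζ) ^ l * biasConst l ≤ ρ) {m : ℕ} (hm : 1 < m)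
    (hcard : m * Real.log (2 * d) + n * ρ ^ 2 ≤ n * (κ₀ ^ 2 / (128 * subgScale σ Δb ^ 4))) :
    ∃ E : Set Ω, MeasurableSet E ∧ 1 - 6 * (d * Real.exp (-(n * ρ ^ 2))) ≤ μ.real E ∧
      ∀ ω ∈ E,
        (∀ i, |vecB (fun k => quantizedCovariate Δb (x k ω) (τ k ω))
            (fun k => quantizedResponse Δ ζ (response θ (x k) (ε k) ω) (φ k ω)) i
          - (matQ Δb (fun k => quantizedCovariate Δb (x k ω) (τ k ω)) *ᵥ θ) i|
          ≤ (Δ + M ^ (1 / (2 * l))) * subgScale σ Δb * (ρ * (B + 1 + momentConst l))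
            + subgScale σ Δb ^ 2 * l2Norm θ * (33 * ρ)
            + M ^ (1 / (2 * l)) * subgScale σ Δb * ρ) ∧
        ∀ v : Fin d → ℝ, κ₀ / 2 * (v ⬝ᵥ v) - 3 * subgScale σ Δb ^ 2 / (m - 1) * l1Norm v ^ 2
          ≤ v ⬝ᵥ matQ Δb (fun k => quantizedCovariate Δb (x k ω) (τ k ω)) *ᵥ v := by
  have hm0 : 0 < M ^ (1 / (2 * l)) := by positivity
  have hS0 : 0 < subgScale σ Δb := subgScale_pos hσ hΔb
  set X : Fin n → Ω → Fin d → ℝ := fun k ω => quantizedCovariate Δb (x k ω) (τ k ω) with hX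
  set Y : Fin n → Ω → ℝ := fun k ω => quantizedResponse Δ ζ (response θ (x k) (ε k) ω) (φ k ω)
    with hY
  have hXm : ∀ k i, Measurable fun ω => X k ω i := h.measurable_covariate_apply
  have hXv : ∀ k v, Measurable fun ω => v ⬝ᵥ X k ω := fun k v =>
    measurable_dotProduct_const (h.measurable_covariate k) v
  have hYm : ∀ k, Measurable (Y k) := h.measurable_quantizedResponse hζ.le
  have hcross := h.measureReal_cross_ge_le (θ := θ) hσ hΔ hΔb hψ hl hM hζ.le hB hρ (by linarith)
    hρζ Hy
  set S := subgScale σ Δb with hS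
  set α := Δ + M ^ (1 / (2 * l)) with hα
  have hα0 : 0 < α := by positivity
  set A₁ : Fin d → Set Ω := fun i => {ω | n * (ρ * (B + 1 + momentConst l)) ≤
    |∑ k, (Y k ω / α * (X k ω i / S) - ∫ ω, Y k ω / α * (X k ω i / S) ∂μ)|} with hA₁
  set A₂ : Fin d → Set Ω := fun i => {ω | n * (33 * ρ) ≤
    |∑ k, (X k ω i / S * (θ ⬝ᵥ X k ω / (S * l2Norm θ))
      - ∫ ω, X k ω i / S * (θ ⬝ᵥ X k ω / (S * l2Norm θ)) ∂μ)|} with hA₂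
  set A₃ : Fin d → Set Ω := fun i => {ω | n * 3 ≤ ∑ k, (X k ω i / S) ^ 2} with hA₃
  set z : (Fin m → Fin d × Bool) → Fin d → ℝ := fun J => ∑ i, signedBasis (J i) with hz
  set A₄ : (Fin m → Fin d × Bool) → Set Ω := fun J => {ω | ∑ k, ((z J ⬝ᵥ X k ω) ^ 2
    - ∫ ω, (z J ⬝ᵥ X k ω) ^ 2 ∂μ) < -(n * (κ₀ / 2 * (z J ⬝ᵥ z J)))} with hA₄
  have m₁ : ∀ i, MeasurableSet (A₁ i) := fun i => measurableSet_le (by fun_prop) (by fun_prop)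
  have m₂ : ∀ i, MeasurableSet (A₂ i) := fun i => measurableSet_le (by fun_prop) (by fun_prop)
  have m₃ : ∀ i, MeasurableSet (A₃ i) := fun i => measurableSet_le (by fun_prop) (by fun_prop)
  have m₄ : ∀ J, MeasurableSet (A₄ J) := fun J => measurableSet_lt (by fun_prop) (by fun_prop)
  set e := Real.exp (-(n * ρ ^ 2)) with he
  have p₁ : ∀ i, μ.real (A₁ i) ≤ 2 * e := fun i => (hcross i).2
  have p₂ : ∀ i, μ.real (A₂ i) ≤ 2 * e := h.measureReal_gram_ge_le hσ hΔb hψ hρ hρ1 θ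
  have p₃ : ∀ i, μ.real (A₃ i) ≤ e := fun i => by
    refine (h.measureReal_diag_ge_le hσ hΔb hψ i).trans (Real.exp_le_exp.2 (neg_le_neg ?_))
    have : ρ ^ 2 ≤ 1 := by nlinarith
    exact mul_le_of_le_one_right (Nat.cast_nonneg n) this
  have p₄ : ∀ J, μ.real (A₄ J) ≤ Real.exp (-(n * (κ₀ ^ 2 / (128 * S ^ 4)))) := fun J => by
    refine (h.measureReal_quadraticForm_lt_le hσ hΔb hψ (half_pos hκ₀) (z J)).trans_eq ?_
    congr 3
    rw [← hS]
    ring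
  have hd' : (1 : ℝ) ≤ d := by exact_mod_cast hd
  -- There are `(2 d) ^ m` index tuples; `hcard` lets the exponential rate pay for their logarithm
  -- and still leave `n ρ²`.
  have q₄ : ∑ J, μ.real (A₄ J) ≤ e := by
    calc _ ≤ ∑ _J : Fin m → Fin d × Bool, Real.exp (-(n * (κ₀ ^ 2 / (128 * S ^ 4)))) :=
          Finset.sum_le_sum fun J _ => p₄ J
      _ = (2 * d : ℝ) ^ m * Real.exp (-(n * (κ₀ ^ 2 / (128 * S ^ 4)))) := by
          simp [mul_comm]
      _ = Real.exp (m * Real.log (2 * d) - n * (κ₀ ^ 2 / (128 * S ^ 4))) := by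
          rw [sub_eq_add_neg, Real.exp_add, Real.exp_nat_mul, Real.exp_log (by positivity)]
      _ ≤ e := Real.exp_le_exp.2 (by linarith)
  set bad := (⋃ i, A₁ i ∪ A₂ i ∪ A₃ i) ∪ ⋃ J, A₄ J with hbad
  have hbadm : MeasurableSet bad :=
    (MeasurableSet.iUnion fun i => ((m₁ i).union (m₂ i)).union (m₃ i)).union
      (MeasurableSet.iUnion m₄)
  have he0 : 0 < e := Real.exp_pos _
  -- Each coordinate costs `2 + 2 + 1`; the Maurey event costs one more `e`, at most `d * e`.
  have hbadle : μ.real bad ≤ 6 * (d * e) := by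
    calc μ.real bad ≤ μ.real (⋃ i, A₁ i ∪ A₂ i ∪ A₃ i) + μ.real (⋃ J, A₄ J) :=
          measureReal_union_le _ _
      _ ≤ ∑ i, μ.real (A₁ i ∪ A₂ i ∪ A₃ i) + ∑ J, μ.real (A₄ J) :=
          add_le_add (measureReal_iUnion_fintype_le _) (measureReal_iUnion_fintype_le _)
      _ ≤ ∑ _i : Fin d, (2 * e + 2 * e + e) + e := by
          refine add_le_add (Finset.sum_le_sum fun i _ => ?_) q₄
          have h1 := measureReal_union_le (μ := μ) (A₁ i ∪ A₂ i) (A₃ i)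
          have h2 := measureReal_union_le (μ := μ) (A₁ i) (A₂ i)
          linarith [p₁ i, p₂ i, p₃ i]
      _ = 5 * (d * e) + e := by simp; ring
      _ ≤ 6 * (d * e) := by nlinarith
  refine ⟨badᶜ, hbadm.compl, ?_, fun ω hω => ?_⟩
  · rw [probReal_compl_eq_one_sub hbadm]
    linarith
  · have hω' : (∀ i, (ω ∉ A₁ i ∧ ω ∉ A₂ i) ∧ ω ∉ A₃ i) ∧ ∀ J, ω ∉ A₄ J := by
      simpa [hbad, not_or] using hω
    refine ⟨fun i => ?_, fun v => ?_⟩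
    · refine h.abs_gradient_le hσ hΔb hψ hn hα0 i ω (fun k => ?_)
        (le_of_not_ge (hω'.1 i).1.1) (le_of_not_ge (hω'.1 i).1.2)
      rw [h.integral_response_mul_covariate hΔ hΔb hζ.le θ k i ((hcross i).1 k)]
      refine (h.abs_integral_truncate_sub_le hσ hΔb (hψ k) (hx0 k) hl hM hζ (Hy k) i).trans ?_
      rw [mul_assoc]
      exact mul_le_mul_of_nonneg_left hbias (by positivity)
    · exact restricted_strong_convexity _ (half_pos hκ₀).le
        (fun i => matQ_diag_le hσ hΔb hn i ω (le_of_not_ge (hω'.1 i).2)) hm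
        (fun J => h.le_dotProduct_matQ hσ hΔb hψ hn hspec (z J) ω (le_of_not_gt (hω'.2 J))) v

end SamplingScheme

end QCS

/-! ### Choice of threshold, atoms and regularization -/

namespace QCS

lemma l1Norm_le_of_isSparse {d s : ℕ} {v : Fin d → ℝ} (hs : IsSparse s v) :
    l1Norm v ≤ √s * l2Norm v := by
  set S := Finset.univ.filter fun i => v i ≠ 0
  have h0 : l1Norm v = ∑ i ∈ S, |v i| := by
    refine (Finset.sum_subset (Finset.subset_univ _) fun i _ hi => ?_).symm
    have : v i = 0 := by simpa [S] using hi
    simp [this]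
  have h1 : (∑ i ∈ S, |v i|) ^ 2 ≤ S.card * ∑ i ∈ S, |v i| ^ 2 := sq_sum_le_card_mul_sum_sq
  have h2 : ∑ i ∈ S, |v i| ^ 2 ≤ l2Norm v ^ 2 := by
    rw [l2Norm_sq, dotProduct]
    calc ∑ i ∈ S, |v i| ^ 2 ≤ ∑ i, |v i| ^ 2 :=
          Finset.sum_le_sum_of_subset_of_nonneg (Finset.subset_univ _) fun _ _ _ => sq_nonneg _
      _ = _ := Finset.sum_congr rfl fun i _ => by rw [sq_abs]; ring
  have h3 : (S.card : ℝ) ≤ s := by exact_mod_cast hs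
  have h5 : 0 ≤ l2Norm v := Real.sqrt_nonneg _
  have h4 : l1Norm v ^ 2 ≤ (√s * l2Norm v) ^ 2 := by
    rw [mul_pow, Real.sq_sqrt (Nat.cast_nonneg s), h0]
    calc _ ≤ S.card * ∑ i ∈ S, |v i| ^ 2 := h1
      _ ≤ s * l2Norm v ^ 2 := by gcongr
  exact (abs_le_of_sq_le_sq' h4 (by positivity)).2

lemma eq_zero_of_l1Norm_le {d : ℕ} {v : Fin d → ℝ} (h : l1Norm v ≤ 0) : v = 0 := by
  ext i
  have h0 := le_antisymm h (l1Norm_nonneg v)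
  have := (Finset.sum_eq_zero_iff_of_nonneg fun i _ => abs_nonneg (v i)).1 h0 i (Finset.mem_univ i)
  simpa using this

/-- The consequences of the choice of the truncation threshold. -/
lemma threshold_bounds {l a b M σ D W N L ζ : ℝ} (hl : 1 < l) (ha : 0 < a)
    (hM : 0 < M) (hσ : 0 < σ) (hD : 0 ≤ D) (hDW : D ≤ W) (hN : 0 < N) (hL : 0 < L) (hb : 0 < b)
    (h₁ : a * √(σ * M ^ (1 / l) / (σ + D) * (N / L)) ≤ ζ)
    (h₂ : ζ ≤ b * √(σ * M ^ (1 / l) / (σ + D) * (N / L))) :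
    0 < ζ ∧ √(L / N) * ζ ≤ b * M ^ (1 / (2 * l)) ∧
      M ^ (1 / (2 * l)) / ζ ≤ √((σ + W) / σ) / a * √(L / N) := by
  set m := M ^ (1 / (2 * l)) with hm
  have hm0 : 0 < m := by positivity
  have hmsq : M ^ (1 / l) = m ^ 2 := by
    rw [hm, ← Real.rpow_natCast, ← Real.rpow_mul hM.le]
    congr 1
    push_cast
    field_simp
  set r := √(L / N) with hr
  have hr0 : 0 < r := Real.sqrt_pos.2 (by positivity)
  set t := √(σ / (σ + D)) with ht
  have ht0 : 0 < t := Real.sqrt_pos.2 (by positivity)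
  have ht1 : t ≤ 1 := by
    exact Real.sqrt_le_one.2 ((div_le_one (by positivity)).2 (by linarith))
  -- The factor `t` is at most 1, so the upper bound on `ζ` is free of the problem parameters. Its
  -- lower bound, through `W` dominating `D`, enters only the bias.
  have hroot : √(σ * M ^ (1 / l) / (σ + D) * (N / L)) = m * t / r := by
    rw [Real.sqrt_eq_iff_mul_self_eq_of_pos (by positivity), hmsq]
    have h1 : r * r = L / N := Real.mul_self_sqrt (by positivity)
    have h2 : t * t = σ / (σ + D) := Real.mul_self_sqrt (by positivity)
    calc m * t / r * (m * t / r) = m ^ 2 * (t * t) / (r * r) := by ring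
      _ = _ := by rw [h1, h2]; field_simp
  rw [hroot] at h₁ h₂
  have hζ : 0 < ζ := lt_of_lt_of_le (by positivity) h₁
  refine ⟨hζ, ?_, ?_⟩
  · calc r * ζ ≤ r * (b * (m * t / r)) := by gcongr
      _ = b * m * t := by field_simp
      _ ≤ b * m := mul_le_of_le_one_right (by positivity) ht1
  · have h3 : 1 ≤ √((σ + W) / σ) * t := by
      rw [ht, ← Real.sqrt_mul (by have := hD.trans hDW; positivity), Real.one_le_sqrt]
      rw [div_mul_div_comm, mul_comm σ, one_le_div (by positivity)]
      gcongr
    rw [div_le_iff₀ hζ]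
    calc m ≤ √((σ + W) / σ) * t * m := le_mul_of_one_le_left hm0.le h3
      _ = √((σ + W) / σ) / a * r * (a * (m * t / r)) := by field_simp
      _ ≤ _ := by gcongr

/-- The bias is of order `r ^ l = r ^ (l - 1) * r`; since `l > 1`, a small `r` makes the first
factor absorb every constant. -/
lemma rpow_mul_le_self {l A K r z : ℝ} (hl : 1 < l) (hA : 0 < A) (hK : 0 < K) (hr : 0 < r)
    (hz : 0 ≤ z) (hzr : z ≤ A * r) (h : r ≤ (A ^ l * K) ^ (-(1 / (l - 1)))) : z ^ l * K ≤ r := by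
  have hl1 : 0 < l - 1 := by linarith
  have h1 : r ^ (l - 1) ≤ (A ^ l * K)⁻¹ := by
    calc r ^ (l - 1) ≤ ((A ^ l * K) ^ (-(1 / (l - 1)))) ^ (l - 1) :=
          Real.rpow_le_rpow hr.le h hl1.le
      _ = _ := by
        rw [← Real.rpow_mul (by positivity), neg_mul, one_div_mul_cancel hl1.ne', Real.rpow_neg_one]
  calc z ^ l * K ≤ (A * r) ^ l * K := by gcongr
    _ = A ^ l * K * r ^ (l - 1) * r := by
      have : r ^ l = r ^ (l - 1) * r := by
        nth_rewrite 3 [← Real.rpow_one r]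
        rw [← Real.rpow_add hr]; congr 1; ring
      rw [Real.mul_rpow hA.le hr.le, this]; ring
    _ ≤ A ^ l * K * (A ^ l * K)⁻¹ * r := by gcongr
    _ = r := by rw [mul_inv_cancel₀ (by positivity), one_mul]

/-- The choice of the number of terms in Maurey's empirical method. -/
lemma exists_maurey_length {γ lg L N : ℝ} (hγ : 0 < γ) (hlg : 0 < lg) (hN : 16 * lg / γ ≤ N)
    (hL : 2 * L / γ ≤ N) :
    ∃ m : ℕ, 1 < m ∧ 2 * (m * lg) + L ≤ N * γ ∧ 1 / ((m : ℝ) - 1) ≤ 8 * lg / (γ * N) := by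
  rw [div_le_iff₀ hγ] at hN hL
  have hN0 : 0 < N := pos_of_mul_pos_left (lt_of_lt_of_le (by positivity) hN) hγ.le
  -- The number of atoms is `⌊y⌋₊`: half of `N γ` pays for the count and half for `L`. The condition
  -- `y ≥ 4` gives `⌊y⌋₊ - 1 > y - 2 ≥ y / 2`.
  set y := γ * N / (4 * lg) with hy
  have hy4 : 4 ≤ y := by rw [hy, le_div_iff₀ (by positivity)]; linarith
  have h1 : (⌊y⌋₊ : ℝ) ≤ y := Nat.floor_le (by linarith)
  have h2 : y < ⌊y⌋₊ + 1 := Nat.lt_floor_add_one y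
  have hylg : y * lg = γ * N / 4 := by rw [hy]; field_simp
  refine ⟨⌊y⌋₊, ?_, ?_, ?_⟩
  · have : (1 : ℝ) < ⌊y⌋₊ := by linarith
    exact_mod_cast this
  · have := mul_le_mul_of_nonneg_right h1 hlg.le
    linarith
  · have h3 : 8 * lg / (γ * N) = 1 / (y / 2) := by rw [hy]; field_simp; norm_num
    rw [h3]
    exact one_div_le_one_div_of_le (by linarith) (by linarith)

/-- The regularization parameter dominates the gradient at the true parameter. -/
lemma gradient_bound_le_half {Δ m S r q T b G C₁ : ℝ} (hΔ : 0 ≤ Δ) (hm : 0 < m) (hS : 0 < S)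
    (hr : 0 ≤ r) (hq : 0 < q) (hqS : q ≤ 2 * S) (hqT : q * T ≤ 2 * m)
    (hbG : 0 ≤ b + 1 + G) (hC₁ : 18 * (2 * (b + 1 + G) + 68) ≤ C₁) :
    (Δ + m) * S * (r * (b + 1 + G)) + S ^ 2 * T * (33 * r) + m * S * r
      ≤ C₁ * ((S / 3) ^ 2 / q) * (Δ + m) * r / 2 := by
  have h1 : q * ((Δ + m) * S * (r * (b + 1 + G))) ≤ (Δ + m) * S * (r * (b + 1 + G)) * (2 * S) := by
    rw [mul_comm]; gcongr
  have h2 : q * (S ^ 2 * T * (33 * r)) ≤ S ^ 2 * (33 * r) * (2 * m) := by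
    calc _ = S ^ 2 * (33 * r) * (q * T) := by ring
      _ ≤ _ := by gcongr
  have h3 : q * (m * S * r) ≤ m * S * r * (2 * S) := by rw [mul_comm]; gcongr
  -- After multiplication by `q`, the Gram term contributes `66 = 33 · 2` and the bias 2; `18` comes
  -- from `(S / 3) ^ 2` and the final halving.
  have h4 : (Δ + m) * S ^ 2 * r * (2 * (b + 1 + G) + 68) ≤ (Δ + m) * S ^ 2 * r * (C₁ / 18) := by
    gcongr; linarith
  have h5 : 0 ≤ Δ * S ^ 2 * r := by positivity
  have h6 : C₁ * ((S / 3) ^ 2 / q) * (Δ + m) * r / 2 = (Δ + m) * S ^ 2 * r * (C₁ / 18) / q := by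
    field_simp; ring
  rw [h6, le_div_iff₀ hq]
  nlinarith [h1, h2, h3, h4, h5]

/-- The sample-size condition reads `r² s ≤ 1 / c`, so each summand `(ρ²)⁻¹` of `c` buys one
smallness condition. -/
lemma le_of_sq_mul_le_inv {r s c ρ : ℝ} (hs : 1 ≤ s) (hρ : 0 < ρ)
    (hc : (ρ ^ 2)⁻¹ ≤ c) (h : r ^ 2 * s ≤ 1 / c) : r * √s ≤ ρ ∧ r ≤ ρ := by
  have hc' : 1 / c ≤ ρ ^ 2 := by
    rw [one_div]
    exact inv_le_of_inv_le₀ (by positivity) hc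
  have h1 : r ^ 2 ≤ ρ ^ 2 := by nlinarith [sq_nonneg r]
  have h2 : (r * √s) ^ 2 ≤ ρ ^ 2 := by
    rw [mul_pow, Real.sq_sqrt (by linarith)]; linarith
  exact ⟨(abs_le_of_sq_le_sq' h2 hρ.le).2, (abs_le_of_sq_le_sq' h1 hρ.le).2⟩

end QCS

/-! ### Assembly and constants -/

theorem theorem4p1 :
    ∃ C₂ C₃ : ℝ, 0 < C₂ ∧ 0 < C₃ ∧
    ∀ l a b : ℝ, 1 < l → 0 < a → a ≤ b →
    ∃ C₀ : ℝ, 0 < C₀ ∧ ∀ C₁ : ℝ, C₀ ≤ C₁ →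
    ∃ C C' : ℝ, 0 < C ∧ 0 < C' ∧
    ∀ κ₀ σ Δ Δb M R : ℝ, 0 < κ₀ → 0 < σ → 0 ≤ Δ → 0 ≤ Δb → 0 < M → 0 < R →
    ∃ c : ℝ, 0 < c ∧
    ∀ (n d s : ℕ) (δ κ₁ D ζ lam : ℝ) (θs : Fin d → ℝ)
      (Ω : Type*) [MeasurableSpace Ω] (μ : Measure Ω) [IsProbabilityMeasure μ]
      (x : Fin n → Ω → Fin d → ℝ) (ε φ : Fin n → Ω → ℝ) (τ : Fin n → Ω → Fin d → ℝ),
      2 ≤ d → 0 < δ → κ₀ < κ₁ →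
      QCS.SamplingScheme μ Δ Δb x ε φ τ →
      (∀ k i, ∫ ω, x k ω i ∂μ = 0) →
      (∀ k, QCS.psi2NormVec μ (x k) ≤ ENNReal.ofReal σ) →
      (∀ k, ∀ ev ∈ spectrum ℝ (QCS.secondMoment μ (x k)), κ₀ ≤ ev ∧ ev ≤ κ₁) →
      QCS.IsSparse s θs →
      QCS.l2Norm θs ≤ R →
      (∀ k, ∫⁻ ω, ENNReal.ofReal (|QCS.response θs (x k) (ε k) ω| ^ (2 * l)) ∂μ
        ≤ ENNReal.ofReal M) →
      (D = Δ ∨ D = Δb) →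
      a * Real.sqrt (σ * M ^ (1 / l) / (σ + D) * (n / (δ * Real.log d))) ≤ ζ →
      ζ ≤ b * Real.sqrt (σ * M ^ (1 / l) / (σ + D) * (n / (δ * Real.log d))) →
      lam = C₁ * ((σ + Δb) ^ 2 / Real.sqrt κ₀) * (Δ + M ^ (1 / (2 * l)))
        * Real.sqrt (δ * Real.log d / n) →
      c * (δ * s * Real.log d) ≤ n →
      ∃ E : Set Ω, MeasurableSet E ∧
        1 - 8 * (d : ℝ) ^ (1 - δ) - C₂ * Real.exp (-(C₃ * n)) ≤ μ.real E ∧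
        ∀ ω ∈ E, ∀ θ : Fin d → ℝ,
          QCS.IsStationary
            (QCS.matQ Δb (fun k => QCS.quantizedCovariate Δb (x k ω) (τ k ω)))
            (QCS.vecB (fun k => QCS.quantizedCovariate Δb (x k ω) (τ k ω))
              (fun k => QCS.quantizedResponse Δ ζ (QCS.response θs (x k) (ε k) ω) (φ k ω)))
            lam (R * Real.sqrt s) θ →
          QCS.l2Norm (θ - θs)
              ≤ C * QCS.errorFactor l κ₀ σ Δ Δb M * Real.sqrt (δ * s * Real.log d / n) ∧
          QCS.l1Norm (θ - θs)
              ≤ C' * QCS.errorFactor l κ₀ σ Δ Δb M * s * Real.sqrt (δ * Real.log d / n) := by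
  -- The exponential term is slack: the good event fails with probability at most `6 d ^ (1 - δ)`.
  refine ⟨1, 1, one_pos, one_pos, fun l a b hl ha hab => ?_⟩
  set G := QCS.momentConst l with hG
  have hG0 : 0 < G := by rw [hG]; unfold QCS.momentConst; positivity
  have hb : 0 < b := ha.trans_le hab
  refine ⟨18 * (2 * (b + 1 + G) + 68), by positivity, fun C₁ hC₁ => ?_⟩
  have hC₁0 : 0 < C₁ := lt_of_lt_of_le (by positivity) hC₁
  -- Twice the factors `7/4` and `14` of the deterministic bound, because its convexity constant is
  -- `κ₀ / 2`.
  refine ⟨7 / 2 * C₁, 28 * C₁, by positivity, by positivity, ?_⟩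
  intro κ₀ σ Δ Δb M R hκ₀ hσ hΔ hΔb hM hR
  set m := M ^ (1 / (2 * l)) with hm
  have hm0 : 0 < m := by positivity
  set S := QCS.subgScale σ Δb with hS
  have hS0 : 0 < S := QCS.subgScale_pos hσ hΔb
  have hS3 : S / 3 = σ + Δb := by rw [hS, QCS.subgScale]; ring
  set q := √κ₀ with hq
  have hq0 : 0 < q := Real.sqrt_pos.2 hκ₀
  have hqsq : q ^ 2 = κ₀ := Real.sq_sqrt hκ₀.le
  set γ := κ₀ ^ 2 / (128 * S ^ 4) with hγ
  have hγ0 : 0 < γ := by positivity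
  set A := √((σ + (Δ + Δb)) / σ) / a with hA
  have hA0 : 0 < A := by rw [hA]; positivity
  set K := QCS.biasConst l with hK
  have hK0 : 0 < K := QCS.biasConst_pos l
  -- Below `r₀` the truncation bias is at most `r`; below `r₁` (for `r √s`) the convexity defect is
  -- at most `lam / 4`. In `c`, the summand 4 gives `r ≤ 1/2` and `16 / γ` allows Maurey's length.
  set r₀ := (A ^ l * K) ^ (-(1 / (l - 1))) with hr₀
  have hr₀0 : 0 < r₀ := by positivity
  set r₁ := C₁ * γ * (S / 3) ^ 2 * (Δ + m) / (192 * S ^ 2 * R * q) with hr₁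
  have hr₁0 : 0 < r₁ := by positivity
  set c := 4 + (r₀ ^ 2)⁻¹ + (r₁ ^ 2)⁻¹ + 16 / γ with hc
  have hc0 : 0 < c := by positivity
  clear_value r₀ r₁ γ q c
  refine ⟨c, hc0, ?_⟩
  intro n d s δ κ₁ D ζ lam θs Ω _ μ _ x ε φ τ hd hδ hκ h hx0 hψ hspec hsp hθR Hy hD hζ₁ hζ₂ hlam hn
  have hd0 : 0 < d := by omega
  have hd1 : (1 : ℝ) < d := by exact_mod_cast hd
  have hF0 : 0 ≤ QCS.errorFactor l κ₀ σ Δ Δb M := by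
    unfold QCS.errorFactor; positivity
  -- For `s = 0` the feasible set is `{0}`, so nothing is random; this also disposes of `n = 0`.
  rcases Nat.eq_zero_or_pos s with rfl | hs
  · refine ⟨Set.univ, MeasurableSet.univ, ?_, fun ω _ θ hθ => ?_⟩
    · have h1 : 0 ≤ (d : ℝ) ^ (1 - δ) := by positivity
      have h2 := Real.exp_pos (-(1 * (n : ℝ)))
      rw [probReal_univ]
      linarith
    · have h1 : θ = 0 := QCS.eq_zero_of_l1Norm_le (by simpa using hθ.1)
      have h2 : θs = 0 := QCS.eq_zero_of_l1Norm_le (by simpa using QCS.l1Norm_le_of_isSparse hsp)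
      subst h1 h2
      simp [QCS.l2Norm, QCS.l1Norm]
  -- For `δ ≤ 1` the probability bound is vacuous; otherwise `log d ≤ L`, which the union bound over
  -- atoms uses.
  rcases le_or_gt δ 1 with hδ1 | hδ1
  · refine ⟨∅, MeasurableSet.empty, ?_, fun ω hω => absurd hω (Set.notMem_empty ω)⟩
    have h1 : 1 ≤ (d : ℝ) ^ (1 - δ) := Real.one_le_rpow hd1.le (by linarith)
    have h2 := Real.exp_pos (-(1 * (n : ℝ)))
    rw [measureReal_empty]
    linarith
  have hlg : 0 < Real.log d := Real.log_pos hd1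
  set L := δ * Real.log d with hL
  have hL0 : 0 < L := by positivity
  have hlgL : Real.log d ≤ L := le_mul_of_one_le_left hlg.le hδ1.le
  have hs1 : (1 : ℝ) ≤ s := by exact_mod_cast hs
  have hnLs : c * (L * s) ≤ n := by
    rw [hL]; calc _ = c * (δ * s * Real.log d) := by ring
      _ ≤ n := hn
  have hN0 : (0 : ℝ) < n := lt_of_lt_of_le (by positivity) hnLs
  have hn0 : 0 < n := by exact_mod_cast hN0
  have hcL : c * L ≤ n := by
    have : c * (L * 1) ≤ c * (L * s) := by gcongr
    linarith
  set r := √(L / n) with hr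
  have hr0 : 0 < r := Real.sqrt_pos.2 (by positivity)
  have hrsq : r ^ 2 = L / n := Real.sq_sqrt (by positivity)
  have hnr : n * r ^ 2 = L := by rw [hrsq]; field_simp
  have hrs : r ^ 2 * s ≤ 1 / c := by
    rw [hrsq, div_mul_eq_mul_div, div_le_div_iff₀ hN0 hc0]
    linarith
  have hi₀ : 0 < (r₀ ^ 2)⁻¹ := by positivity
  have hi₁ : 0 < (r₁ ^ 2)⁻¹ := by positivity
  have hi₂ : 0 < 16 / γ := by positivity
  have hr_half : r ≤ 1 / 2 :=
    (QCS.le_of_sq_mul_le_inv hs1 (by norm_num) (by norm_num; linarith) hrs).2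
  have hr_r₀ : r ≤ r₀ := (QCS.le_of_sq_mul_le_inv hs1 hr₀0 (by linarith) hrs).2
  have hr_r₁ : r * √s ≤ r₁ := (QCS.le_of_sq_mul_le_inv hs1 hr₁0 (by linarith) hrs).1
  have hD0 : 0 ≤ D := by rcases hD with rfl | rfl <;> assumption
  have hDW : D ≤ Δ + Δb := by rcases hD with rfl | rfl <;> linarith
  obtain ⟨hζ, hrζ, hmζ⟩ := QCS.threshold_bounds hl ha hM hσ hD0 hDW hN0 hL0 hb hζ₁ hζ₂
  have hbias : (m / ζ) ^ l * K ≤ r :=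
    QCS.rpow_mul_le_self hl hA0 hK0 hr0 (by positivity) hmζ (hr_r₀.trans_eq hr₀)
  have hcγ : 16 / γ * L ≤ n := le_trans (by gcongr; linarith) hcL
  obtain ⟨p, hp1, hpcard, hpinv⟩ := QCS.exists_maurey_length (γ := γ) (lg := Real.log d) (L := L)
    (N := n) hγ0 hlg
    (by
      calc 16 * Real.log d / γ = 16 / γ * Real.log d := by ring
        _ ≤ 16 / γ * L := by gcongr
        _ ≤ n := hcγ)
    (by
      calc 2 * L / γ = 2 / γ * L := by ring
        _ ≤ 16 / γ * L := by gcongr; norm_num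
        _ ≤ n := hcγ)
  have hlog2d : Real.log (2 * d) ≤ 2 * Real.log d := by
    rw [Real.log_mul (by norm_num) (by positivity)]
    have : Real.log 2 ≤ Real.log d := Real.log_le_log (by norm_num) (by exact_mod_cast hd)
    linarith
  have hcard : p * Real.log (2 * d) + n * r ^ 2 ≤ n * (κ₀ ^ 2 / (128 * S ^ 4)) := by
    rw [hnr, ← hγ]
    have : p * Real.log (2 * d) ≤ p * (2 * Real.log d) := by gcongr
    linarith
  obtain ⟨E, hEm, hEp, hE⟩ := h.exists_good_event hσ hΔ hΔb hψ hx0 hκ₀ hspec hl hM Hy hn0 hd0 hζ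
    hb.le hr0.le hr_half hrζ hbias hp1 hcard
  have hdexp : (d : ℝ) * Real.exp (-(n * r ^ 2)) = (d : ℝ) ^ (1 - δ) := by
    rw [hnr, hL, Real.rpow_def_of_pos (by linarith)]
    nth_rewrite 1 [← Real.exp_log (by linarith : (0 : ℝ) < d)]
    rw [← Real.exp_add]; congr 1; ring
  refine ⟨E, hEm, ?_, fun ω hω θ hθ => ?_⟩
  · have h1 : 0 ≤ (d : ℝ) ^ (1 - δ) := by positivity
    have h2 := Real.exp_pos (-(1 * (n : ℝ)))
    rw [hdexp] at hEp
    linarith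
  obtain ⟨hgrad, hrsc⟩ := hE ω hω
  have k₀ : Fin n := ⟨0, hn0⟩
  have hκS := h.kappa_le hσ hΔb (hψ k₀) (hspec k₀) ⟨0, hd0⟩
  have hqS : q ≤ 2 * S := by
    rw [hq]
    refine Real.sqrt_le_iff.2 ⟨by positivity, ?_⟩
    rw [mul_pow]; linarith
  -- The parameter is bounded through the response moments rather than by `R`, so `lam` and the
  -- error factor are free of `R`.
  have hqT : q * QCS.l2Norm θs ≤ 2 * m := by
    have h1 := h.dotProduct_self_le hσ hΔb (hψ k₀) (hx0 k₀) (hspec k₀) hl hM (Hy k₀)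
    have h2 : (q * QCS.l2Norm θs) ^ 2 ≤ (2 * m) ^ 2 := by
      rw [mul_pow, hqsq, QCS.l2Norm_sq]
      have h3 := sq_nonneg m
      rw [show (2 * m) ^ 2 = 4 * m ^ 2 by ring]
      exact h1.trans (by linarith)
    exact (abs_le_of_sq_le_sq' h2 (by positivity)).2
  rw [← hS3] at hlam
  have hlam0 : 0 < lam := by rw [hlam]; positivity
  have hgrad' := QCS.gradient_bound_le_half hΔ hm0 hS0 hr0.le hq0 hqS hqT
    (by positivity : 0 ≤ b + 1 + G) hC₁
  have hp1' : (1 : ℝ) < p := by exact_mod_cast hp1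
  have hfeas : QCS.l1Norm θs ≤ R * √s := by
    refine (QCS.l1Norm_le_of_isSparse hsp).trans ?_
    rw [mul_comm]; gcongr
  -- Here `1 / (p - 1)` is of order `r²`, and `r² √s = r (r √s)`: one `r` matches `lam`, and `r √s ≤
  -- r₁` absorbs `R` and the other constants.
  have hη : 3 * S ^ 2 / ((p : ℝ) - 1) * (2 * (R * √s)) ≤ lam / 4 := by
    have h1 : 1 / ((p : ℝ) - 1) ≤ 8 / γ * r ^ 2 := by
      refine hpinv.trans ?_
      rw [hrsq]
      calc 8 * Real.log d / (γ * n) ≤ 8 * L / (γ * n) := by gcongr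
        _ = _ := by field_simp
    calc 3 * S ^ 2 / ((p : ℝ) - 1) * (2 * (R * √s))
        = 6 * S ^ 2 * R * √s * (1 / ((p : ℝ) - 1)) := by ring
      _ ≤ 6 * S ^ 2 * R * √s * (8 / γ * r ^ 2) := by gcongr
      _ = 48 * S ^ 2 * R / γ * r * (r * √s) := by ring
      _ ≤ 48 * S ^ 2 * R / γ * r * r₁ := by gcongr
      _ = lam / 4 := by rw [hlam, hr₁]; field_simp; norm_num
  have herr := QCS.stationary_error_bound (κ := κ₀ / 2) (η := 3 * S ^ 2 / ((p : ℝ) - 1)) hlam0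
    (half_pos hκ₀) (div_nonneg (by positivity) (by linarith)) hθ hsp hfeas
    (fun i => (hgrad i).trans (hgrad'.trans_eq (by rw [hlam]))) hη hrsc
  have hlamF : lam / (κ₀ / 2) = 2 * C₁ * QCS.errorFactor l κ₀ σ Δ Δb M * r := by
    have h32 : κ₀ ^ (3 / 2 : ℝ) = κ₀ * q := by
      rw [hq, Real.sqrt_eq_rpow]
      nth_rewrite 2 [← Real.rpow_one κ₀]
      rw [← Real.rpow_add hκ₀]; norm_num
    rw [hlam, QCS.errorFactor, h32, hS3, ← hm]
    field_simp
  have hrs' : r * √s = √(δ * s * Real.log d / n) := by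
    rw [hr, ← Real.sqrt_mul (by positivity), hL]
    congr 1; ring
  rw [hlamF] at herr
  constructor
  · refine herr.1.trans_eq ?_
    rw [← hrs']; ring
  · refine herr.2.trans_eq ?_
    ring
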